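/- **Theorem (the jamming run-and-tumble process is a lift of sticky Brownian motion).** Let $\omega, L\in(0,\infty)$. *Sticky Brownian motion* on $[0,L]$ with parameter $\omega$ is the (existing and unique in law) $[0,L]$-valued Feller process whose $C^0$-generator, i.e. the generator of its transition semigroup on $C([0,L])$, is $$\mathcal L_{C^0}f=f'',\qquad \mathrm{Dom}(\mathcal L_{C^0})=\{f\in C^2([0,L]) : f''(0)=\omega f'(0),\ f''(L)=-\omega f'(L)\}.$$ The *jamming run-and-tumble (RTP) process* on $[0,L]$ with parameter $\omega$ is the process $(x(t),v(t))$ on $[0,L]\times\{-2,0,2\}$ in which $v$ is a Markov jump process with jump rates $2\to0$ and $-2\to0$ equal to $2\omega$, $0\to2$ and $0\to-2$ equal to $\omega$ (all other rates being zero), and in which, if $0=T_0<T_1<\dots$ are the jump times of $v$, the continuous path $x$ satisfies $x(t)=\max[0,\min[L,\,x(T_n)+v(T_n)(t-T_n)]]$ for $t\in[T_n,T_{n+1})$. Let $\hat\mu=\sum_{v}(d^0_v\delta_0+a_v\,dx+d^L_v\delta_L)\otimes\delta_v$ with $$a_{\pm2}=\tfrac{\omega/4}{2+\omega L},\quad a_0=\tfrac{\omega/2}{2+\omega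 L},\quad d^0_2=d^L_{-2}=0,\quad d^0_0=d^0_{-2}=d^L_0=d^L_2=\tfrac{1/2}{2+\omega L}.$$ Let $(\hat Z_t)$ be a Markov process on $\hat{\mathcal S}$ with invariant probability measure $\hat\mu$ and $L^2(\hat\mu)$-generator $(\hat{\mathcal L},\mathrm{Dom}(\hat{\mathcal L}))$, let $\pi\colon\hat{\mathcal S}\to\mathcal S$ be a measurable surjection, and let $(Z_t)$ be a Markov process on $\mathcal S$ that is reversible with respect to $\mu=\hat\mu\circ\pi^{-1}$, with $L^2(\mu)$-generator $(\mathcal L,\mathrm{Dom}(\mathcal L))$. Then $(\hat Z_t)$ is a *second-order lift* of $(Z_t)$ along $\pi$ if there is a core $C$ of $\mathcal L$ such that $f\circ\pi\in\mathrm{Dom}(\hat{\mathcal L})$ for all $f\in C$ and, for all $f,g\in C$, $$\langle\hat{\mathcal L}(f\circ\pi),g\circ\pi\rangle_{L^2(\hat\mu)}=0,\qquad \tfrac12\langle\hat{\mathcal L}(f\circ\pi),\hat{\mathcal L}(g\circ\pi)\rangle_{L^2(\hat\mu)}=-\langle f,\mathcal Lg\rangle_{L^2(\mu)}.$$ Then: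 1. Sticky Brownian motion on $[0,L]$ with parameter $\omega$ has a unique invariant probability measure, namely $$\mu=\frac1{2+\omega L}\,\delta_0+\frac{\omega}{2+\omega L}\,dx+\frac1{2+\omega L}\,\delta_L .$$ 2. The $C^0$-generator of sticky Brownian motion is a core of its $L^2(\mu)$-generator: the $L^2(\mu)$-generator is closed and extends $\mathcal L_{C^0}$, and it is the closure of its restriction to $\mathrm{Dom}(\mathcal L_{C^0})$. 3. The jamming RTP process, which has invariant probability measure $\hat\mu$, is a second-order lift of sticky Brownian motion (which is reversible with respect to $\mu$) along $\pi(x,v)=x$. -/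

import Mathlib

open MeasureTheory ProbabilityTheory Filter Set
open scoped Topology NNReal ENNReal

noncomputable section

namespace SecondOrderLift

/-! ### Generators of operator semigroups -/

section Generator

variable {X : Type*} [NormedAddCommGroup X] [NormedSpace ℝ X]

/-- `f` is in the domain of the generator of `(T t)` with image `g` iff
`(T t f - f) / t → g` in norm as `t ↓ 0`. -/
def IsGeneratorPair (T : ℝ≥0 → X →ₗ[ℝ] X) (f g : X) : Prop :=
  Tendsto (fun t : ℝ≥0 => (t : ℝ)⁻¹ • (T t f - f)) (𝓝[>] 0) (𝓝 g)

theorem IsGeneratorPair.add {T : ℝ≥0 → X →ₗ[ℝ] X} {f f' g g' : X}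
    (h : IsGeneratorPair T f g) (h' : IsGeneratorPair T f' g') :
    IsGeneratorPair T (f + f') (g + g') := by
  refine (Tendsto.add h h').congr fun t => ?_
  rw [map_add, ← smul_add]; congr 1; abel

theorem IsGeneratorPair.smul {T : ℝ≥0 → X →ₗ[ℝ] X} {f g : X} (c : ℝ)
    (h : IsGeneratorPair T f g) : IsGeneratorPair T (c • f) (c • g) := by
  refine (Tendsto.const_smul h c).congr fun t => ?_
  rw [map_smul, ← smul_sub, smul_comm]

theorem IsGeneratorPair.unique {T : ℝ≥0 → X →ₗ[ℝ] X} {f g g' : X}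
    (h : IsGeneratorPair T f g) (h' : IsGeneratorPair T f g') : g = g' :=
  tendsto_nhds_unique h h'

/-- The infinitesimal generator of `(T t)`, an unbounded operator with its maximal domain. -/
def semigroupGenerator (T : ℝ≥0 → X →ₗ[ℝ] X) : X →ₗ.[ℝ] X where
  domain :=
    { carrier := {f | ∃ g, IsGeneratorPair T f g}
      add_mem' := fun ⟨_, h⟩ ⟨_, h'⟩ => ⟨_, h.add h'⟩
      zero_mem' := ⟨0, by simp [IsGeneratorPair]⟩
      smul_mem' := fun c _ ⟨_, h⟩ => ⟨_, h.smul c⟩ }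
  toFun :=
    { toFun := fun f => f.2.choose
      map_add' := fun f f' =>
        (f + f').2.choose_spec.unique (f.2.choose_spec.add f'.2.choose_spec)
      map_smul' := fun c f => (c • f).2.choose_spec.unique (f.2.choose_spec.smul c) }

end Generator

/-! ### Transition semigroups of Markov processes and their generators -/

section Markov

variable {E : Type*} [MeasurableSpace E]

/-- `κ t x A` is the probability to be in `A` at time `t` when started at `x`; the family `κ` is the
transition function of a time-homogeneous Markov process. -/
structure IsMarkovSemigroup (κ : ℝ≥0 → Kernel E E) : Prop where
  markov : ∀ t, IsMarkovKernel (κ t)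
  zero : κ 0 = Kernel.id
  add : ∀ s t, κ (s + t) = κ s ∘ₖ κ t

/-- `μ` is an invariant measure of the process with transition function `κ`. -/
def IsInvariantMeasure (κ : ℝ≥0 → Kernel E E) (μ : Measure E) : Prop :=
  ∀ t, (κ t).Invariant μ

theorem lintegral_invariant (κ : Kernel E E) {μ : Measure E} (hμ : κ.Invariant μ) {h : E → ℝ≥0∞}
    (hh : Measurable h) : ∫⁻ x, ∫⁻ y, h y ∂κ x ∂μ = ∫⁻ y, h y ∂μ := by
  conv_rhs => rw [← hμ.def]
  exact (Measure.lintegral_bind κ.measurable.aemeasurable hh.aemeasurable).symm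

theorem memLp_kernel_integral (κ : Kernel E E) [IsMarkovKernel κ] {μ : Measure E}
    (hμ : κ.Invariant μ) (f : Lp ℝ 2 μ) : MemLp (fun x => ∫ y, f y ∂κ x) 2 μ := by
  have hf : StronglyMeasurable (f : E → ℝ) := Lp.stronglyMeasurable f
  refine ⟨hf.integral_kernel.aestronglyMeasurable, ?_⟩
  have h2 : eLpNorm (f : E → ℝ) 2 μ < ∞ := (Lp.memLp f).2
  rw [eLpNorm_lt_top_iff_lintegral_rpow_enorm_lt_top (by simp) (by simp)] at h2 ⊢
  refine lt_of_le_of_lt ?_ h2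
  refine le_of_le_of_eq ?_ (lintegral_invariant κ hμ (hf.enorm.pow_const _))
  refine lintegral_mono fun x => ?_
  have h1 : ‖∫ y, f y ∂κ x‖ₑ ≤ eLpNorm (f : E → ℝ) 2 (κ x) :=
    (enorm_integral_le_lintegral_enorm _).trans <| by
      rw [← eLpNorm_one_eq_lintegral_enorm]
      exact eLpNorm_le_eLpNorm_of_exponent_le (by norm_num) hf.aestronglyMeasurable
  calc ‖∫ y, f y ∂κ x‖ₑ ^ (2 : ℝ≥0∞).toReal
      ≤ (eLpNorm (f : E → ℝ) 2 (κ x)) ^ (2 : ℝ≥0∞).toReal := by gcongr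
    _ = _ := by
      rw [eLpNorm_eq_lintegral_rpow_enorm_toReal (by simp) (by simp), ← ENNReal.rpow_mul,
        one_div, inv_mul_cancel₀ (by simp), ENNReal.rpow_one]

theorem ae_integrable_kernel (κ : Kernel E E) [IsMarkovKernel κ] {μ : Measure E}
    (hμ : κ.Invariant μ) (f : Lp ℝ 2 μ) : ∀ᵐ x ∂μ, Integrable (f : E → ℝ) (κ x) := by
  have hf : StronglyMeasurable (f : E → ℝ) := Lp.stronglyMeasurable f
  have h2 : eLpNorm (f : E → ℝ) 2 μ < ∞ := (Lp.memLp f).2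
  rw [eLpNorm_lt_top_iff_lintegral_rpow_enorm_lt_top (by simp) (by simp),
    ← lintegral_invariant κ hμ (by exact hf.enorm.pow_const _)] at h2
  filter_upwards [ae_lt_top (by exact (hf.enorm.pow_const _).lintegral_kernel) h2.ne] with x hx
  have : MemLp (f : E → ℝ) 2 (κ x) := ⟨hf.aestronglyMeasurable, by
    rw [eLpNorm_lt_top_iff_lintegral_rpow_enorm_lt_top (by simp) (by simp)]; exact hx⟩
  exact this.integrable (by norm_num)

theorem ae_kernel_of_ae (κ : Kernel E E) {μ : Measure E} (hμ : κ.Invariant μ) {p : E → Prop}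
    (h : ∀ᵐ y ∂μ, p y) : ∀ᵐ x ∂μ, ∀ᵐ y ∂κ x, p y := by
  rw [← hμ.def] at h
  exact Measure.ae_ae_of_ae_comp h

/-- The action `(P f)(x) = ∫ f(y) κ(x, dy)` of a Markov kernel on `L²(μ)`, for invariant `μ`. -/
def l2Operator (κ : Kernel E E) [IsMarkovKernel κ] (μ : Measure E) (hμ : κ.Invariant μ) :
    Lp ℝ 2 μ →ₗ[ℝ] Lp ℝ 2 μ where
  toFun f := (memLp_kernel_integral κ hμ f).toLp _
  map_add' f g := by
    rw [← MemLp.toLp_add, MemLp.toLp_eq_toLp_iff]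
    filter_upwards [ae_integrable_kernel κ hμ f, ae_integrable_kernel κ hμ g,
      ae_kernel_of_ae κ hμ (Lp.coeFn_add f g)] with x hf hg hfg
    rw [integral_congr_ae hfg]
    exact integral_add hf hg
  map_smul' c f := by
    rw [RingHom.id_apply, ← MemLp.toLp_const_smul, MemLp.toLp_eq_toLp_iff]
    filter_upwards [ae_kernel_of_ae κ hμ (Lp.coeFn_smul c f)] with x hf
    rw [integral_congr_ae hf]
    exact integral_smul c _

/-- The `L²(μ)`-generator of a Markov process with invariant measure `μ`. -/
def l2Generator {κ : ℝ≥0 → Kernel E E} (hκ : IsMarkovSemigroup κ) {μ : Measure E}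
    (hμ : IsInvariantMeasure κ μ) : Lp ℝ 2 μ →ₗ.[ℝ] Lp ℝ 2 μ :=
  semigroupGenerator fun t =>
    have := hκ.markov t
    l2Operator (κ t) μ (hμ t)

end Markov

/-! ### Feller processes on compact spaces -/

section Feller

variable {E : Type*} [MeasurableSpace E] [TopologicalSpace E] [CompactSpace E] [BorelSpace E]

/-- The transition function of a Feller process on a compact state space: continuous functions are
mapped to continuous functions, and `P_t f → f` uniformly as `t ↓ 0`. -/
structure IsFellerSemigroup (κ : ℝ≥0 → Kernel E E) : Prop extends IsMarkovSemigroup κ where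
  continuous_integral : ∀ t (f : C(E, ℝ)), Continuous fun x => ∫ y, f y ∂κ t x
  tendsto_zero : ∀ f : C(E, ℝ), Tendsto
    (fun t => (⟨fun x => ∫ y, f y ∂κ t x, continuous_integral t f⟩ : C(E, ℝ))) (𝓝[>] 0) (𝓝 f)

/-- The action `(P_t f)(x) = ∫ f(y) κ_t(x, dy)` of a Feller process on continuous functions. -/
def fellerOperator {κ : ℝ≥0 → Kernel E E} (hκ : IsFellerSemigroup κ) (t : ℝ≥0) :
    C(E, ℝ) →ₗ[ℝ] C(E, ℝ) where
  toFun f := ⟨fun x => ∫ y, f y ∂κ t x, hκ.continuous_integral t f⟩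
  map_add' f g := by
    have := hκ.markov t
    ext x
    have hi : ∀ h : C(E, ℝ), Integrable h (κ t x) := fun h =>
      Integrable.of_bound h.continuous.aestronglyMeasurable ‖h‖
        (Eventually.of_forall h.norm_coe_le_norm)
    exact integral_add (hi f) (hi g)
  map_smul' c f := by
    ext x
    exact integral_smul c _

/-- The `C⁰`-generator of a Feller process. -/
def fellerGenerator {κ : ℝ≥0 → Kernel E E} (hκ : IsFellerSemigroup κ) :
    C(E, ℝ) →ₗ.[ℝ] C(E, ℝ) :=
  semigroupGenerator (fellerOperator hκ)

end Feller

/-! ### Second-order lifts -/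

section Lift

variable {E' E : Type*} [MeasurableSpace E'] [MeasurableSpace E]

/-- The Markov process with transition function `κ'` and invariant probability measure `μ'` is a
second-order lift, along `π`, of the reversible Markov process with transition function `κ` and
invariant probability measure `μ = μ' ∘ π⁻¹`. -/
structure IsSecondOrderLift (κ' : ℝ≥0 → Kernel E' E') (μ' : Measure E')
    (κ : ℝ≥0 → Kernel E E) (μ : Measure E) (π : E' → E) : Prop where
  semigroup' : IsMarkovSemigroup κ'
  prob' : IsProbabilityMeasure μ'
  invariant' : IsInvariantMeasure κ' μ'
  semigroup : IsMarkovSemigroup κ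
  invariant : IsInvariantMeasure κ μ
  reversible : ∀ t, (κ t).IsReversible μ
  surjective : Function.Surjective π
  measurePreserving : MeasurePreserving π μ' μ
  exists_core : ∃ C : Submodule ℝ (Lp ℝ 2 μ), (l2Generator semigroup invariant).HasCore C ∧
    (∀ f ∈ C, Lp.compMeasurePreserving π measurePreserving f ∈
      (l2Generator semigroup' invariant').domain) ∧
    ∀ f ∈ C, ∀ g ∈ C, ∀ (F G : Lp ℝ 2 μ') (h : Lp ℝ 2 μ),
      (Lp.compMeasurePreserving π measurePreserving f, F) ∈
        (l2Generator semigroup' invariant').graph →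
      (Lp.compMeasurePreserving π measurePreserving g, G) ∈
        (l2Generator semigroup' invariant').graph →
      (g, h) ∈ (l2Generator semigroup invariant).graph →
      inner ℝ F (Lp.compMeasurePreserving π measurePreserving g) = 0 ∧
      (1 / 2 : ℝ) * inner ℝ F G = -inner ℝ f h

end Lift

/-! ### Sticky Brownian motion on `[0, L]` -/

section Sticky

variable (ω L : ℝ)

/-- The operator `f ↦ f''` on `C([0, L])` with domain the `f ∈ C²([0, L])` such that
`f''(0) = ω f'(0)` and `f''(L) = -ω f'(L)`. Derivatives are taken within `[0, L]`, so that they are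
one-sided at the endpoints. -/
def stickyGenerator (hL : 0 < L) : C(Icc (0 : ℝ) L, ℝ) →ₗ.[ℝ] C(Icc (0 : ℝ) L, ℝ) where
  domain :=
    { carrier := {f | ContDiffOn ℝ 2 (IccExtend hL.le f) (Icc 0 L) ∧
        iteratedDerivWithin 2 (IccExtend hL.le f) (Icc 0 L) 0 =
          ω * derivWithin (IccExtend hL.le f) (Icc 0 L) 0 ∧
        iteratedDerivWithin 2 (IccExtend hL.le f) (Icc 0 L) L =
          -ω * derivWithin (IccExtend hL.le f) (Icc 0 L) L}
      add_mem' := by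
        rintro f g ⟨hf, hf0, hfL⟩ ⟨hg, hg0, hgL⟩
        have hu := uniqueDiffOn_Icc hL
        have h0 : (0 : ℝ) ∈ Icc 0 L := left_mem_Icc.2 hL.le
        have hL' : L ∈ Icc 0 L := right_mem_Icc.2 hL.le
        have he : IccExtend hL.le ⇑(f + g) = IccExtend hL.le f + IccExtend hL.le g := rfl
        have d : ∀ x ∈ Icc 0 L,
            derivWithin (IccExtend hL.le f + IccExtend hL.le g) (Icc 0 L) x =
            derivWithin (IccExtend hL.le f) (Icc 0 L) x +
            derivWithin (IccExtend hL.le g) (Icc 0 L) x := fun x hx =>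
          derivWithin_add (hf.differentiableOn (by norm_num) x hx)
            (hg.differentiableOn (by norm_num) x hx)
        refine ⟨he ▸ hf.add hg, ?_, ?_⟩
        · rw [he, iteratedDerivWithin_add h0 hu (hf 0 h0) (hg 0 h0), d 0 h0, hf0, hg0]; ring
        · rw [he, iteratedDerivWithin_add hL' hu (hf L hL') (hg L hL'), d L hL', hfL, hgL]; ring
      zero_mem' := by
        have he : IccExtend hL.le ⇑(0 : C(Icc (0 : ℝ) L, ℝ)) = fun _ => (0 : ℝ) := rfl
        simp only [mem_ofPred_eq, he]
        exact ⟨contDiffOn_const, by simp,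
          by simp⟩
      smul_mem' := by
        rintro c f ⟨hf, hf0, hfL⟩
        have hu := uniqueDiffOn_Icc hL
        have h0 : (0 : ℝ) ∈ Icc 0 L := left_mem_Icc.2 hL.le
        have hL' : L ∈ Icc 0 L := right_mem_Icc.2 hL.le
        have he : IccExtend hL.le ⇑(c • f) = c • IccExtend hL.le f := rfl
        have d : ∀ x ∈ Icc 0 L, derivWithin (c • IccExtend hL.le f) (Icc 0 L) x =
            c • derivWithin (IccExtend hL.le f) (Icc 0 L) x := fun x hx =>
          derivWithin_const_smul c (hf.differentiableOn (by norm_num) x hx)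
        refine ⟨he ▸ hf.const_smul c, ?_, ?_⟩
        · rw [he, iteratedDerivWithin_const_smul h0 hu c (hf 0 h0), d 0 h0, hf0]
          simp only [smul_eq_mul]; ring
        · rw [he, iteratedDerivWithin_const_smul hL' hu c (hf L hL'), d L hL', hfL]
          simp only [smul_eq_mul]; ring }
  toFun :=
    { toFun := fun f =>
        ⟨(Icc 0 L).domRestrict (iteratedDerivWithin 2 (IccExtend hL.le f.1) (Icc 0 L)),
          (f.2.1.continuousOn_iteratedDerivWithin le_rfl (uniqueDiffOn_Icc hL)).domRestrict⟩
      map_add' := fun f g => by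
        ext x
        exact iteratedDerivWithin_add x.2 (uniqueDiffOn_Icc hL) (f.2.1 x x.2) (g.2.1 x x.2)
      map_smul' := fun c f => by
        ext x
        exact iteratedDerivWithin_const_smul x.2 (uniqueDiffOn_Icc hL) c (f.2.1 x x.2) }

/-- `κ` is the transition function of sticky Brownian motion on `[0, L]` with parameter `ω`: the
Feller process whose `C⁰`-generator, including its domain, is `stickyGenerator`. -/
def IsStickyBrownianMotion (hL : 0 < L) (κ : ℝ≥0 → Kernel (Icc (0 : ℝ) L) (Icc (0 : ℝ) L)) :
    Prop :=
  ∃ hκ : IsFellerSemigroup κ, fellerGenerator hκ = stickyGenerator ω L hL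

/-- Lebesgue measure on `[0, L]`. -/
def lebesgueIcc : Measure (Icc (0 : ℝ) L) :=
  (volume : Measure ℝ).comap Subtype.val

/-- The measure `(δ₀ + ω dx + δ_L) / (2 + ω L)` on `[0, L]`. -/
def stickyMeasure (hL : 0 < L) : Measure (Icc (0 : ℝ) L) :=
  ENNReal.ofReal (1 / (2 + ω * L)) • Measure.dirac ⟨0, left_mem_Icc.2 hL.le⟩ +
    ENNReal.ofReal (ω / (2 + ω * L)) • lebesgueIcc L +
    ENNReal.ofReal (1 / (2 + ω * L)) • Measure.dirac ⟨L, right_mem_Icc.2 hL.le⟩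

instance isFiniteMeasure_stickyMeasure (hL : 0 < L) : IsFiniteMeasure (stickyMeasure ω L hL) := by
  have : IsFiniteMeasure (lebesgueIcc L) :=
    ⟨by rw [lebesgueIcc, comap_subtype_coe_apply measurableSet_Icc, image_univ,
      Subtype.range_coe, Real.volume_Icc]; exact ENNReal.ofReal_lt_top⟩
  have := fun r : ℝ => Measure.smul_finite (lebesgueIcc L)
    (c := ENNReal.ofReal r) ENNReal.ofReal_ne_top
  have := fun (r : ℝ) (a : Icc (0 : ℝ) L) => Measure.smul_finite (Measure.dirac a)
    (c := ENNReal.ofReal r) ENNReal.ofReal_ne_top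
  unfold stickyMeasure
  infer_instance

/-- The inclusion of `C([0, L])` into `L²(μ)`, for `μ = stickyMeasure`. -/
def stickyToL2 (hL : 0 < L) : C(Icc (0 : ℝ) L, ℝ) →ₗ[ℝ] Lp ℝ 2 (stickyMeasure ω L hL) :=
  (ContinuousMap.toLp 2 (stickyMeasure ω L hL) ℝ).toLinearMap

end Sticky

/-! ### The jamming run-and-tumble process on `[0, L] × {-2, 0, 2}` -/

section RTP

/-- The set `{-2, 0, 2}` of relative velocities. -/
abbrev Velocity : Type := ↥({-2, 0, 2} : Finset ℤ)

/-- The entry `λ_{v w}` of the generator matrix of the relative velocity. -/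
def tumbleRate (ω : ℝ) (v w : Velocity) : ℝ :=
  if v = w then -2 * ω
  else if v.1 = 0 then ω
  else if w.1 = 0 then 2 * ω
  else 0

/-- The total rate at which the velocity `v` is left. -/
def exitRate (ω : ℝ) (v : Velocity) : ℝ := ∑ w ∈ Finset.univ.erase v, tumbleRate ω v w

theorem exitRate_eq (ω : ℝ) (v : Velocity) : exitRate ω v = 2 * ω := by
  obtain ⟨v, hv⟩ := v
  have h1 : (Finset.univ : Finset Velocity) =
    {⟨-2, by decide⟩, ⟨0, by decide⟩, ⟨2, by decide⟩} := by decide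
  unfold exitRate
  rw [Finset.sum_erase_eq_sub (Finset.mem_univ _), h1, Finset.sum_insert (by decide),
    Finset.sum_insert (by decide), Finset.sum_singleton]
  simp only [Finset.mem_insert, Finset.mem_singleton] at hv
  rcases hv with rfl | rfl | rfl <;> simp [tumbleRate] <;> ring

theorem tumbleRate_nonneg {ω : ℝ} (hω : 0 < ω) {v w : Velocity} (h : v ≠ w) :
    0 ≤ tumbleRate ω v w := by
  unfold tumbleRate
  split_ifs <;> first | contradiction | positivity

/-- The law of the velocity after a jump out of `v`: it is `w ≠ v` with probability `λ_{v w}`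
divided by the total rate out of `v`. -/
def jumpLaw {ω : ℝ} (hω : 0 < ω) (v : Velocity) : PMF Velocity :=
  PMF.ofFintype
    (fun w => if w = v then 0 else ENNReal.ofReal (tumbleRate ω v w / exitRate ω v)) <| by
      have hq : 0 < exitRate ω v := by rw [exitRate_eq]; positivity
      rw [← Finset.add_sum_erase _ _ (Finset.mem_univ v), if_pos rfl, zero_add,
        Finset.sum_congr rfl (g := fun w => ENNReal.ofReal (tumbleRate ω v w / exitRate ω v))
          fun w hw => if_neg (Finset.ne_of_mem_erase hw),
        ← ENNReal.ofReal_sum_of_nonneg fun w hw =>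
          div_nonneg (tumbleRate_nonneg hω (Finset.ne_of_mem_erase hw).symm) hq.le,
        ← Finset.sum_div]
      change ENNReal.ofReal (exitRate ω v / exitRate ω v) = 1
      rw [div_self hq.ne', ENNReal.ofReal_one]

/-- The randomness driving the velocity process. For each `n`, the `n`-th entry consists of a clock
and of a map that sends each velocity `v` to the velocity after the `(n+1)`-st jump in case
`v` is the velocity before that jump. -/
abbrev Driving : Type := ℕ → ℝ × (Velocity → Velocity)

/-- All clocks are exponential with parameter `1`, all jumps out of `v` have law `jumpLaw hω v`, and
all of them are independent. -/
def drivingMeasure {ω : ℝ} (hω : 0 < ω) : Measure Driving :=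
  Measure.infinitePi fun _ => (expMeasure 1).prod (Measure.pi fun v => (jumpLaw hω v).toMeasure)

/-- The velocity `v(T_n)` after `n` jumps, started from `v`. -/
def velocityChain (v : Velocity) (o : Driving) : ℕ → Velocity
  | 0 => v
  | n + 1 => (o n).2 (velocityChain v o n)

/-- The time `T_{n+1} - T_n` between the `n`-th and the `(n+1)`-st jump. Given the velocities, these
times are independent and exponential, with the total jump rate of the current velocity. -/
def holdingTime (ω : ℝ) (v : Velocity) (o : Driving) (n : ℕ) : ℝ :=
  (o n).1 / exitRate ω (velocityChain v o n)

/-- The jump times `T_n`, with `T_0 = 0`. -/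
def jumpTime (ω : ℝ) (v : Velocity) (o : Driving) (n : ℕ) : ℝ :=
  ∑ k ∈ Finset.range n, holdingTime ω v o k

/-- The number `n` with `t ∈ [T_n, T_{n+1})`, which exists almost surely. -/
def jumpCount (ω : ℝ) (t : ℝ≥0) (v : Velocity) (o : Driving) : ℕ :=
  sInf {n | (t : ℝ) < jumpTime ω v o (n + 1)}

/-- The particle separation `max(0, min(L, x + v s))` after moving for a time `s` from `x` with
velocity `v`. -/
def moveClamped {L : ℝ} (hL : 0 < L) (x : Icc (0 : ℝ) L) (v : Velocity) (s : ℝ) : Icc (0 : ℝ) L :=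
  projIcc 0 L hL.le (x + (v.1 : ℝ) * s)

/-- The particle separation `x(T_n)` at the jump times. -/
def positionChain (ω : ℝ) {L : ℝ} (hL : 0 < L) (z : Icc (0 : ℝ) L × Velocity) (o : Driving) :
    ℕ → Icc (0 : ℝ) L
  | 0 => z.1
  | n + 1 => moveClamped hL (positionChain ω hL z o n) (velocityChain z.2 o n)
      (holdingTime ω z.2 o n)

/-- The jamming run-and-tumble process `(x(t), v(t))` started from `z`. -/
def rtpProcess (ω : ℝ) {L : ℝ} (hL : 0 < L) (t : ℝ≥0) (z : Icc (0 : ℝ) L × Velocity)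
    (o : Driving) : Icc (0 : ℝ) L × Velocity :=
  let n := jumpCount ω t z.2 o
  (moveClamped hL (positionChain ω hL z o n) (velocityChain z.2 o n) (t - jumpTime ω z.2 o n),
    velocityChain z.2 o n)

theorem measurable_velocityChain (n : ℕ) :
    Measurable fun p : Velocity × Driving => velocityChain p.1 p.2 n := by
  have he : Measurable fun q : (Velocity → Velocity) × Velocity => q.1 q.2 :=
    measurable_from_prod_countable_left fun v => measurable_pi_apply v
  induction n with
  | zero => exact measurable_fst
  | succ n ih =>
    exact he.comp ((measurable_snd.comp ((measurable_pi_apply n).comp measurable_snd)).prodMk ih)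

theorem measurable_holdingTime (ω : ℝ) (n : ℕ) :
    Measurable fun p : Velocity × Driving => holdingTime ω p.1 p.2 n := by
  have hq : Measurable (exitRate ω) := measurable_of_countable _
  exact (measurable_fst.comp ((measurable_pi_apply n).comp measurable_snd)).div
    (hq.comp (measurable_velocityChain n))

theorem measurable_jumpTime (ω : ℝ) (n : ℕ) :
    Measurable fun p : Velocity × Driving => jumpTime ω p.1 p.2 n :=
  Finset.measurable_sum _ fun k _ => measurable_holdingTime ω k

theorem measurable_jumpCount (ω : ℝ) (t : ℝ≥0) :
    Measurable fun p : Velocity × Driving => jumpCount ω t p.1 p.2 := by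
  have hm : ∀ n, MeasurableSet {p : Velocity × Driving | (t : ℝ) < jumpTime ω p.1 p.2 (n + 1)} :=
    fun n => measurableSet_lt measurable_const (measurable_jumpTime ω (n + 1))
  have hex : ∀ p : Velocity × Driving, ∃ n, (t : ℝ) < jumpTime ω p.1 p.2 (n + 1) ∨
      ∀ m, ¬ (t : ℝ) < jumpTime ω p.1 p.2 (m + 1) := fun p => by
    by_cases h : ∃ n, (t : ℝ) < jumpTime ω p.1 p.2 (n + 1)
    · exact h.imp fun n hn => Or.inl hn
    · exact ⟨0, Or.inr (not_exists.1 h)⟩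
  classical
  have hf : Measurable fun p : Velocity × Driving => Nat.find (hex p) := by
    refine measurable_find hex fun n => (hm n).union ?_
    have := MeasurableSet.iInter fun m => (hm m).compl
    have he : {p : Velocity × Driving | ∀ m, ¬ (t : ℝ) < jumpTime ω p.1 p.2 (m + 1)} =
        ⋂ m, {p : Velocity × Driving | (t : ℝ) < jumpTime ω p.1 p.2 (m + 1)}ᶜ := by
      ext p
      simp
    rw [← he] at this
    exact this
  convert hf using 2 with p
  unfold jumpCount
  by_cases h : ∃ n, (t : ℝ) < jumpTime ω p.1 p.2 (n + 1)
  · have hs : ({n | (t : ℝ) < jumpTime ω p.1 p.2 (n + 1)} : Set ℕ).Nonempty := h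
    rw [Nat.sInf_def hs]
    refine Nat.find_congr' fun {n} => ⟨Or.inl, fun h' => h'.resolve_right fun h'' => ?_⟩
    obtain ⟨m, hm⟩ := h
    exact h'' m hm
  · have h0 : {n | (t : ℝ) < jumpTime ω p.1 p.2 (n + 1)} = ∅ :=
      eq_empty_iff_forall_notMem.2 (not_exists.1 h)
    rw [h0, Nat.sInf_empty]
    exact ((Nat.find_eq_zero _).2 (Or.inr (not_exists.1 h))).symm

theorem measurable_moveClamped {L : ℝ} (hL : 0 < L) :
    Measurable fun q : Icc (0 : ℝ) L × Velocity × ℝ => moveClamped hL q.1 q.2.1 q.2.2 := by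
  have hv : Measurable fun v : Velocity => (v.1 : ℝ) := measurable_of_countable _
  exact continuous_projIcc.measurable.comp
    ((measurable_subtype_coe.comp measurable_fst).add
      ((hv.comp (measurable_fst.comp measurable_snd)).mul (measurable_snd.comp measurable_snd)))

theorem measurable_positionChain (ω : ℝ) {L : ℝ} (hL : 0 < L) (n : ℕ) :
    Measurable fun p : (Icc (0 : ℝ) L × Velocity) × Driving => positionChain ω hL p.1 p.2 n := by
  have hp : Measurable fun p : (Icc (0 : ℝ) L × Velocity) × Driving => (p.1.2, p.2) :=
    (measurable_snd.comp measurable_fst).prodMk measurable_snd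
  induction n with
  | zero => exact measurable_fst.comp measurable_fst
  | succ n ih =>
    exact (measurable_moveClamped hL).comp (ih.prodMk
      (((measurable_velocityChain n).comp hp).prodMk ((measurable_holdingTime ω n).comp hp)))

theorem measurable_rtpProcess (ω : ℝ) {L : ℝ} (hL : 0 < L) (t : ℝ≥0) :
    Measurable fun p : (Icc (0 : ℝ) L × Velocity) × Driving => rtpProcess ω hL t p.1 p.2 := by
  have hp : Measurable fun p : (Icc (0 : ℝ) L × Velocity) × Driving => (p.1.2, p.2) :=
    (measurable_snd.comp measurable_fst).prodMk measurable_snd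
  have hn := (measurable_jumpCount ω t).comp hp
  have key : Measurable fun q : ((Icc (0 : ℝ) L × Velocity) × Driving) × ℕ =>
      (moveClamped hL (positionChain ω hL q.1.1 q.1.2 q.2) (velocityChain q.1.1.2 q.1.2 q.2)
        (t - jumpTime ω q.1.1.2 q.1.2 q.2), velocityChain q.1.1.2 q.1.2 q.2) := by
    refine measurable_from_prod_countable_left fun n => ?_
    have hv := (measurable_velocityChain n).comp hp
    exact ((measurable_moveClamped hL).comp ((measurable_positionChain ω hL n).prodMk
      (hv.prodMk (((measurable_jumpTime ω n).comp hp).const_sub _)))).prodMk hv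
  exact key.comp (measurable_id.prodMk hn)

/-- The transition function of the jamming run-and-tumble process: `rtpKernel hω hL t z` is the law
at time `t` of the process started from `z`. -/
def rtpKernel {ω L : ℝ} (hω : 0 < ω) (hL : 0 < L) (t : ℝ≥0) :
    Kernel (Icc (0 : ℝ) L × Velocity) (Icc (0 : ℝ) L × Velocity) where
  toFun z := (drivingMeasure hω).map (rtpProcess ω hL t z)
  measurable' := by
    have : IsProbabilityMeasure (expMeasure 1) := isProbabilityMeasure_expMeasure one_pos
    have : IsProbabilityMeasure (drivingMeasure hω) := by unfold drivingMeasure; infer_instance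
    refine Measure.measurable_of_measurable_coe _ fun s hs => ?_
    have h : (fun z => (drivingMeasure hω).map (rtpProcess ω hL t z) s) = fun z =>
        drivingMeasure hω (Prod.mk z ⁻¹' ((fun p : (Icc (0 : ℝ) L × Velocity) × Driving =>
          rtpProcess ω hL t p.1 p.2) ⁻¹' s)) := funext fun z => Measure.map_apply
      ((measurable_rtpProcess ω hL t).comp (measurable_prodMk_left (x := z))) hs
    rw [h]
    exact measurable_measure_prodMk_left ((measurable_rtpProcess ω hL t) hs)

/-- The weight of the atom at `(0, v)` of the invariant measure, times `2 + ω L`. -/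
def leftWeight (v : Velocity) : ℝ := if v.1 = 2 then 0 else 1 / 2

/-- The density of the invariant measure at velocity `v`, times `2 + ω L`. -/
def bulkWeight (ω : ℝ) (v : Velocity) : ℝ := if v.1 = 0 then ω / 2 else ω / 4

/-- The weight of the atom at `(L, v)` of the invariant measure, times `2 + ω L`. -/
def rightWeight (v : Velocity) : ℝ := if v.1 = -2 then 0 else 1 / 2

/-- The invariant probability measure of the jamming run-and-tumble process. -/
def rtpMeasure (ω L : ℝ) (hL : 0 < L) : Measure (Icc (0 : ℝ) L × Velocity) :=
  ∑ v : Velocity,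
    (ENNReal.ofReal (leftWeight v / (2 + ω * L)) • Measure.dirac (⟨0, left_mem_Icc.2 hL.le⟩ : Icc (0 : ℝ) L) +
      ENNReal.ofReal (bulkWeight ω v / (2 + ω * L)) • lebesgueIcc L +
      ENNReal.ofReal (rightWeight v / (2 + ω * L)) •
        Measure.dirac (⟨L, right_mem_Icc.2 hL.le⟩ : Icc (0 : ℝ) L)).prod (Measure.dirac v)

end RTP

end SecondOrderLift

end

open SecondOrderLift

/-!
Sticky Brownian motion is constructed from its generator `A f = f''`. The domain conditions turn
the second derivative at an endpoint into a multiple of the first derivative pointing inwards, so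
that a maximum principle holds up to the boundary (`stickyGenerator_dissipative`), and
`c f - f'' = h` is solved explicitly (`stickyGenerator_surjective`). The Hille–Yosida theorem
(`exists_contractionSemigroup`) and the Riesz–Markov–Kakutani theorem then give the Feller process
(`exists_fellerSemigroup`), and a generator determines its contraction semigroup
(`IsContractionSemigroup.eq_of_isGeneratorPair`).

Integrating by parts against `δ₀ + ω dx + δ_L`, the atoms absorb the boundary terms:
`∫ f A u dμ = -(ω / (2 + ω L)) ∫ f' u' dx` (`StickyExtension.integral_mul`). Hence `A` is symmetric, so the
semigroup is symmetric and `μ` is invariant and reversible. The range of `A` is the set of all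
functions of `μ`-mean zero (`exists_stickyGenerator_eq`), and an invariant probability measure has
to annihilate it, so it is `μ`. The domain of `A` is a core on `L²(μ)` because `1 - A` has dense
range there (`IsContractionSemigroup.hasCore_of_dense`).

The velocity of the run-and-tumble process is always left at rate `2ω`. Conditioning on the first
jump yields a renewal equation (`rtpMean_eq`), whose solution is unique (`renewal_unique`). From
it follow the Markov property (`rtpMean_add`), the Feller property
(`isFellerSemigroup_rtpKernel`), and the expansion `T_r k = k ∘ φ_r + r B k + o(r)`, uniformly on
the state space (`eventually_abs_rtpMean_sub_le`), where `φ_r` moves the particle without a jump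
and `B` is the generator of the velocity. No smoothness of `k` is needed, so the expansion applies
to `k = T_t h`: since the flow through the bulk and the jumps at the endpoints cancel under `μ̂`
(`tendsto_integral_rtpMeasure_move`), the right derivative of `t ↦ ∫ T_t h dμ̂` vanishes, and `μ̂`
is invariant.

For `k = f ∘ π` the jump part vanishes, and the difference quotients converge boundedly to
`v f'(x)`, except at the jammed states, where they converge to `0`. So `f ∘ π` is in the domain of
the `L²(μ̂)`-generator with this image (`StickyExtension.isGeneratorPair_rtp`). Under `μ̂` its
only contribution comes from the bulk. Averaging over `v = ±2` kills the term linear in `v`, and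
the term quadratic in `v` is twice the Dirichlet form of sticky Brownian motion
(`integral_freeDerivative_mul`, `integral_freeDerivative_mul_freeDerivative`).
-/

noncomputable section

namespace SecondOrderLift

/-! ### Contraction semigroups -/

section ContractionSemigroup

variable {X : Type*} [NormedAddCommGroup X] [NormedSpace ℝ X]

/-- `(T t)` is a strongly continuous semigroup of linear contractions. -/
structure IsContractionSemigroup (T : ℝ≥0 → X →ₗ[ℝ] X) : Prop where
  zero : ∀ f, T 0 f = f
  add : ∀ s t f, T (s + t) f = T s (T t f)
  norm_le : ∀ t f, ‖T t f‖ ≤ ‖f‖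
  tendsto_zero : ∀ f, Tendsto (fun t => T t f) (𝓝[>] 0) (𝓝 f)

theorem tendsto_of_dense {ι : Type*} {l : Filter ι} {E : ι → X →ₗ[ℝ] X} (hE : ∀ n f, ‖E n f‖ ≤ ‖f‖)
    {D : Set X} (hD : Dense D) (h : ∀ f ∈ D, Tendsto (fun n => E n f) l (𝓝 f)) (f : X) :
    Tendsto (fun n => E n f) l (𝓝 f) := by
  refine Metric.tendsto_nhds.2 fun ε hε => ?_
  obtain ⟨f', hf', hff'⟩ := Metric.mem_closure_iff.1 (hD f) (ε / 3) (by positivity)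
  filter_upwards [Metric.tendsto_nhds.1 (h f' hf') (ε / 3) (by positivity)] with n hn
  have h1 : dist (E n f) (E n f') < ε / 3 := by
    rw [dist_eq_norm, ← map_sub]
    exact (hE n _).trans_lt (by rwa [← dist_eq_norm])
  have h2 := dist_triangle4 (E n f) (E n f') f' f
  rw [dist_comm] at hff'
  linarith

theorem toNNReal_add_right {a b : ℝ} (h : 0 ≤ b) (hab : b ≤ a) :
    a.toNNReal = b.toNNReal + (a - b).toNNReal := by
  rw [← Real.toNNReal_add h (sub_nonneg.2 hab)]; congr 1; ring

theorem tendsto_sub_toNNReal (s : ℝ) :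
    Tendsto (fun y : ℝ => (y - s).toNNReal) (𝓝[>] s) (𝓝[>] 0) := by
  refine tendsto_nhdsWithin_iff.2 ⟨?_, ?_⟩
  · have : Tendsto (fun y : ℝ => (y - s).toNNReal) (𝓝 s) (𝓝 (s - s).toNNReal) :=
      (continuous_real_toNNReal.comp (continuous_id.sub continuous_const)).tendsto s
    rw [sub_self, Real.toNNReal_zero] at this
    exact this.mono_left nhdsWithin_le_nhds
  · filter_upwards [self_mem_nhdsWithin] with y hy
    exact Real.toNNReal_pos.2 (sub_pos.2 hy)

theorem tendsto_coe_nnreal_nhdsGT_zero :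
    Tendsto (fun t : ℝ≥0 => (t : ℝ)) (𝓝[>] 0) (𝓝[>] 0) :=
  tendsto_nhdsWithin_iff.2 ⟨(NNReal.continuous_coe.tendsto 0).mono_left nhdsWithin_le_nhds, by
    filter_upwards [self_mem_nhdsWithin] with t ht using NNReal.coe_pos.2 ht⟩

theorem IsGeneratorPair.mem_domain {T : ℝ≥0 → X →ₗ[ℝ] X} {f g : X} (h : IsGeneratorPair T f g) :
    f ∈ (semigroupGenerator T).domain := ⟨g, h⟩

theorem mem_graph_semigroupGenerator {T : ℝ≥0 → X →ₗ[ℝ] X} {f g : X} :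
    (f, g) ∈ (semigroupGenerator T).graph ↔ IsGeneratorPair T f g := by
  rw [LinearPMap.mem_graph_iff]
  constructor
  · rintro ⟨y, rfl, rfl⟩
    exact y.2.choose_spec
  · intro h
    exact ⟨⟨f, g, h⟩, rfl, (Exists.choose_spec (⟨g, h⟩ : ∃ g, IsGeneratorPair T f g)).unique h⟩

/-- The difference quotients of a contraction semigroup are dissipative, hence so is the
generator. -/
theorem IsGeneratorPair.mul_norm_le {T : ℝ≥0 → X →ₗ[ℝ] X} (hT : ∀ t f, ‖T t f‖ ≤ ‖f‖) {f g : X}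
    (h : IsGeneratorPair T f g) (c : ℝ) (hc : 0 ≤ c) : c * ‖f‖ ≤ ‖c • f - g‖ := by
  have h1 : Tendsto (fun t : ℝ≥0 => ‖c • f - (t : ℝ)⁻¹ • (T t f - f)‖) (𝓝[>] 0)
      (𝓝 ‖c • f - g‖) := (tendsto_const_nhds.sub h).norm
  refine ge_of_tendsto h1 ?_
  filter_upwards [self_mem_nhdsWithin] with t ht
  have ht' : (0 : ℝ) < t := ht
  have h2 : (c + (t : ℝ)⁻¹) • f = (c • f - (t : ℝ)⁻¹ • (T t f - f)) + (t : ℝ)⁻¹ • T t f := by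
    rw [add_smul, smul_sub]; abel
  have h3 := norm_add_le (c • f - (t : ℝ)⁻¹ • (T t f - f)) ((t : ℝ)⁻¹ • T t f)
  rw [← h2, norm_smul, norm_smul, Real.norm_of_nonneg (by positivity),
    Real.norm_of_nonneg (by positivity : (0 : ℝ) ≤ (t : ℝ)⁻¹)] at h3
  have h4 := mul_le_mul_of_nonneg_left (hT t f) (by positivity : (0 : ℝ) ≤ (t : ℝ)⁻¹)
  linarith

namespace IsContractionSemigroup

variable {T T' : ℝ≥0 → X →ₗ[ℝ] X}

theorem norm_sub_le (hT : IsContractionSemigroup T) (t : ℝ≥0) (f g : X) :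
    ‖T t f - T t g‖ ≤ ‖f - g‖ := by
  rw [← map_sub]; exact hT.norm_le _ _

theorem map_comm (hT : IsContractionSemigroup T) (s t : ℝ≥0) (f : X) :
    T s (T t f) = T t (T s f) := by
  rw [← hT.add, ← hT.add, add_comm]

theorem tendsto_nhds_zero (hT : IsContractionSemigroup T) (f : X) :
    Tendsto (fun t => T t f) (𝓝 0) (𝓝 f) := by
  have h := hT.tendsto_zero f
  have h2 : Tendsto (fun t => T t f) (pure 0) (𝓝 f) := by
    rw [tendsto_pure_left]
    intro s hs
    rw [hT.zero]
    exact mem_of_mem_nhds hs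
  have h3 := h.sup h2
  refine h3.mono_left ?_
  rw [sup_comm, ← nhdsNE_sup_pure, sup_comm]
  refine sup_le_sup le_rfl (nhdsWithin_mono _ fun t ht => ?_)
  exact pos_iff_ne_zero.2 ht

theorem continuous (hT : IsContractionSemigroup T) (f : X) : Continuous fun t => T t f := by
  rw [continuous_iff_continuousAt]
  intro s
  have h0 := hT.tendsto_nhds_zero f
  have key : ∀ t, ‖T t f - T s f‖ ≤ ‖T (t - s) f - f‖ + ‖T (s - t) f - f‖ := by
    intro t
    rcases le_total s t with h | h
    · obtain ⟨r, rfl⟩ := exists_add_of_le h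
      rw [hT.add, add_tsub_cancel_left]
      exact (hT.norm_sub_le s _ _).trans (le_add_of_nonneg_right (norm_nonneg _))
    · obtain ⟨r, rfl⟩ := exists_add_of_le h
      rw [hT.add, add_tsub_cancel_left, norm_sub_rev]
      exact (hT.norm_sub_le t _ _).trans (le_add_of_nonneg_left (norm_nonneg _))
  have h1 : Tendsto (fun t : ℝ≥0 => t - s) (𝓝 s) (𝓝 0) := by
    have : ContinuousAt (fun t : ℝ≥0 => t - s) s := by fun_prop
    simpa [ContinuousAt] using this
  have h2 : Tendsto (fun t : ℝ≥0 => s - t) (𝓝 s) (𝓝 0) := by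
    have : ContinuousAt (fun t : ℝ≥0 => s - t) s := by fun_prop
    simpa [ContinuousAt] using this
  have h3 := (tendsto_iff_norm_sub_tendsto_zero.1 (h0.comp h1)).add
    (tendsto_iff_norm_sub_tendsto_zero.1 (h0.comp h2))
  rw [add_zero] at h3
  exact tendsto_iff_norm_sub_tendsto_zero.2 (squeeze_zero (fun _ => norm_nonneg _) key h3)

theorem continuous_toNNReal (hT : IsContractionSemigroup T) (f : X) :
    Continuous fun t : ℝ => T t.toNNReal f :=
  (hT.continuous f).comp continuous_real_toNNReal

theorem isGeneratorPair_map (hT : IsContractionSemigroup T) {f g : X} (h : IsGeneratorPair T f g)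
    (s : ℝ≥0) : IsGeneratorPair T (T s f) (T s g) := by
  rw [IsGeneratorPair, tendsto_iff_norm_sub_tendsto_zero] at h ⊢
  refine squeeze_zero (fun _ => norm_nonneg _) (fun t => ?_) h
  rw [hT.map_comm t s, ← map_sub, ← map_smul]
  exact hT.norm_sub_le s _ _

theorem hasDerivWithinAt (hT : IsContractionSemigroup T) {f g : X} (h : IsGeneratorPair T f g)
    {s : ℝ} (hs : 0 ≤ s) :
    HasDerivWithinAt (fun t : ℝ => T t.toNNReal f) (T s.toNNReal g) (Ici s) s := by
  rw [hasDerivWithinAt_iff_tendsto_slope, Ici_sdiff_left]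
  have h1 := (hT.isGeneratorPair_map h s.toNNReal).comp (tendsto_sub_toNNReal s)
  refine h1.congr' ?_
  filter_upwards [self_mem_nhdsWithin] with y hy
  have hy' : s < y := hy
  simp only [Function.comp, slope, vsub_eq_sub]
  rw [Real.coe_toNNReal _ (sub_nonneg.2 hy'.le), toNNReal_add_right hs hy'.le,
    add_comm s.toNNReal, hT.add]

/-- A functional is preserved by a semigroup if its right derivative at time `0` vanishes at every
point. -/
theorem apply_map_eq (hT : IsContractionSemigroup T) {Λ : X → ℝ} (hΛ : Continuous Λ)
    (h : ∀ f, Tendsto (fun r : ℝ≥0 => (r : ℝ)⁻¹ * (Λ (T r f) - Λ f)) (𝓝[>] 0) (𝓝 0)) (t : ℝ≥0)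
    (f : X) : Λ (T t f) = Λ f := by
  have h1 := constant_of_has_deriv_right_zero (f := fun s : ℝ => Λ (T s.toNNReal f)) (a := 0)
    (b := t) (hΛ.comp (hT.continuous_toNNReal f)).continuousOn (fun s hs => by
      rw [hasDerivWithinAt_iff_tendsto_slope, Ici_sdiff_left]
      refine ((h (T s.toNNReal f)).comp (tendsto_sub_toNNReal s)).congr' ?_
      filter_upwards [self_mem_nhdsWithin] with y hy
      have hy' : s < y := hy
      simp only [Function.comp, slope, vsub_eq_sub, smul_eq_mul]
      rw [Real.coe_toNNReal _ (sub_nonneg.2 hy'.le), toNNReal_add_right hs.1 hy'.le,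
        add_comm s.toNNReal, hT.add]) t (right_mem_Icc.2 t.coe_nonneg)
  simpa [hT.zero] using h1

/-- A quantitative form of `(T t f - f) / t → g`, by the mean value inequality. -/
theorem norm_map_sub_sub_le (hT : IsContractionSemigroup T) {f g : X} (h : IsGeneratorPair T f g)
    (g' : X) {t : ℝ} (ht : 0 ≤ t) {ε : ℝ} (hε : ∀ s : ℝ≥0, (s : ℝ) ≤ t → ‖T s g' - g'‖ ≤ ε) :
    ‖T t.toNNReal f - f - t • g'‖ ≤ (‖g - g'‖ + ε) * t := by
  have h1 := image_norm_le_of_norm_deriv_right_le_deriv_boundary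
    (f := fun s : ℝ => T s.toNNReal f - f - s • g') (f' := fun s => T s.toNNReal g - g')
    (a := 0) (b := t) (B := fun s => (‖g - g'‖ + ε) * s) (B' := fun _ => ‖g - g'‖ + ε)
    (((hT.continuous_toNNReal f).sub continuous_const).sub
      (continuous_id.smul continuous_const)).continuousOn
    (fun s hs => by
      have := ((hT.hasDerivWithinAt h hs.1).sub_const f).sub
        ((hasDerivWithinAt_id s (Ici s)).smul_const g')
      rw [one_smul] at this
      exact this)
    (by simp [hT.zero])
    (fun s => by simpa using (hasDerivAt_id s).const_mul (‖g - g'‖ + ε))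
    (fun s hs => by
      have e : T s.toNNReal g - g' = (T s.toNNReal g - T s.toNNReal g') +
        (T s.toNNReal g' - g') := by abel
      rw [e]
      refine (norm_add_le _ _).trans (add_le_add (hT.norm_sub_le _ _ _) (hε _ ?_))
      rw [Real.coe_toNNReal _ hs.1]; exact hs.2.le)
  exact h1 (right_mem_Icc.2 ht)

/-- A bound that is uniform in the modulus of continuity of `T` at `g`, and hence passes to limits,
suffices for `g` to be the image of `f`. -/
theorem isGeneratorPair_of_bound (hT : IsContractionSemigroup T) {f g : X}
    (h : ∀ (t ε : ℝ), 0 ≤ t → (∀ s : ℝ≥0, (s : ℝ) ≤ t → ‖T s g - g‖ ≤ ε) →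
      ‖T t.toNNReal f - f - t • g‖ ≤ ε * t) : IsGeneratorPair T f g := by
  rw [IsGeneratorPair, Metric.tendsto_nhds]
  intro ε hε
  obtain ⟨δ, hδ, hd⟩ := Metric.tendsto_nhds_nhds.1 (hT.tendsto_nhds_zero g) (ε / 2) (half_pos hε)
  have : ∀ᶠ t : ℝ≥0 in 𝓝[>] 0, (t : ℝ) < δ := by
    have h1 : Tendsto (fun t : ℝ≥0 => (t : ℝ)) (𝓝[>] 0) (𝓝 0) :=
      tendsto_coe_nnreal_nhdsGT_zero.mono_right nhdsWithin_le_nhds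
    exact h1.eventually_lt_const hδ
  filter_upwards [this, self_mem_nhdsWithin] with t htd ht
  have ht' : (0 : ℝ) < t := ht
  have h2 := h t (ε / 2) ht'.le fun s hs => by
    have h3 := @hd s (by
      rw [NNReal.dist_eq, NNReal.coe_zero, sub_zero]
      exact (abs_of_nonneg s.2).trans_lt (hs.trans_lt htd))
    rw [dist_eq_norm] at h3
    exact h3.le
  rw [Real.toNNReal_coe] at h2
  rw [dist_eq_norm]
  have e : (t : ℝ)⁻¹ • (T t f - f) - g = (t : ℝ)⁻¹ • (T t f - f - (t : ℝ) • g) := by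
    rw [smul_sub (t : ℝ)⁻¹ (T t f - f), smul_smul, inv_mul_cancel₀ ht'.ne', one_smul]
  rw [e, norm_smul, norm_inv, Real.norm_of_nonneg ht'.le, inv_mul_lt_iff₀ ht']
  nlinarith

theorem isClosed_generator (hT : IsContractionSemigroup T) : (semigroupGenerator T).IsClosed := by
  refine IsSeqClosed.isClosed fun p q hp hq => ?_
  obtain ⟨f, g⟩ := q
  have hp' : ∀ n, IsGeneratorPair T (p n).1 (p n).2 := fun n => mem_graph_semigroupGenerator.1 (hp n)
  have hf : Tendsto (fun n => (p n).1) atTop (𝓝 f) := (continuous_fst.tendsto _).comp hq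
  have hg : Tendsto (fun n => (p n).2) atTop (𝓝 g) := (continuous_snd.tendsto _).comp hq
  refine mem_graph_semigroupGenerator.2 (hT.isGeneratorPair_of_bound fun t ε ht hε => ?_)
  have h1 : Tendsto (fun n => T t.toNNReal (p n).1) atTop (𝓝 (T t.toNNReal f)) := by
    rw [tendsto_iff_norm_sub_tendsto_zero] at hf ⊢
    exact squeeze_zero (fun _ => norm_nonneg _) (fun n => hT.norm_sub_le _ _ _) hf
  have h2 := ((h1.sub hf).sub_const (t • g)).norm
  have h3 := ((tendsto_iff_norm_sub_tendsto_zero.1 hg).add_const ε).mul_const t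
  rw [zero_add] at h3
  exact le_of_tendsto_of_tendsto' h2 h3 fun n => hT.norm_map_sub_sub_le (hp' n) g ht hε

/-- A contraction semigroup with densely defined generator is determined by its generator: the
function `s ↦ T' (t - s) (T s f)` has right derivative zero. -/
theorem eq_of_isGeneratorPair (hT : IsContractionSemigroup T) (hT' : IsContractionSemigroup T')
    (hd : Dense {f | ∃ g, IsGeneratorPair T f g})
    (h : ∀ f g, IsGeneratorPair T f g → IsGeneratorPair T' f g) (t : ℝ≥0) (f : X) :
    T t f = T' t f := by
  have hc : ∀ {S : ℝ≥0 → X →ₗ[ℝ] X}, IsContractionSemigroup S → Continuous (S t) := fun hS =>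
    (LipschitzWith.of_dist_le_mul (K := 1) fun x y => by
      rw [dist_eq_norm, dist_eq_norm, NNReal.coe_one, one_mul]
      exact hS.norm_sub_le t x y).continuous
  refine congrFun (Continuous.ext_on hd (hc hT) (hc hT') fun f hf => ?_) f
  obtain ⟨g, hg⟩ := hf
  have h1 := constant_of_has_deriv_right_zero (a := 0) (b := (t : ℝ))
    (f := fun s : ℝ => T' ((t : ℝ) - s).toNNReal (T s.toNNReal f)) ?_ ?_ t (right_mem_Icc.2 t.2)
  · simp only [sub_self, Real.toNNReal_zero, hT'.zero, Real.toNNReal_coe, hT.zero, sub_zero] at h1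
    exact h1
  · refine Continuous.continuousOn ?_
    rw [continuous_iff_continuousAt]
    intro s
    have h2 : Tendsto (fun r : ℝ => ‖T r.toNNReal f - T s.toNNReal f‖ +
        ‖T' ((t : ℝ) - r).toNNReal (T s.toNNReal f) - T' ((t : ℝ) - s).toNNReal (T s.toNNReal f)‖)
        (𝓝 s) (𝓝 0) := by
      have h3 : Continuous fun r : ℝ => ‖T r.toNNReal f - T s.toNNReal f‖ +
        ‖T' ((t : ℝ) - r).toNNReal (T s.toNNReal f) - T' ((t : ℝ) - s).toNNReal (T s.toNNReal f)‖ :=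
        ((hT.continuous_toNNReal f).sub continuous_const).norm.add
          (((hT'.continuous_toNNReal _).comp (continuous_const.sub continuous_id)).sub
            continuous_const).norm
      simpa using h3.tendsto s
    refine tendsto_iff_norm_sub_tendsto_zero.2 (squeeze_zero (fun _ => norm_nonneg _)
      (fun r => ?_) h2)
    refine (norm_sub_le_norm_sub_add_norm_sub _ (T' ((t : ℝ) - r).toNNReal (T s.toNNReal f)) _).trans
      (add_le_add (hT'.norm_sub_le _ _ _) le_rfl)
  · intro s hs
    rw [hasDerivWithinAt_iff_tendsto_slope, Ici_sdiff_left]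
    have hp := hT.isGeneratorPair_map hg s.toNNReal
    have h2 : Tendsto (fun r : ℝ≥0 => ‖(r : ℝ)⁻¹ • (T r (T s.toNNReal f) - T s.toNNReal f) -
        (r : ℝ)⁻¹ • (T' r (T s.toNNReal f) - T s.toNNReal f)‖) (𝓝[>] 0) (𝓝 0) := by
      have := (Tendsto.sub hp (h _ _ hp)).norm
      simpa using this
    have h3 := h2.comp (tendsto_sub_toNNReal s)
    rw [tendsto_zero_iff_norm_tendsto_zero]
    refine squeeze_zero' (Eventually.of_forall fun _ => norm_nonneg _) ?_ h3
    filter_upwards [Ioo_mem_nhdsGT hs.2] with y hy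
    have hsy : 0 ≤ y - s := (sub_pos.2 hy.1).le
    simp only [Function.comp, slope, vsub_eq_sub]
    rw [Real.coe_toNNReal _ hsy, ← smul_sub, norm_smul, norm_smul, sub_sub_sub_cancel_right]
    refine mul_le_mul_of_nonneg_left ?_ (norm_nonneg _)
    have e1 : ((t : ℝ) - s).toNNReal = ((t : ℝ) - y).toNNReal + (y - s).toNNReal := by
      rw [← Real.toNNReal_add (sub_nonneg.2 hy.2.le) hsy]; congr 1; ring
    rw [toNNReal_add_right hs.1 hy.1.le, e1, hT'.add, add_comm s.toNNReal, hT.add]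
    exact hT'.norm_sub_le _ _ _

/-- If the generator is symmetric for a continuous bilinear form, so is the semigroup: the function
`s ↦ b (T (t - s) f) (T s u)` has right derivative zero. -/
theorem bilin_symm (hT : IsContractionSemigroup T) (hd : Dense {f | ∃ g, IsGeneratorPair T f g})
    (b : X →L[ℝ] X →L[ℝ] ℝ)
    (hb : ∀ f g u v, IsGeneratorPair T f g → IsGeneratorPair T u v → b g u = b f v)
    (t : ℝ≥0) (f u : X) : b (T t f) u = b f (T t u) := by
  have hc : Continuous (T t) := (LipschitzWith.of_dist_le_mul (K := 1) fun x y => by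
      rw [dist_eq_norm, dist_eq_norm, NNReal.coe_one, one_mul]
      exact hT.norm_sub_le t x y).continuous
  have hc1 : ∀ u, Continuous fun f => b (T t f) u := fun u => (b.continuous.comp hc).clm_apply
    continuous_const
  have hc2 : ∀ u, Continuous fun f => b f (T t u) := fun u => b.continuous.clm_apply continuous_const
  refine congrFun (Continuous.ext_on hd (hc1 u) (hc2 u) fun f hf => ?_) f
  refine congrFun (Continuous.ext_on hd (b (T t f)).continuous ((b f).continuous.comp hc)
    fun u hu => ?_) u
  obtain ⟨g, hg⟩ := hf
  obtain ⟨v, hv⟩ := hu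
  have h1 := constant_of_has_deriv_right_zero (a := 0) (b := (t : ℝ))
    (f := fun s : ℝ => b (T ((t : ℝ) - s).toNNReal f) (T s.toNNReal u)) ?_ ?_ t (right_mem_Icc.2 t.2)
  · simp only [sub_self, Real.toNNReal_zero, hT.zero, Real.toNNReal_coe, sub_zero] at h1
    exact h1.symm
  · exact ((b.continuous.comp ((hT.continuous_toNNReal f).comp
      (continuous_const.sub continuous_id))).clm_apply (hT.continuous_toNNReal u)).continuousOn
  · intro s hs
    rw [hasDerivWithinAt_iff_tendsto_slope, Ici_sdiff_left]
    have hpf := hT.isGeneratorPair_map hg ((t : ℝ) - s).toNNReal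
    have hpu := hT.isGeneratorPair_map hv s.toNNReal
    have hf1 : Tendsto (fun y : ℝ => T ((t : ℝ) - y).toNNReal f) (𝓝[>] s)
        (𝓝 (T ((t : ℝ) - s).toNNReal f)) :=
      (((hT.continuous_toNNReal f).comp (continuous_const.sub continuous_id)).tendsto s).mono_left
        nhdsWithin_le_nhds
    have hg1 : Tendsto (fun y : ℝ => T ((t : ℝ) - y).toNNReal g) (𝓝[>] s)
        (𝓝 (T ((t : ℝ) - s).toNNReal g)) :=
      (((hT.continuous_toNNReal g).comp (continuous_const.sub continuous_id)).tendsto s).mono_left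
        nhdsWithin_le_nhds
    have hq : Tendsto (fun y : ℝ => (y - s)⁻¹ • (T (y - s).toNNReal (T s.toNNReal u) -
        T s.toNNReal u)) (𝓝[>] s) (𝓝 (T s.toNNReal v)) := by
      refine (hpu.comp (tendsto_sub_toNNReal s)).congr' ?_
      filter_upwards [self_mem_nhdsWithin] with y hy
      simp only [Function.comp]
      rw [Real.coe_toNNReal _ (sub_nonneg.2 (le_of_lt hy))]
    have hr0 : Tendsto (fun y : ℝ => (y - s)⁻¹ • (T (y - s).toNNReal f - f)) (𝓝[>] s) (𝓝 g) := by
      refine (Tendsto.comp hg (tendsto_sub_toNNReal s)).congr' ?_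
      filter_upwards [self_mem_nhdsWithin] with y hy
      simp only [Function.comp]
      rw [Real.coe_toNNReal _ (sub_nonneg.2 (le_of_lt hy))]
    have hr : Tendsto (fun y : ℝ => T ((t : ℝ) - y).toNNReal ((y - s)⁻¹ •
        (T (y - s).toNNReal f - f))) (𝓝[>] s) (𝓝 (T ((t : ℝ) - s).toNNReal g)) := by
      have h2 : Tendsto (fun y : ℝ => T ((t : ℝ) - y).toNNReal ((y - s)⁻¹ •
        (T (y - s).toNNReal f - f)) - T ((t : ℝ) - y).toNNReal g) (𝓝[>] s) (𝓝 0) :=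
        squeeze_zero_norm (fun y => hT.norm_sub_le _ _ _) (tendsto_iff_norm_sub_tendsto_zero.1 hr0)
      have h3 := h2.add hg1
      rw [zero_add] at h3
      exact h3.congr fun y => sub_add_cancel _ _
    have h4 := ((b.continuous₂.tendsto (_, _)).comp (hf1.prodMk_nhds hq)).sub
      ((b.continuous₂.tendsto (_, _)).comp (hr.prodMk_nhds (tendsto_const_nhds (x := T s.toNNReal u))))
    simp only [Function.uncurry] at h4
    rw [hb _ _ _ _ hpf hpu, sub_self] at h4
    refine h4.congr' ?_
    filter_upwards [Ioo_mem_nhdsGT hs.2] with y hy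
    have hsy : 0 ≤ y - s := (sub_pos.2 hy.1).le
    simp only [Function.comp, Function.uncurry, slope, vsub_eq_sub, map_smul, map_sub,
      smul_apply, sub_apply]
    have e1 : ((t : ℝ) - s).toNNReal = ((t : ℝ) - y).toNNReal + (y - s).toNNReal := by
      rw [← Real.toNNReal_add (sub_nonneg.2 hy.2.le) hsy]; congr 1; ring
    rw [toNNReal_add_right hs.1 hy.1.le, e1, hT.add, hT.add, hT.map_comm s.toNNReal, ← smul_sub]
    congr 1
    ring

/-- A subspace `S` of the domain is a core as soon as `1 - A` maps it onto a dense set. -/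
theorem hasCore_of_dense (hT : IsContractionSemigroup T) (S : Submodule ℝ X)
    (hS : S ≤ (semigroupGenerator T).domain)
    (hd : Dense {h | ∃ f ∈ S, ∃ g, IsGeneratorPair T f g ∧ f - g = h}) :
    (semigroupGenerator T).HasCore S := by
  refine ⟨hS, ?_⟩
  set A := semigroupGenerator T
  have hle : A.domRestrict S ≤ A := LinearPMap.domRestrict_le
  have hcl : A.IsClosed := hT.isClosed_generator
  have hcb : (A.domRestrict S).IsClosable := hcl.isClosable.leIsClosable hle
  refine LinearPMap.eq_of_eq_graph (le_antisymm ?_ ?_)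
  · rw [← hcb.graph_closure_eq_closure_graph]
    exact Submodule.topologicalClosure_minimal _ (LinearPMap.le_graph_of_le hle) hcl
  · rintro ⟨f, g⟩ hfg
    rw [← hcb.graph_closure_eq_closure_graph]
    have hp := mem_graph_semigroupGenerator.1 hfg
    obtain ⟨u, hu, hlim⟩ := mem_closure_iff_seq_limit.1 (hd (f - g))
    choose fn hfS gn hgn hun using hu
    have h1 : Tendsto (fun n => ‖u n - (f - g)‖) atTop (𝓝 0) :=
      tendsto_iff_norm_sub_tendsto_zero.1 hlim
    -- by dissipativity, `1 - A` has a bounded inverse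
    have hf : Tendsto fn atTop (𝓝 f) := by
      refine tendsto_iff_norm_sub_tendsto_zero.2 (squeeze_zero (fun _ => norm_nonneg _)
        (fun n => ?_) h1)
      have h2 := (hgn n).add (hp.smul (-1))
      have h3 := h2.mul_norm_le hT.norm_le 1 zero_le_one
      rw [one_mul, one_smul] at h3
      have e1 : fn n + (-1 : ℝ) • f = fn n - f := by module
      have e2 : fn n - f - (gn n + (-1 : ℝ) • g) = fn n - gn n - (f - g) := by module
      rwa [e1, e2, hun n] at h3
    have hg : Tendsto gn atTop (𝓝 g) := by
      have h2 := hf.sub hlim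
      rw [sub_sub_cancel] at h2
      refine h2.congr fun n => ?_
      rw [← hun n]; abel
    refine mem_closure_of_tendsto (hf.prodMk_nhds hg) (Eventually.of_forall fun n => ?_)
    refine (LinearPMap.mem_graph_iff _).2 ⟨⟨fn n, hfS n, hS (hfS n)⟩, rfl, ?_⟩
    exact (Exists.choose_spec (⟨gn n, hgn n⟩ : ∃ g, IsGeneratorPair T (fn n) g)).unique (hgn n)

/-- An extension of a surjective `1 - A` is trivial, because `1 - G` is injective for the
generator `G`. -/
theorem generator_eq_of_surjective (hT : IsContractionSemigroup T) (A : X →ₗ.[ℝ] X)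
    (hA : ∀ f : A.domain, IsGeneratorPair T f (A f))
    (hs : ∀ h, ∃ f : A.domain, (f : X) - A f = h) : semigroupGenerator T = A := by
  refine LinearPMap.eq_of_eq_graph (le_antisymm ?_ ?_)
  · rintro ⟨f, g⟩ hfg
    have hp := mem_graph_semigroupGenerator.1 hfg
    obtain ⟨f', hf'⟩ := hs (f - g)
    have h2 := (hp.add ((hA f').smul (-1))).mul_norm_le hT.norm_le 1 zero_le_one
    have e : (1 : ℝ) • (f + (-1 : ℝ) • (f' : X)) - (g + (-1 : ℝ) • A f') = 0 := by
      rw [one_smul, neg_one_smul, neg_one_smul, ← sub_eq_zero.2 hf'.symm]; abel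
    rw [e, norm_zero, one_mul] at h2
    have h3 : f = f' := by
      have := norm_le_zero_iff.1 h2
      rw [neg_one_smul, ← sub_eq_add_neg] at this
      exact sub_eq_zero.1 this
    have h4 : g = A f' := hp.unique (h3 ▸ hA f')
    exact (LinearPMap.mem_graph_iff _).2 ⟨f', h3.symm, h4.symm⟩
  · rintro ⟨f, g⟩ hfg
    obtain ⟨f', rfl, rfl⟩ := (LinearPMap.mem_graph_iff _).1 hfg
    exact mem_graph_semigroupGenerator.2 (hA f')

end IsContractionSemigroup

end ContractionSemigroup

/-! ### The Hille–Yosida theorem -/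

section HilleYosida

variable {X : Type*} [NormedAddCommGroup X] [NormedSpace ℝ X]

/-- The resolvent `(c - A)⁻¹` as a bounded operator. -/
theorem exists_resolvent (A : X →ₗ.[ℝ] X) {c : ℝ} (hc : 0 < c)
    (hdis : ∀ f : A.domain, c * ‖(f : X)‖ ≤ ‖c • (f : X) - A f‖)
    (hsurj : ∀ h, ∃ f : A.domain, c • (f : X) - A f = h) :
    ∃ R : X →L[ℝ] X, (∀ h, c * ‖R h‖ ≤ ‖h‖) ∧ (∀ f : A.domain, R (c • (f : X) - A f) = f) ∧
      ∀ h, ∃ f : A.domain, (f : X) = R h ∧ c • (f : X) - A f = h := by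
  choose r hr using hsurj
  have hinj : ∀ f f' : A.domain, c • (f : X) - A f = c • (f' : X) - A f' → f = f' := fun f f' h => by
    have h1 := hdis (f - f')
    rw [LinearPMap.map_sub, Submodule.coe_sub, smul_sub, sub_sub_sub_comm, h, sub_self,
      norm_zero] at h1
    have h2 : ‖(f : X) - f'‖ ≤ 0 := by
      by_contra! h3
      exact absurd h1 (not_le.2 (mul_pos hc h3))
    exact Subtype.ext (sub_eq_zero.1 (norm_le_zero_iff.1 h2))
  have hbd : ∀ h, c * ‖(r h : X)‖ ≤ ‖h‖ := fun h => (hdis (r h)).trans_eq (by rw [hr])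
  let R₀ : X →ₗ[ℝ] X :=
    { toFun := fun h => r h
      map_add' := fun h h' => by
        rw [← Submodule.coe_add]; congr 1
        apply hinj
        rw [hr, Submodule.coe_add, LinearPMap.map_add, smul_add, add_sub_add_comm, hr, hr]
      map_smul' := fun a h => by
        rw [RingHom.id_apply, ← Submodule.coe_smul]; congr 1
        apply hinj
        rw [hr, Submodule.coe_smul, LinearPMap.map_smul, smul_comm, ← smul_sub, hr] }
  refine ⟨R₀.mkContinuous c⁻¹ fun h => ?_, hbd, fun f => ?_, fun h => ⟨r h, rfl, hr h⟩⟩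
  · rw [← div_eq_inv_mul, le_div_iff₀ hc, mul_comm]; exact hbd h
  · exact congrArg Subtype.val (hinj _ _ (hr _))

variable [CompleteSpace X]

theorem exp_add_of_commute_clm {A B : X →L[ℝ] X} (h : Commute A B) :
    NormedSpace.exp (A + B) = NormedSpace.exp A * NormedSpace.exp B :=
  NormedSpace.exp_add_of_commute_of_mem_ball (𝕂 := ℝ) h
    ((NormedSpace.expSeries_radius_eq_top ℝ (X →L[ℝ] X)).symm ▸ edist_lt_top _ _)
    ((NormedSpace.expSeries_radius_eq_top ℝ (X →L[ℝ] X)).symm ▸ edist_lt_top _ _)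

theorem norm_exp_clm_le (B : X →L[ℝ] X) : ‖NormedSpace.exp B‖ ≤ Real.exp ‖B‖ := by
  have h1 := NormedSpace.exp_series_hasSum_exp' (𝕂 := ℝ) B
  have h2 := NormedSpace.exp_series_hasSum_exp' (𝕂 := ℝ) ‖B‖
  rw [← Real.exp_eq_exp_ℝ] at h2
  refine h1.norm_le_of_bounded h2 fun n => ?_
  rw [norm_smul, Real.norm_of_nonneg (by positivity), smul_eq_mul]
  refine mul_le_mul_of_nonneg_left ?_ (by positivity)
  induction n with
  | zero =>
    rw [pow_zero, pow_zero]
    exact ContinuousLinearMap.norm_id_le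
  | succ n ih =>
    rw [pow_succ, pow_succ]
    exact (norm_mul_le _ _).trans (mul_le_mul_of_nonneg_right ih (norm_nonneg _))

/-- For a contraction `J`, `exp (c (J - 1)) = exp (-c) exp (c J)` is a contraction. -/
theorem norm_exp_smul_sub_one_le {J : X →L[ℝ] X} (hJ : ‖J‖ ≤ 1) {c : ℝ} (hc : 0 ≤ c) :
    ‖NormedSpace.exp (c • (J - 1))‖ ≤ 1 := by
  have e : c • (J - 1) = c • J + algebraMap ℝ (X →L[ℝ] X) (-c) := by
    rw [Algebra.algebraMap_eq_smul_one, smul_sub, neg_smul, sub_eq_add_neg]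
  have hcomm : Commute (c • J) (algebraMap ℝ (X →L[ℝ] X) (-c)) := (Algebra.commutes _ _).symm
  rw [e, exp_add_of_commute_clm hcomm, ← NormedSpace.algebraMap_exp_comm,
    ← Real.exp_eq_exp_ℝ, Algebra.algebraMap_eq_smul_one, mul_smul_comm, mul_one, norm_smul,
    Real.norm_of_nonneg (Real.exp_pos _).le, Real.exp_neg]
  refine inv_mul_le_one_of_le₀ ((norm_exp_clm_le _).trans (Real.exp_le_exp.2 ?_)) (Real.exp_pos _).le
  rw [norm_smul, Real.norm_of_nonneg hc]
  exact mul_le_of_le_one_right hc hJ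

/-- The semigroup `exp (t A)` of a bounded operator `A`. -/
def expSemigroup (A : X →L[ℝ] X) (t : ℝ≥0) : X →ₗ[ℝ] X := (NormedSpace.exp ((t : ℝ) • A)).toLinearMap

theorem isGeneratorPair_expSemigroup (A : X →L[ℝ] X) (f : X) :
    IsGeneratorPair (expSemigroup A) f (A f) := by
  have h := (hasDerivAt_exp_smul_const (𝕂 := ℝ) A 0).clm_apply (hasDerivAt_const 0 f)
  simp only [zero_smul, NormedSpace.exp_zero, one_mul, map_zero, add_zero] at h
  have h1 := (hasDerivAt_iff_tendsto_slope.1 h).mono_left (nhdsGT_le_nhdsNE (0 : ℝ))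
  refine (h1.comp tendsto_coe_nnreal_nhdsGT_zero).congr fun t => ?_
  simp [slope, expSemigroup]

theorem isContractionSemigroup_exp {A : X →L[ℝ] X}
    (hA : ∀ c : ℝ, 0 ≤ c → ‖NormedSpace.exp (c • A)‖ ≤ 1) :
    IsContractionSemigroup (expSemigroup A) where
  zero f := by simp [expSemigroup]
  add s t f := by
    simp only [expSemigroup, NNReal.coe_add, add_smul]
    rw [exp_add_of_commute_clm (((Commute.refl A).smul_left _).smul_right _)]
    rfl
  norm_le t f := ((NormedSpace.exp ((t : ℝ) • A)).le_of_opNorm_le (hA t t.2) f).trans_eq (one_mul _)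
  tendsto_zero f := by
    have h := (hasDerivAt_exp_smul_const (𝕂 := ℝ) A 0).clm_apply (hasDerivAt_const 0 f)
    have h1 := h.continuousAt.tendsto
    simp only [zero_smul, NormedSpace.exp_zero] at h1
    exact (h1.mono_left nhdsWithin_le_nhds).comp tendsto_coe_nnreal_nhdsGT_zero

/-- Commuting bounded generators are compared along `s ↦ exp ((t - s) B) exp (s A) f`, which is
`exp (t B) exp (s (A - B)) f`. -/
theorem norm_exp_sub_exp_le {A B : X →L[ℝ] X} (hc : Commute A B)
    (hA : ∀ c : ℝ, 0 ≤ c → ‖NormedSpace.exp (c • A)‖ ≤ 1)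
    (hB : ∀ c : ℝ, 0 ≤ c → ‖NormedSpace.exp (c • B)‖ ≤ 1) (t : ℝ≥0) (f : X) :
    ‖expSemigroup A t f - expSemigroup B t f‖ ≤ t * ‖A f - B f‖ := by
  have hd : ∀ s : ℝ, HasDerivAt
      (fun s : ℝ => NormedSpace.exp ((t : ℝ) • B) (NormedSpace.exp (s • (A - B)) f))
      (NormedSpace.exp ((t : ℝ) • B) (NormedSpace.exp (s • (A - B)) ((A - B) f))) s := fun s => by
    have h := (hasDerivAt_exp_smul_const (𝕂 := ℝ) (A - B) s).clm_apply (hasDerivAt_const s f)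
    simp only [map_zero, add_zero] at h
    exact (NormedSpace.exp ((t : ℝ) • B)).hasFDerivAt.comp_hasDerivAt s h
  have hAB : ∀ a b : ℝ, Commute (a • A) (b • B) := fun a b => (hc.smul_left a).smul_right b
  have hBAB : ∀ a b : ℝ, Commute (a • B) (b • (A - B)) := fun a b =>
    ((hc.symm.sub_right (Commute.refl B)).smul_left a).smul_right b
  have hmul : ∀ s : ℝ, NormedSpace.exp ((t : ℝ) • B) * NormedSpace.exp (s • (A - B)) =
      NormedSpace.exp ((t - s) • B) * NormedSpace.exp (s • A) := fun s => by
    rw [← exp_add_of_commute_clm (hBAB _ _), ← exp_add_of_commute_clm (hAB _ _).symm]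
    congr 1; module
  have hb : ∀ s ∈ Ico (0 : ℝ) t,
      ‖NormedSpace.exp ((t : ℝ) • B) (NormedSpace.exp (s • (A - B)) ((A - B) f))‖ ≤
        ‖A f - B f‖ := fun s hs => by
    change ‖(NormedSpace.exp ((t : ℝ) • B) * NormedSpace.exp (s • (A - B))) ((A - B) f)‖ ≤ _
    rw [hmul]
    refine (ContinuousLinearMap.le_of_opNorm_le _ ?_ _).trans_eq (one_mul _)
    exact (norm_mul_le _ _).trans (mul_le_one₀ (hB _ (sub_nonneg.2 hs.2.le)) (norm_nonneg _)
      (hA _ hs.1))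
  have h := norm_image_sub_le_of_norm_deriv_le_segment' (a := 0) (b := (t : ℝ))
    (fun s _ => (hd s).hasDerivWithinAt) hb t (right_mem_Icc.2 t.2)
  have e : NormedSpace.exp ((t : ℝ) • B) (NormedSpace.exp ((t : ℝ) • (A - B)) f) =
      NormedSpace.exp ((t : ℝ) • A) f := by
    change (NormedSpace.exp ((t : ℝ) • B) * NormedSpace.exp ((t : ℝ) • (A - B))) f = _
    rw [hmul]; simp
  simp only [zero_smul, NormedSpace.exp_zero, one_apply_eq_self, sub_zero] at h
  rw [e, mul_comm] at h
  exact h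

theorem exists_tendsto_of_dense {E : ℕ → X →ₗ[ℝ] X} (hE : ∀ n f, ‖E n f‖ ≤ ‖f‖) {D : Set X}
    (hD : Dense D) (h : ∀ f ∈ D, ∃ g, Tendsto (fun n => E n f) atTop (𝓝 g)) (f : X) :
    ∃ g, Tendsto (fun n => E n f) atTop (𝓝 g) := by
  refine cauchySeq_tendsto_of_complete (Metric.cauchySeq_iff'.2 fun ε hε => ?_)
  obtain ⟨f', hf', hff'⟩ := Metric.mem_closure_iff.1 (hD f) (ε / 3) (by positivity)
  obtain ⟨g, hg⟩ := h f' hf'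
  obtain ⟨N, hN⟩ := Metric.cauchySeq_iff'.1 hg.cauchySeq (ε / 3) (by positivity)
  refine ⟨N, fun n hn => ?_⟩
  have h1 : ∀ k, dist (E k f) (E k f') < ε / 3 := fun k => by
    rw [dist_eq_norm, ← map_sub]
    exact (hE k _).trans_lt (by rwa [← dist_eq_norm])
  have h2 := dist_triangle4 (E n f) (E n f') (E N f') (E N f)
  have h3 := h1 n
  have h4 := h1 N
  rw [dist_comm] at h4
  linarith [hN n hn]

/-- The Hille–Yosida theorem: a densely defined dissipative operator `A` such that all `c - A` with
`c > 0` are surjective generates a contraction semigroup. It is the limit of the semigroups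
generated by the Yosida approximations `n (n (n - A)⁻¹ - 1)` of `A`. -/
theorem exists_contractionSemigroup (A : X →ₗ.[ℝ] X) (hd : Dense (A.domain : Set X))
    (hdis : ∀ c : ℝ, 0 < c → ∀ f : A.domain, c * ‖(f : X)‖ ≤ ‖c • (f : X) - A f‖)
    (hsurj : ∀ c : ℝ, 0 < c → ∀ h, ∃ f : A.domain, c • (f : X) - A f = h) :
    ∃ T : ℝ≥0 → X →ₗ[ℝ] X, IsContractionSemigroup T ∧ semigroupGenerator T = A := by
  have hc : ∀ n : ℕ, (0 : ℝ) < n + 1 := fun n => by positivity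
  choose R hRn hRl hRr using fun n : ℕ =>
    exists_resolvent A (hc n) (hdis _ (hc n)) (hsurj _ (hc n))
  let J : ℕ → X →L[ℝ] X := fun n => ((n : ℝ) + 1) • R n
  let Y : ℕ → X →L[ℝ] X := fun n => ((n : ℝ) + 1) • (J n - 1)
  have hJn : ∀ n f, ‖J n f‖ ≤ ‖f‖ := fun n f => by
    change ‖((n : ℝ) + 1) • R n f‖ ≤ _
    rw [norm_smul, Real.norm_of_nonneg (hc n).le]
    exact hRn n f
  have hJ1 : ∀ n, ‖J n‖ ≤ 1 := fun n =>
    ContinuousLinearMap.opNorm_le_bound _ zero_le_one fun f => by rw [one_mul]; exact hJn n f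
  have hJd : ∀ n (f : A.domain), J n f - f = R n (A f) := fun n f => by
    change ((n : ℝ) + 1) • R n f - f = _
    nth_rewrite 2 [← hRl n f]
    rw [← map_smul, ← map_sub, sub_sub_cancel]
  have hY : ∀ n (f : A.domain), Y n f = J n (A f) := fun n f => by
    change ((n : ℝ) + 1) • (J n f - f) = ((n : ℝ) + 1) • R n (A f)
    rw [hJd]
  have hJlim : ∀ f, Tendsto (fun n => J n f) atTop (𝓝 f) := by
    refine tendsto_of_dense (E := fun n => (J n).toLinearMap) hJn hd fun f hf => ?_
    refine tendsto_iff_norm_sub_tendsto_zero.2 (squeeze_zero (fun _ => norm_nonneg _) (fun n => ?_)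
      (by simpa using tendsto_one_div_add_atTop_nhds_zero_nat.mul_const ‖A ⟨f, hf⟩‖))
    have := hJd n ⟨f, hf⟩
    change J n f - f = _ at this
    change ‖J n f - f‖ ≤ _
    rw [this, ← div_eq_inv_mul, le_div_iff₀ (hc n), mul_comm]
    exact hRn n _
  have hYlim : ∀ f : A.domain, Tendsto (fun n => Y n f) atTop (𝓝 (A f)) := fun f =>
    (hJlim (A f)).congr fun n => (hY n f).symm
  have hRcomm : ∀ n m, Commute (R n) (R m) := fun n m => by
    ext f
    change R n (R m f) = R m (R n f)
    obtain ⟨u, hu, hu'⟩ := hRr n f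
    obtain ⟨w, hw, hw'⟩ := hRr m u
    -- `(m - A) ((n - A) w) = (n - A) ((m - A) w) = (n - A) u = f`
    have hAw : A w ∈ A.domain := by
      have : A w = ((m : ℝ) + 1) • (w : X) - u := by rw [← hw']; abel
      rw [this]
      exact A.domain.sub_mem (A.domain.smul_mem _ w.2) u.2
    let z : A.domain := ((n : ℝ) + 1) • w - ⟨A w, hAw⟩
    have hz : R m f = z := by
      rw [← hRl m z]
      congr 1
      have h1 : u = ((m : ℝ) + 1) • w - ⟨A w, hAw⟩ := by
        apply Subtype.ext
        rw [Submodule.coe_sub, Submodule.coe_smul, ← hw']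
      rw [← hu', h1]
      simp only [z, LinearPMap.map_sub, LinearPMap.map_smul, Submodule.coe_sub, Submodule.coe_smul]
      module
    rw [hz, ← hu, ← hw]
    exact hRl n w
  have hYcomm : ∀ n m, Commute (Y n) (Y m) := fun n m => by
    have h1 : Commute (J n) (J m) := ((hRcomm n m).smul_left _).smul_right _
    exact (((h1.sub_right (Commute.one_right _)).sub_left
      (Commute.one_left _)).smul_left _).smul_right _
  have hYexp : ∀ n (c : ℝ), 0 ≤ c → ‖NormedSpace.exp (c • Y n)‖ ≤ 1 := fun n c h => by
    rw [smul_smul]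
    exact norm_exp_smul_sub_one_le (hJ1 n) (mul_nonneg h (hc n).le)
  have hE : ∀ n, IsContractionSemigroup (expSemigroup (Y n)) := fun n =>
    isContractionSemigroup_exp (hYexp n)
  have hlim : ∀ t f, ∃ g, Tendsto (fun n => expSemigroup (Y n) t f) atTop (𝓝 g) := fun t => by
    refine exists_tendsto_of_dense (E := fun n => expSemigroup (Y n) t) (fun n => (hE n).norm_le t) hd
      fun f hf => cauchySeq_tendsto_of_complete (Metric.cauchySeq_iff.2 fun ε hε => ?_)
    obtain ⟨N, hN⟩ := Metric.cauchySeq_iff.1 (hYlim ⟨f, hf⟩).cauchySeq (ε / (t + 1)) (by positivity)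
    refine ⟨N, fun m hm n hn => ?_⟩
    have h1 := norm_exp_sub_exp_le (hYcomm m n) (hYexp m) (hYexp n) t f
    have h2 := hN m hm n hn
    rw [dist_eq_norm, lt_div_iff₀ (by positivity)] at h2
    rw [dist_eq_norm]
    refine h1.trans_lt (lt_of_le_of_lt ?_ h2)
    nlinarith [norm_nonneg (Y m f - Y n f)]
  choose S hS using hlim
  let T : ℝ≥0 → X →ₗ[ℝ] X := fun t =>
    { toFun := S t
      map_add' := fun f g => tendsto_nhds_unique (hS t (f + g))
        (by simpa only [map_add] using (hS t f).add (hS t g))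
      map_smul' := fun c f => tendsto_nhds_unique (hS t (c • f))
        (by simpa only [map_smul, RingHom.id_apply] using (hS t f).const_smul c) }
  have hTn : ∀ t f, ‖T t f‖ ≤ ‖f‖ := fun t f =>
    le_of_tendsto' (hS t f).norm fun n => (hE n).norm_le t f
  have hTd : ∀ (f : A.domain) (t : ℝ≥0), ‖T t f - f‖ ≤ ‖A f‖ * t := fun f t => by
    refine le_of_tendsto_of_tendsto' ((hS t f).sub_const (f : X)).norm
      ((hYlim f).norm.mul_const (t : ℝ)) fun n => ?_
    have h := (hE n).norm_map_sub_sub_le (isGeneratorPair_expSemigroup (Y n) f) 0 t.2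
      (ε := 0) (by simp)
    simpa using h
  have hT : IsContractionSemigroup T :=
    { zero := fun f => tendsto_nhds_unique (hS 0 f) (by simp [(hE _).zero])
      add := fun s t f => by
        refine tendsto_nhds_unique (hS (s + t) f) ?_
        simp only [(hE _).add]
        have h1 : Tendsto (fun n => expSemigroup (Y n) s (expSemigroup (Y n) t f) -
            expSemigroup (Y n) s (T t f)) atTop (𝓝 0) :=
          squeeze_zero_norm (fun n => (hE n).norm_sub_le s _ _)
            (tendsto_iff_norm_sub_tendsto_zero.1 (hS t f))
        have h2 := h1.add (hS s (T t f))
        rw [zero_add] at h2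
        exact h2.congr fun n => sub_add_cancel _ _
      norm_le := hTn
      tendsto_zero := tendsto_of_dense hTn hd fun f hf => by
        have h0 : Tendsto (fun t : ℝ≥0 => ‖A ⟨f, hf⟩‖ * (t : ℝ)) (𝓝[>] 0) (𝓝 0) := by
          simpa using (tendsto_coe_nnreal_nhdsGT_zero.mono_right nhdsWithin_le_nhds).const_mul
            ‖A ⟨f, hf⟩‖
        exact tendsto_iff_norm_sub_tendsto_zero.2
          (squeeze_zero (fun _ => norm_nonneg _) (hTd ⟨f, hf⟩) h0) }
  refine ⟨T, hT, hT.generator_eq_of_surjective A (fun f => ?_) fun h => ?_⟩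
  · -- `A f` is approximated by `g'` in the domain, because `exp (s Yₙ) g'` is close to `g'` for
    -- small `s`, uniformly in `n`
    rw [IsGeneratorPair, Metric.tendsto_nhds]
    intro ε hε
    obtain ⟨g', hg', hgg'⟩ := Metric.mem_closure_iff.1 (hd (A f)) (ε / 8) (by positivity)
    rw [dist_eq_norm] at hgg'
    have hbdd : ∀ᶠ n in atTop, ‖Y n g'‖ ≤ ‖A ⟨g', hg'⟩‖ + 1 := by
      have := (hYlim ⟨g', hg'⟩).norm.eventually_lt_const (lt_add_one _)
      filter_upwards [this] with n hn using hn.le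
    set M := ‖A ⟨g', hg'⟩‖ + 1 with hM
    have hMpos : 0 < M := by positivity
    have h0 : Tendsto (fun t : ℝ≥0 => M * (t : ℝ)) (𝓝[>] 0) (𝓝 0) := by
      simpa using (tendsto_coe_nnreal_nhdsGT_zero.mono_right nhdsWithin_le_nhds).const_mul M
    filter_upwards [h0.eventually_lt_const (by positivity : 0 < ε / 8), self_mem_nhdsWithin]
      with t ht htpos
    have htpos' : (0 : ℝ) < t := htpos
    have hb : ‖T t f - f - (t : ℝ) • A f‖ ≤ (0 + 3 * (ε / 8)) * t := by
      refine le_of_tendsto_of_tendsto (((hS t f).sub_const (f : X)).sub_const ((t : ℝ) • A f)).norm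
        (((tendsto_iff_norm_sub_tendsto_zero.1 (hYlim f)).add_const (3 * (ε / 8))).mul_const (t : ℝ))
        ?_
      filter_upwards [hbdd] with n hn
      have h := (hE n).norm_map_sub_sub_le (isGeneratorPair_expSemigroup (Y n) f) (A f) t.2
        (ε := 3 * (ε / 8)) ?_
      · simpa using h
      · intro s hs
        have h1 := (hE n).norm_map_sub_sub_le (isGeneratorPair_expSemigroup (Y n) g') 0 s.2
          (ε := 0) (by simp)
        simp only [NNReal.val_eq_coe, Real.toNNReal_coe, smul_zero, sub_zero, add_zero] at h1
        have h2 := (hE n).norm_sub_le s (A f) g'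
        have e : expSemigroup (Y n) s (A f) - A f =
          (expSemigroup (Y n) s (A f) - expSemigroup (Y n) s g') + (expSemigroup (Y n) s g' - g') -
            (A f - g') := by abel
        rw [e]
        have h3 : ‖Y n g'‖ * s ≤ M * t := mul_le_mul hn hs s.2 hMpos.le
        refine (norm_sub_le _ _).trans ?_
        have := norm_add_le (expSemigroup (Y n) s (A f) - expSemigroup (Y n) s g')
          (expSemigroup (Y n) s g' - g')
        linarith
    have e : (t : ℝ)⁻¹ • (T t f - f) - A f = (t : ℝ)⁻¹ • (T t f - f - (t : ℝ) • A f) := by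
      rw [smul_sub (t : ℝ)⁻¹ (T t f - f), smul_smul, inv_mul_cancel₀ htpos'.ne', one_smul]
    rw [dist_eq_norm, e, norm_smul, norm_inv, Real.norm_of_nonneg htpos'.le, inv_mul_lt_iff₀ htpos']
    nlinarith
  · obtain ⟨f, hf⟩ := hsurj 1 one_pos h
    exact ⟨f, by rwa [one_smul] at hf⟩

end HilleYosida

/-! ### The generator of sticky Brownian motion -/

section StickyGenerator

variable {ω L : ℝ} {hL : 0 < L}

/-- The left endpoint of `[0, L]`. -/
abbrev leftEnd (hL : 0 < L) : Icc (0 : ℝ) L := ⟨0, left_mem_Icc.2 hL.le⟩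

/-- The right endpoint of `[0, L]`. -/
abbrev rightEnd (hL : 0 < L) : Icc (0 : ℝ) L := ⟨L, right_mem_Icc.2 hL.le⟩

/-- `F`, `F'` and `F''` extend `f ∈ Dom(A)`, its derivative and `g = A f = f''` from `[0, L]` to the
real line, where `A` is the generator of sticky Brownian motion. -/
structure StickyExtension (ω : ℝ) (hL : 0 < L) (f g : C(Icc (0 : ℝ) L, ℝ)) (F F' F'' : ℝ → ℝ) :
    Prop where
  hasDerivAt : ∀ x, HasDerivAt F (F' x) x
  hasDerivAt' : ∀ x, HasDerivAt F' (F'' x) x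
  continuous'' : Continuous F''
  eq : ∀ x : Icc (0 : ℝ) L, F x = f x
  eq'' : ∀ x : Icc (0 : ℝ) L, F'' x = g x
  left : F'' 0 = ω * F' 0
  right : F'' L = -ω * F' L

namespace StickyExtension

variable {f g : C(Icc (0 : ℝ) L, ℝ)} {F F' F'' : ℝ → ℝ}

theorem continuous' (h : StickyExtension ω hL f g F F' F'') : Continuous F' :=
  continuous_iff_continuousAt.2 fun x => (h.hasDerivAt' x).continuousAt

theorem neg (h : StickyExtension ω hL f g F F' F'') :
    StickyExtension ω hL (-f) (-g) (-F) (-F') (-F'') where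
  hasDerivAt x := (h.hasDerivAt x).neg
  hasDerivAt' x := (h.hasDerivAt' x).neg
  continuous'' := h.continuous''.neg
  eq x := congrArg Neg.neg (h.eq x)
  eq'' x := congrArg Neg.neg (h.eq'' x)
  left := by simp [h.left]
  right := by simp [h.right]

end StickyExtension

theorem mem_graph_stickyGenerator {f g : C(Icc (0 : ℝ) L, ℝ)} :
    (f, g) ∈ (stickyGenerator ω L hL).graph ↔ ∃ F F' F'', StickyExtension ω hL f g F F' F'' := by
  have hu := uniqueDiffOn_Icc hL
  have h0 : (0 : ℝ) ∈ Icc 0 L := left_mem_Icc.2 hL.le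
  have hL' : L ∈ Icc 0 L := right_mem_Icc.2 hL.le
  constructor
  · intro hfg
    obtain ⟨⟨f, hfd⟩, rfl, rfl⟩ := (LinearPMap.mem_graph_iff _).1 hfg
    obtain ⟨hf, hf0, hfL⟩ := id hfd
    set g := stickyGenerator ω L hL ⟨f, hfd⟩ with hg
    set e := IccExtend hL.le f with he
    have hgx : ∀ x : Icc (0 : ℝ) L, g x = iteratedDerivWithin 2 e (Icc 0 L) x := fun x => rfl
    let F'' : ℝ → ℝ := IccExtend hL.le g
    have hF'' : Continuous F'' := g.continuous.Icc_extend'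
    have hF''x : ∀ x ∈ Icc 0 L, F'' x = iteratedDerivWithin 2 e (Icc 0 L) x := fun x hx => by
      simp only [F'', IccExtend_of_mem _ _ hx, hgx]
    let F' : ℝ → ℝ := fun x => derivWithin e (Icc 0 L) 0 + ∫ y in (0 : ℝ)..x, F'' y
    have hF' : ∀ x, HasDerivAt F' (F'' x) x := fun x =>
      ((hF''.integral_hasStrictDerivAt 0 x).hasDerivAt).const_add _
    have hF'c : Continuous F' := continuous_iff_continuousAt.2 fun x => (hF' x).continuousAt
    let F : ℝ → ℝ := fun x => e 0 + ∫ y in (0 : ℝ)..x, F' y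
    have hF : ∀ x, HasDerivAt F (F' x) x := fun x =>
      ((hF'c.integral_hasStrictDerivAt 0 x).hasDerivAt).const_add _
    have hd1 : DifferentiableOn ℝ (derivWithin e (Icc 0 L)) (Icc 0 L) := by
      have := hf.differentiableOn_iteratedDerivWithin (m := 1) (by norm_num) hu
      rwa [iteratedDerivWithin_one] at this
    have hF'e : ∀ x ∈ Icc 0 L, derivWithin e (Icc 0 L) x = F' x := by
      have := constant_of_derivWithin_zero (f := fun x => derivWithin e (Icc 0 L) x - F' x)
        (a := 0) (b := L) (hd1.sub fun x _ => (hF' x).differentiableAt.differentiableWithinAt)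
        fun x hx => by
          have hx' := Ico_subset_Icc_self hx
          have h1 := (hd1 x hx').hasDerivWithinAt.sub (hF' x).hasDerivWithinAt
          have h2 : F'' x = derivWithin (derivWithin e (Icc 0 L)) (Icc 0 L) x := by
            rw [hF''x x hx', iteratedDerivWithin_succ, iteratedDerivWithin_one]
          rw [h2, sub_self] at h1
          exact h1.derivWithin (hu x hx')
      intro x hx
      have h1 := this x hx
      simp only [F', intervalIntegral.integral_same, add_zero, sub_self] at h1
      exact sub_eq_zero.1 h1
    have hde : DifferentiableOn ℝ e (Icc 0 L) := hf.differentiableOn (by norm_num)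
    have hFe : ∀ x ∈ Icc 0 L, e x = F x := by
      have := constant_of_derivWithin_zero (f := fun x => e x - F x)
        (a := 0) (b := L) (hde.sub fun x _ => (hF x).differentiableAt.differentiableWithinAt)
        fun x hx => by
          have hx' := Ico_subset_Icc_self hx
          have h1 := (hde x hx').hasDerivWithinAt.sub (hF x).hasDerivWithinAt
          rw [hF'e x hx', sub_self] at h1
          exact h1.derivWithin (hu x hx')
      intro x hx
      have h1 := this x hx
      simp only [F, intervalIntegral.integral_same, add_zero, sub_self] at h1
      exact sub_eq_zero.1 h1
    refine ⟨F, F', F'', hF, hF', hF'', fun x => ?_, fun x => IccExtend_val _ _ x, ?_, ?_⟩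
    · rw [← hFe x x.2]; exact IccExtend_val _ _ x
    · rw [hF''x 0 h0, hf0, hF'e 0 h0]
    · rw [hF''x L hL', hfL, hF'e L hL']
  · rintro ⟨F, F', F'', h⟩
    have hef : EqOn (IccExtend hL.le f) F (Icc 0 L) := fun x hx => by
      rw [IccExtend_of_mem _ _ hx]; exact (h.eq ⟨x, hx⟩).symm
    have hC : ContDiff ℝ 2 F := by
      have h1 : deriv F = F' := funext fun x => (h.hasDerivAt x).deriv
      have h2 : deriv F' = F'' := funext fun x => (h.hasDerivAt' x).deriv
      have : (2 : WithTop ℕ∞) = 1 + 1 := by norm_num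
      rw [this, contDiff_succ_iff_deriv]
      refine ⟨fun x => (h.hasDerivAt x).differentiableAt, by simp, ?_⟩
      rw [h1, contDiff_one_iff_deriv, h2]
      exact ⟨fun x => (h.hasDerivAt' x).differentiableAt, h.continuous''⟩
    have hd1 : EqOn (derivWithin (IccExtend hL.le f) (Icc 0 L)) F' (Icc 0 L) := fun x hx => by
      rw [derivWithin_congr hef (hef hx)]
      exact (h.hasDerivAt x).hasDerivWithinAt.derivWithin (hu x hx)
    have hd2 : ∀ x ∈ Icc 0 L, iteratedDerivWithin 2 (IccExtend hL.le f) (Icc 0 L) x = F'' x :=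
      fun x hx => by
        rw [iteratedDerivWithin_succ, iteratedDerivWithin_one, derivWithin_congr hd1 (hd1 hx)]
        exact (h.hasDerivAt' x).hasDerivWithinAt.derivWithin (hu x hx)
    have hdom : f ∈ (stickyGenerator ω L hL).domain := by
      refine ⟨hC.contDiffOn.congr hef, ?_, ?_⟩
      · rw [hd2 0 h0, hd1 h0, h.left]
      · rw [hd2 L hL', hd1 hL', h.right]
    refine (LinearPMap.mem_graph_iff _).2 ⟨⟨f, hdom⟩, rfl, ?_⟩
    ext x
    exact (hd2 x x.2).trans (h.eq'' x)

theorem StickyExtension.mem_domain {f g : C(Icc (0 : ℝ) L, ℝ)} {F F' F'' : ℝ → ℝ}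
    (h : StickyExtension ω hL f g F F' F'') : f ∈ (stickyGenerator ω L hL).domain :=
  LinearPMap.mem_domain_of_mem_graph (mem_graph_stickyGenerator.2 ⟨F, F', F'', h⟩)

theorem StickyExtension.apply_eq {f : (stickyGenerator ω L hL).domain} {g : C(Icc (0 : ℝ) L, ℝ)}
    {F F' F'' : ℝ → ℝ} (h : StickyExtension ω hL f g F F' F'') : stickyGenerator ω L hL f = g := by
  obtain ⟨y, hy, rfl⟩ := (LinearPMap.mem_graph_iff _).1 (mem_graph_stickyGenerator.2 ⟨F, F', F'', h⟩)
  rw [Subtype.ext hy]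

theorem exists_stickyExtension (f : (stickyGenerator ω L hL).domain) :
    ∃ F F' F'', StickyExtension ω hL f (stickyGenerator ω L hL f) F F' F'' :=
  mem_graph_stickyGenerator.1 ((stickyGenerator ω L hL).mem_graph f)

/-- If the second derivative were negative, the local minimum would also be a local maximum, and the
function would be locally constant. -/
theorem nonneg_second_deriv_of_isLocalMin {F F' : ℝ → ℝ} {c x : ℝ}
    (h : ∀ y, HasDerivAt F (F' y) y) (h' : HasDerivAt F' c x) (hx : IsLocalMin F x) : 0 ≤ c := by
  by_contra! hc
  have hd : deriv F = F' := funext fun y => (h y).deriv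
  have h0 : F' x = 0 := hx.hasDerivAt_eq_zero (h x)
  have hmax := isLocalMax_of_deriv_deriv_neg (f := F) (x₀ := x) (by rw [hd, h'.deriv]; exact hc)
    (by rw [hd, h0]) (h x).continuousAt
  have heq : F =ᶠ[𝓝 x] fun _ => F x := by
    filter_upwards [hx, hmax] with y h1 h2 using le_antisymm h2 h1
  have h2 := heq.deriv
  rw [hd] at h2
  have h3 := h2.deriv_eq
  rw [h'.deriv] at h3
  simp at h3
  exact hc.ne h3

/-- At a minimum of `f ∈ Dom(A)` one has `A f ≥ 0`; at the endpoints, this is what the boundary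
conditions are for. -/
theorem StickyExtension.nonneg_of_forall_le (hω : 0 < ω) {f g : C(Icc (0 : ℝ) L, ℝ)}
    {F F' F'' : ℝ → ℝ} (h : StickyExtension ω hL f g F F' F'') {x : Icc (0 : ℝ) L}
    (hx : ∀ y, f x ≤ f y) : 0 ≤ g x := by
  obtain ⟨x, hx0, hxL⟩ := x
  have hF : ∀ y ∈ Icc 0 L, F x ≤ F y := fun y hy => by
    rw [h.eq ⟨x, hx0, hxL⟩, h.eq ⟨y, hy⟩]; exact hx _
  rw [← h.eq'' ⟨x, hx0, hxL⟩]
  change 0 ≤ F'' x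
  rcases hx0.eq_or_lt with rfl | hx0'
  · rw [h.left]
    refine mul_nonneg hω.le ?_
    have h1 := (hasDerivAt_iff_tendsto_slope.1 (h.hasDerivAt 0)).mono_left (nhdsGT_le_nhdsNE (0 : ℝ))
    refine ge_of_tendsto h1 ?_
    filter_upwards [Ioo_mem_nhdsGT hL] with y hy
    rw [slope_def_field]
    exact div_nonneg (sub_nonneg.2 (hF y ⟨hy.1.le, hy.2.le⟩)) (sub_nonneg.2 hy.1.le)
  rcases hxL.eq_or_lt with rfl | hxL'
  · rw [h.right, neg_mul, ← mul_neg]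
    refine mul_nonneg hω.le (neg_nonneg.2 ?_)
    have h1 := (hasDerivAt_iff_tendsto_slope.1 (h.hasDerivAt x)).mono_left (nhdsLT_le_nhdsNE x)
    refine le_of_tendsto h1 ?_
    filter_upwards [Ioo_mem_nhdsLT hx0'] with y hy
    rw [slope_def_field]
    exact div_nonpos_of_nonneg_of_nonpos (sub_nonneg.2 (hF y ⟨hy.1.le, hy.2.le⟩))
      (sub_nonpos.2 hy.2.le)
  · refine nonneg_second_deriv_of_isLocalMin h.hasDerivAt (h.hasDerivAt' x) ?_
    filter_upwards [Icc_mem_nhds hx0' hxL'] with y hy using hF y hy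

theorem StickyExtension.le_mul_of_forall_le (hω : 0 < ω) {f g : C(Icc (0 : ℝ) L, ℝ)}
    {F F' F'' : ℝ → ℝ} (h : StickyExtension ω hL f g F F' F'') {c m : ℝ} (hc : 0 < c)
    (hm : ∀ x, m ≤ c * f x - g x) (x : Icc (0 : ℝ) L) : m ≤ c * f x := by
  have : Nonempty (Icc (0 : ℝ) L) := ⟨x⟩
  obtain ⟨x₀, -, hx₀⟩ := isCompact_univ.exists_isMinOn univ_nonempty f.continuous.continuousOn
  have h1 := h.nonneg_of_forall_le hω (x := x₀) fun y => hx₀ (mem_univ y)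
  have h2 : c * f x₀ ≤ c * f x := mul_le_mul_of_nonneg_left (hx₀ (mem_univ x)) hc.le
  linarith [hm x₀]

/-- The maximum principle, applied to `f` and `-f`. -/
theorem stickyGenerator_dissipative (hω : 0 < ω) {c : ℝ} (hc : 0 < c)
    (f : (stickyGenerator ω L hL).domain) :
    c * ‖(f : C(Icc (0 : ℝ) L, ℝ))‖ ≤ ‖c • (f : C(Icc (0 : ℝ) L, ℝ)) - stickyGenerator ω L hL f‖ := by
  obtain ⟨F, F', F'', h⟩ := exists_stickyExtension f
  set u := c • (f : C(Icc (0 : ℝ) L, ℝ)) - stickyGenerator ω L hL f with hu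
  have hux : ∀ x, u x = c * (f : C(Icc (0 : ℝ) L, ℝ)) x - stickyGenerator ω L hL f x := fun x => rfl
  have hb : ∀ x, |u x| ≤ ‖u‖ := fun x => u.norm_coe_le_norm x
  have h1 : ‖c • (f : C(Icc (0 : ℝ) L, ℝ))‖ ≤ ‖u‖ := by
    refine (ContinuousMap.norm_le _ (norm_nonneg _)).2 fun x => ?_
    change |c * (f : C(Icc (0 : ℝ) L, ℝ)) x| ≤ ‖u‖
    refine abs_le.2 ⟨?_, ?_⟩
    · exact h.le_mul_of_forall_le hω hc (fun y => by rw [← hux]; exact (abs_le.1 (hb y)).1) x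
    · have h2 := h.neg.le_mul_of_forall_le hω hc (m := -‖u‖) (fun y => by
        have := (abs_le.1 (hb y)).2
        rw [hux] at this
        simp only [ContinuousMap.neg_apply]
        linarith) x
      simp only [ContinuousMap.neg_apply] at h2
      linarith
  rwa [norm_smul, Real.norm_of_nonneg hc.le] at h1

/-- The resolvent equation `c f - f'' = h`, solved by variation of constants. -/
theorem stickyGenerator_surjective (hω : 0 < ω) {c : ℝ} (hc : 0 < c) (h : C(Icc (0 : ℝ) L, ℝ)) :
    ∃ f : (stickyGenerator ω L hL).domain,
      c • (f : C(Icc (0 : ℝ) L, ℝ)) - stickyGenerator ω L hL f = h := by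
  obtain ⟨s, hs, rfl⟩ : ∃ s : ℝ, 0 < s ∧ c = s ^ 2 :=
    ⟨√c, Real.sqrt_pos.2 hc, (Real.sq_sqrt hc.le).symm⟩
  let H : ℝ → ℝ := IccExtend hL.le h
  have hH : Continuous H := h.continuous.Icc_extend'
  have hch : Continuous fun y => Real.cosh (s * y) * H y := by fun_prop
  have hsh : Continuous fun y => Real.sinh (s * y) * H y := by fun_prop
  let C : ℝ → ℝ := fun x => ∫ y in (0 : ℝ)..x, Real.cosh (s * y) * H y
  let S : ℝ → ℝ := fun x => ∫ y in (0 : ℝ)..x, Real.sinh (s * y) * H y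
  have hC : ∀ x, HasDerivAt C (Real.cosh (s * x) * H x) x := fun x =>
    (hch.integral_hasStrictDerivAt 0 x).hasDerivAt
  have hS : ∀ x, HasDerivAt S (Real.sinh (s * x) * H x) x := fun x =>
    (hsh.integral_hasStrictDerivAt 0 x).hasDerivAt
  have hl : ∀ x : ℝ, HasDerivAt (fun x : ℝ => s * x) s x := fun x => by
    simpa using (hasDerivAt_id x).const_mul s
  have hdc : ∀ x, HasDerivAt (fun x => Real.cosh (s * x)) (Real.sinh (s * x) * s) x := fun x =>
    (hl x).cosh
  have hds : ∀ x, HasDerivAt (fun x => Real.sinh (s * x)) (Real.cosh (s * x) * s) x := fun x =>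
    (hl x).sinh
  let P : ℝ → ℝ := fun x => -s⁻¹ * (Real.sinh (s * x) * C x - Real.cosh (s * x) * S x)
  let Q : ℝ → ℝ := fun x => -(Real.cosh (s * x) * C x - Real.sinh (s * x) * S x)
  have hP : ∀ x, HasDerivAt P (Q x) x := fun x => by
    refine ((((hds x).mul (hC x)).sub ((hdc x).mul (hS x))).const_mul (-s⁻¹)).congr_deriv ?_
    simp only [Q]
    field_simp
    ring
  have hQ : ∀ x, HasDerivAt Q (s ^ 2 * P x - H x) x := fun x => by
    refine ((((hdc x).mul (hC x)).sub ((hds x).mul (hS x))).neg).congr_deriv ?_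
    simp only [P]
    have h1 := Real.cosh_sq (s * x)
    field_simp
    linear_combination (-H x) * h1
  -- `a` and `b` are determined by the boundary conditions
  let den : ℝ := s ^ 2 * Real.cosh (s * L) + s ^ 3 / ω * Real.sinh (s * L) +
    ω * s * Real.sinh (s * L) + s ^ 2 * Real.cosh (s * L)
  have hsL : 0 < Real.sinh (s * L) := Real.sinh_pos_iff.2 (mul_pos hs hL)
  have hcL : 0 < Real.cosh (s * L) := Real.cosh_pos _
  have hden : 0 < den := by positivity
  let a : ℝ := (H L - s ^ 2 * P L - ω * Q L + s / ω * H 0 * Real.sinh (s * L) +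
    H 0 * Real.cosh (s * L)) / den
  let b : ℝ := (s ^ 2 * a - H 0) / (ω * s)
  let F : ℝ → ℝ := fun x => P x + a * Real.cosh (s * x) + b * Real.sinh (s * x)
  let F' : ℝ → ℝ := fun x => Q x + a * (Real.sinh (s * x) * s) + b * (Real.cosh (s * x) * s)
  let F'' : ℝ → ℝ := fun x => s ^ 2 * F x - H x
  have hF : ∀ x, HasDerivAt F (F' x) x := fun x =>
    ((hP x).add ((hdc x).const_mul a)).add ((hds x).const_mul b)
  have hF' : ∀ x, HasDerivAt F' (F'' x) x := fun x => by
    refine (((hQ x).add (((hds x).mul_const s).const_mul a)).add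
      (((hdc x).mul_const s).const_mul b)).congr_deriv ?_
    simp only [F'', F]
    ring
  have hFc : Continuous F := continuous_iff_continuousAt.2 fun x => (hF x).continuousAt
  let f : C(Icc (0 : ℝ) L, ℝ) := ⟨fun x => F x, hFc.comp continuous_subtype_val⟩
  have hext : StickyExtension ω hL f (s ^ 2 • f - h) F F' F'' :=
    { hasDerivAt := hF
      hasDerivAt' := hF'
      continuous'' := (continuous_const.mul hFc).sub hH
      eq := fun x => rfl
      eq'' := fun x => by
        simp only [F'', H, IccExtend_val]
        rfl
      left := by
        have hC0 : C 0 = 0 := intervalIntegral.integral_same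
        have hS0 : S 0 = 0 := intervalIntegral.integral_same
        simp only [F'', F, F', P, Q, hC0, hS0, b]
        simp
        field_simp
      right := by
        have ha : a * den = H L - s ^ 2 * P L - ω * Q L + s / ω * H 0 * Real.sinh (s * L) +
          H 0 * Real.cosh (s * L) := div_mul_cancel₀ _ hden.ne'
        simp only [F'', F, F', b]
        simp only [den] at ha
        field_simp at ha ⊢
        linear_combination ha }
  refine ⟨⟨f, hext.mem_domain⟩, ?_⟩
  rw [hext.apply_eq]
  exact sub_sub_cancel _ _

/-- Polynomials are dense, and a small oscillating perturbation repairs the boundary conditions of a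
polynomial: the derivatives of `A cos (a x) + B cos (b x)`, with `a L` an even and `b L` an odd
multiple of `π`, vanish at both endpoints, while its second derivatives there take prescribed values, which
allows `A` and `B` of order `a⁻²` and `b⁻²`. -/
theorem dense_domain_stickyGenerator :
    Dense ((stickyGenerator ω L hL).domain : Set C(Icc (0 : ℝ) L, ℝ)) := by
  have hpoly : Dense ((polynomialFunctions (Icc (0 : ℝ) L)) : Set C(Icc (0 : ℝ) L, ℝ)) := fun f => by
    have := polynomialFunctions_closure_eq_top 0 L
    have h2 : f ∈ (polynomialFunctions (Icc (0 : ℝ) L)).topologicalClosure := by rw [this]; trivial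
    exact h2
  intro f
  refine Metric.mem_closure_iff.2 fun ε hε => ?_
  obtain ⟨_, ⟨p, -, rfl⟩, hp⟩ := Metric.mem_closure_iff.1 (hpoly f) (ε / 2) (by positivity)
  -- the defects of `p` in the two boundary conditions
  let d₀ : ℝ := p.derivative.derivative.eval 0 - ω * p.derivative.eval 0
  let d₁ : ℝ := p.derivative.derivative.eval L + ω * p.derivative.eval L
  let a : ℕ → ℝ := fun k => (2 * k : ℝ) * Real.pi / L
  let b : ℕ → ℝ := fun k => (2 * k + 1 : ℝ) * Real.pi / L
  let A : ℕ → ℝ := fun k => (d₀ + d₁) / 2 / a k ^ 2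
  let B : ℕ → ℝ := fun k => (d₀ - d₁) / 2 / b k ^ 2
  have hat : Tendsto a atTop atTop := by
    have h1 : Tendsto (fun k : ℕ => (k : ℝ)) atTop atTop := tendsto_natCast_atTop_atTop
    exact ((h1.const_mul_atTop two_pos).atTop_mul_const Real.pi_pos).atTop_div_const hL
  have hbt : Tendsto b atTop atTop := by
    have h1 : Tendsto (fun k : ℕ => (k : ℝ)) atTop atTop := tendsto_natCast_atTop_atTop
    exact (((h1.const_mul_atTop two_pos).atTop_add tendsto_const_nhds).atTop_mul_const
      Real.pi_pos).atTop_div_const hL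
  have hA : Tendsto A atTop (𝓝 0) :=
    ((tendsto_pow_atTop two_ne_zero).comp hat).const_div_atTop _
  have hB : Tendsto B atTop (𝓝 0) :=
    ((tendsto_pow_atTop two_ne_zero).comp hbt).const_div_atTop _
  have hAB : Tendsto (fun k => |A k| + |B k|) atTop (𝓝 0) := by simpa using hA.abs.add hB.abs
  obtain ⟨k, hk, hk1⟩ := ((hAB.eventually_lt_const (by positivity : 0 < ε / 2)).and
    (eventually_gt_atTop 0)).exists
  have hkr : (0 : ℝ) < k := by exact_mod_cast hk1
  have ha : 0 < a k := div_pos (mul_pos (by positivity) Real.pi_pos) hL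
  have hb : 0 < b k := div_pos (mul_pos (by positivity) Real.pi_pos) hL
  have haL : a k * L = k * (2 * Real.pi) := by simp only [a]; field_simp
  have hbL : b k * L = k * (2 * Real.pi) + Real.pi := by simp only [b]; field_simp
  have hl : ∀ q x : ℝ, HasDerivAt (fun x : ℝ => q * x) q x := fun q x => by
    simpa using (hasDerivAt_id x).const_mul q
  let F : ℝ → ℝ := fun x => p.eval x + (A k * Real.cos (a k * x) + B k * Real.cos (b k * x))
  let F' : ℝ → ℝ := fun x => p.derivative.eval x +
    (A k * (-Real.sin (a k * x) * a k) + B k * (-Real.sin (b k * x) * b k))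
  let F'' : ℝ → ℝ := fun x => p.derivative.derivative.eval x +
    (A k * (-(Real.cos (a k * x) * a k) * a k) + B k * (-(Real.cos (b k * x) * b k) * b k))
  have hAa : A k * a k ^ 2 = (d₀ + d₁) / 2 := div_mul_cancel₀ _ (pow_ne_zero _ ha.ne')
  have hBb : B k * b k ^ 2 = (d₀ - d₁) / 2 := div_mul_cancel₀ _ (pow_ne_zero _ hb.ne')
  have hF'' : Continuous F'' := by fun_prop
  have hF : Continuous F := by fun_prop
  let g : C(Icc (0 : ℝ) L, ℝ) := ⟨fun x => F x, hF.comp continuous_subtype_val⟩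
  have hext : StickyExtension ω hL g ⟨fun x => F'' x, hF''.comp continuous_subtype_val⟩ F F' F'' :=
    { hasDerivAt := fun x => (p.hasDerivAt x).add ((((hl (a k) x).cos).const_mul _).add
        (((hl (b k) x).cos).const_mul _))
      hasDerivAt' := fun x => (p.derivative.hasDerivAt x).add
        (((((hl (a k) x).sin).neg.mul_const _).const_mul _).add
        ((((hl (b k) x).sin).neg.mul_const _).const_mul _))
      continuous'' := hF''
      eq := fun _ => rfl
      eq'' := fun _ => rfl
      left := by
        simp only [F'', F', mul_zero, Real.cos_zero, Real.sin_zero]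
        simp only [d₀, d₁] at hAa hBb
        linear_combination -hAa - hBb
      right := by
        simp only [F'', F']
        rw [haL, hbL, Real.cos_add_pi, Real.sin_add_pi, Real.cos_nat_mul_two_pi]
        have : Real.sin (k * (2 * Real.pi)) = 0 := by
          rw [← sub_zero (k * (2 * Real.pi)), Real.sin_nat_mul_two_pi_sub, Real.sin_zero, neg_zero]
        rw [this]
        simp only [d₀, d₁] at hAa hBb
        linear_combination -hAa + hBb }
  refine ⟨g, hext.mem_domain, ?_⟩
  have h1 : dist ((Polynomial.toContinuousMapOnAlgHom (Icc (0 : ℝ) L)) p) g < ε / 2 := by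
    refine (ContinuousMap.dist_lt_iff (by positivity)).2 fun x => lt_of_le_of_lt ?_ hk
    change |p.eval (x : ℝ) -
      (p.eval (x : ℝ) + (A k * Real.cos (a k * x) + B k * Real.cos (b k * x)))| ≤ _
    rw [sub_add_cancel_left, abs_neg]
    refine (abs_add_le _ _).trans (add_le_add ?_ ?_)
    · rw [abs_mul]; exact mul_le_of_le_one_right (abs_nonneg _) (Real.abs_cos_le_one _)
    · rw [abs_mul]; exact mul_le_of_le_one_right (abs_nonneg _) (Real.abs_cos_le_one _)
  exact (dist_triangle _ _ _).trans_lt ((add_lt_add hp h1).trans_eq (add_halves ε))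

theorem stickyExtension_one : StickyExtension ω hL 1 0 (fun _ => 1) (fun _ => 0) (fun _ => 0) where
  hasDerivAt x := hasDerivAt_const x _
  hasDerivAt' x := hasDerivAt_const x _
  continuous'' := continuous_const
  eq _ := rfl
  eq'' _ := rfl
  left := by simp
  right := by simp

/-! ### The invariant measure of sticky Brownian motion -/

theorem two_add_mul_pos (hω : 0 < ω) (hL : 0 < L) : 0 < 2 + ω * L := by positivity

theorem integral_lebesgueIcc (hL : 0 < L) (h : Icc (0 : ℝ) L → ℝ) :
    ∫ x, h x ∂lebesgueIcc L = ∫ x in (0 : ℝ)..L, IccExtend hL.le h x := by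
  rw [intervalIntegral.integral_of_le hL.le, ← integral_Icc_eq_integral_Ioc]
  have := integral_subtype_comap (μ := volume) (s := Icc 0 L) measurableSet_Icc (IccExtend hL.le h)
  simp only [IccExtend_val] at this
  exact this

instance isFiniteMeasure_lebesgueIcc : IsFiniteMeasure (lebesgueIcc L) :=
  ⟨by rw [lebesgueIcc, comap_subtype_coe_apply measurableSet_Icc, image_univ,
    Subtype.range_coe, Real.volume_Icc]; exact ENNReal.ofReal_lt_top⟩

theorem ContinuousMap.integrable {E : Type*} [MeasurableSpace E] [TopologicalSpace E]
    [CompactSpace E] [OpensMeasurableSpace E] (f : C(E, ℝ)) (μ : Measure E) [IsFiniteMeasure μ] :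
    Integrable f μ :=
  Integrable.of_bound f.continuous.aestronglyMeasurable ‖f‖ (Eventually.of_forall f.norm_coe_le_norm)

theorem integral_stickyMeasure (hω : 0 < ω) (hL : 0 < L) (h : C(Icc (0 : ℝ) L, ℝ)) :
    ∫ x, h x ∂stickyMeasure ω L hL = (2 + ω * L)⁻¹ *
      (h (leftEnd hL) + ω * (∫ x in (0 : ℝ)..L, IccExtend hL.le h x) + h (rightEnd hL)) := by
  have hp := two_add_mul_pos hω hL
  have hi : ∀ (r : ℝ) (ν : Measure (Icc (0 : ℝ) L)) [IsFiniteMeasure ν],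
      Integrable h (ENNReal.ofReal r • ν) := fun r ν _ =>
    (ContinuousMap.integrable h ν).smul_measure ENNReal.ofReal_ne_top
  rw [stickyMeasure, integral_add_measure ((hi _ _).add_measure (hi _ _)) (hi _ _),
    integral_add_measure (hi _ _) (hi _ _), integral_smul_measure, integral_smul_measure,
    integral_smul_measure, integral_dirac, integral_dirac, integral_lebesgueIcc hL,
    ENNReal.toReal_ofReal (by positivity), ENNReal.toReal_ofReal (by positivity)]
  simp only [smul_eq_mul]
  field_simp

theorem isProbabilityMeasure_stickyMeasure (hω : 0 < ω) (hL : 0 < L) :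
    IsProbabilityMeasure (stickyMeasure ω L hL) := by
  have hp := two_add_mul_pos hω hL
  have h := integral_stickyMeasure hω hL 1
  have h1 : (∫ x in (0 : ℝ)..L, IccExtend hL.le (1 : C(Icc (0 : ℝ) L, ℝ)) x) = L := by
    have : IccExtend hL.le (1 : C(Icc (0 : ℝ) L, ℝ)) = fun _ => (1 : ℝ) := rfl
    rw [this]; simp
  rw [h1] at h
  simp only [ContinuousMap.one_apply, integral_const, smul_eq_mul, mul_one] at h
  have h2 : (2 + ω * L)⁻¹ * (1 + ω * L + 1) = 1 := by field_simp; ring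
  rw [h2, measureReal_def] at h
  exact ⟨(ENNReal.toReal_eq_one_iff _).1 h⟩

/-- Integration by parts: the Dirichlet form of sticky Brownian motion has no boundary term. -/
theorem StickyExtension.integral_mul (hω : 0 < ω) {f g u v : C(Icc (0 : ℝ) L, ℝ)}
    {F F' F'' U U' U'' : ℝ → ℝ} (h : StickyExtension ω hL f g F F' F'')
    (h' : StickyExtension ω hL u v U U' U'') :
    ∫ x, f x * v x ∂stickyMeasure ω L hL =
      -((2 + ω * L)⁻¹ * ω * ∫ x in (0 : ℝ)..L, F' x * U' x) := by
  have h1 := integral_stickyMeasure hω hL (f * v)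
  have h2 : (∫ x in (0 : ℝ)..L, IccExtend hL.le (f * v) x) = ∫ x in (0 : ℝ)..L, F x * U'' x := by
    refine intervalIntegral.integral_congr fun x hx => ?_
    rw [uIcc_of_le hL.le] at hx
    rw [IccExtend_of_mem _ _ hx, h.eq ⟨x, hx⟩, h'.eq'' ⟨x, hx⟩]
    rfl
  have h3 := intervalIntegral.integral_mul_deriv_eq_deriv_mul (a := 0) (b := L)
    (u := F) (v := U') (u' := F') (v' := U'') (fun x _ => h.hasDerivAt x)
    (fun x _ => h'.hasDerivAt' x) (h.continuous'.intervalIntegrable _ _)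
    (h'.continuous''.intervalIntegrable _ _)
  rw [h2, h3] at h1
  simp only [ContinuousMap.mul_apply] at h1
  rw [h1, ← h.eq, ← h.eq, ← h'.eq'', ← h'.eq'', h'.left, h'.right]
  ring

theorem StickyExtension.integral_symm (hω : 0 < ω) {f g u v : C(Icc (0 : ℝ) L, ℝ)}
    {F F' F'' U U' U'' : ℝ → ℝ} (h : StickyExtension ω hL f g F F' F'')
    (h' : StickyExtension ω hL u v U U' U'') :
    ∫ x, g x * u x ∂stickyMeasure ω L hL = ∫ x, f x * v x ∂stickyMeasure ω L hL := by
  rw [h.integral_mul hω h']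
  have := h'.integral_mul hω h
  simp only [mul_comm (U' _)] at this
  rw [← this]
  simp only [mul_comm]

/-- The range of the generator consists of the functions of mean zero. -/
theorem exists_stickyGenerator_eq (hω : 0 < ω) {h : C(Icc (0 : ℝ) L, ℝ)}
    (hh : ∫ x, h x ∂stickyMeasure ω L hL = 0) :
    ∃ f : (stickyGenerator ω L hL).domain, stickyGenerator ω L hL f = h := by
  have hp := two_add_mul_pos hω hL
  let F'' : ℝ → ℝ := IccExtend hL.le h
  have hF'' : Continuous F'' := h.continuous.Icc_extend'
  have e0 : F'' 0 = h (leftEnd hL) := IccExtend_left _ _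
  have eL : F'' L = h (rightEnd hL) := IccExtend_right _ _
  let F' : ℝ → ℝ := fun x => F'' 0 / ω + ∫ y in (0 : ℝ)..x, F'' y
  have hF' : ∀ x, HasDerivAt F' (F'' x) x := fun x =>
    ((hF''.integral_hasStrictDerivAt 0 x).hasDerivAt).const_add _
  have hF'c : Continuous F' := continuous_iff_continuousAt.2 fun x => (hF' x).continuousAt
  let F : ℝ → ℝ := fun x => ∫ y in (0 : ℝ)..x, F' y
  have hF : ∀ x, HasDerivAt F (F' x) x := fun x => (hF'c.integral_hasStrictDerivAt 0 x).hasDerivAt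
  have hFc : Continuous F := continuous_iff_continuousAt.2 fun x => (hF x).continuousAt
  have hext : StickyExtension ω hL ⟨fun x => F x, hFc.comp continuous_subtype_val⟩ h F F' F'' :=
    { hasDerivAt := hF
      hasDerivAt' := hF'
      continuous'' := hF''
      eq := fun _ => rfl
      eq'' := fun x => IccExtend_val _ _ x
      left := by
        simp only [F', intervalIntegral.integral_same, add_zero]
        field_simp
      -- this boundary condition is equivalent to the mean being zero
      right := by
        rw [integral_stickyMeasure hω hL, mul_eq_zero, or_iff_right (inv_ne_zero hp.ne'), ← e0,
          ← eL] at hh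
        simp only [F']
        field_simp
        linear_combination hh }
  exact ⟨⟨_, hext.mem_domain⟩, hext.apply_eq⟩

end StickyGenerator

/-! ### Feller processes and contraction semigroups on continuous functions -/

section FellerRepresentation

/-- A contraction that fixes `1` is positive: if `0 ≤ f ≤ 2m`, then `‖f - m‖ ≤ m`. -/
theorem nonneg_of_norm_le {E : Type*} [TopologicalSpace E] [CompactSpace E]
    {S : C(E, ℝ) →ₗ[ℝ] C(E, ℝ)} (hS : ∀ f, ‖S f‖ ≤ ‖f‖)
    (h1 : S 1 = 1)
    {f : C(E, ℝ)} (hf : 0 ≤ f) : 0 ≤ S f := by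
  set m : ℝ := ‖f‖ / 2 with hm
  have hm0 : 0 ≤ m := by positivity
  have h2 : ‖f - m • 1‖ ≤ m := by
    refine (ContinuousMap.norm_le _ hm0).2 fun x => ?_
    have h3 := f.norm_coe_le_norm x
    have h4 : 0 ≤ f x := hf x
    rw [Real.norm_of_nonneg h4] at h3
    simp only [ContinuousMap.sub_apply, ContinuousMap.smul_apply, ContinuousMap.one_apply,
      smul_eq_mul, mul_one, Real.norm_eq_abs]
    exact abs_le.2 ⟨by linarith, by linarith⟩
  have h3 := (hS _).trans h2
  rw [map_sub, map_smul, h1] at h3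
  intro x
  have h4 := (ContinuousMap.norm_coe_le_norm (S f - m • 1) x).trans h3
  simp only [ContinuousMap.sub_apply, ContinuousMap.smul_apply, ContinuousMap.one_apply,
      smul_eq_mul, mul_one, Real.norm_eq_abs] at h4
  have := (abs_le.1 h4).1
  change 0 ≤ S f x
  linarith

variable {E : Type*} [MeasurableSpace E]

theorem measure_ext_of_continuousMap [TopologicalSpace E] [CompactSpace E] [BorelSpace E]
    [HasOuterApproxClosed E] {μ ν : Measure E}
    [IsFiniteMeasure μ] [IsFiniteMeasure ν] (h : ∀ f : C(E, ℝ), ∫ x, f x ∂μ = ∫ x, f x ∂ν) :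
    μ = ν :=
  ext_of_forall_integral_eq_of_IsFiniteMeasure fun f => h f.toContinuousMap

theorem norm_integral_continuousMap_le [TopologicalSpace E] [CompactSpace E] [BorelSpace E]
    (μ : Measure E) [IsProbabilityMeasure μ] (f : C(E, ℝ)) : ‖∫ x, f x ∂μ‖ ≤ ‖f‖ := by
  have := norm_integral_le_of_norm_le_const (μ := μ) (Eventually.of_forall f.norm_coe_le_norm)
  simpa using this

section Topological

variable [TopologicalSpace E] [CompactSpace E] [BorelSpace E]

theorem fellerOperator_apply {κ : ℝ≥0 → Kernel E E} (hκ : IsFellerSemigroup κ) (t : ℝ≥0)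
    (f : C(E, ℝ)) (x : E) : fellerOperator hκ t f x = ∫ y, f y ∂κ t x := rfl

theorem isContractionSemigroup_fellerOperator {κ : ℝ≥0 → Kernel E E} (hκ : IsFellerSemigroup κ) :
    IsContractionSemigroup (fellerOperator hκ) where
  zero f := by
    ext x
    rw [fellerOperator_apply, hκ.zero, Kernel.id_apply]
    exact integral_dirac' _ _ f.continuous.stronglyMeasurable
  add s t f := by
    have := hκ.markov
    ext x
    rw [fellerOperator_apply, fellerOperator_apply, add_comm, hκ.add]
    exact Kernel.integral_comp (ContinuousMap.integrable f _)
  norm_le t f := by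
    have := hκ.markov t
    exact (ContinuousMap.norm_le _ (norm_nonneg _)).2 fun x => norm_integral_continuousMap_le _ f
  tendsto_zero f := hκ.tendsto_zero f

theorem fellerOperator_one {κ : ℝ≥0 → Kernel E E} (hκ : IsFellerSemigroup κ) (t : ℝ≥0) :
    fellerOperator hκ t 1 = 1 := by
  have := hκ.markov t
  ext x
  simp [fellerOperator_apply]

theorem kernel_eq_of_fellerOperator_eq [HasOuterApproxClosed E] {κ κ' : ℝ≥0 → Kernel E E}
    (hκ : IsFellerSemigroup κ) (hκ' : IsFellerSemigroup κ')
    (h : ∀ t f, fellerOperator hκ t f = fellerOperator hκ' t f) : κ = κ' := by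
  have := hκ.markov
  have := hκ'.markov
  funext t
  ext1 x
  exact measure_ext_of_continuousMap fun f => congrArg (fun u : C(E, ℝ) => u x) (h t f)

end Topological

section Metric

variable [MetricSpace E] [BorelSpace E]

/-- The indicators of closed sets are limits of continuous functions. -/
theorem measurable_of_continuous_integral {μ : E → Measure E} [∀ x, IsProbabilityMeasure (μ x)]
    (h : ∀ f : C(E, ℝ), Continuous fun x => ∫ y, f y ∂μ x) : Measurable μ := by
  refine Measurable.measure_of_isPiSystem_of_isProbabilityMeasure
    (S := {s | IsClosed s}) ?_ isPiSystem_isClosed fun F hF => ?_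
  · rw [BorelSpace.measurable_eq (α := E), borel_eq_generateFrom_isClosed]
  have hδ : ∀ n : ℕ, (0 : ℝ) < 1 / ((n : ℝ) + 1) := fun n => by positivity
  have h1 : Measurable fun x => (μ x).real F := by
    refine measurable_of_tendsto_metrizable (f := fun (n : ℕ) x =>
      ∫ y, (thickenedIndicator (hδ n) F y : ℝ) ∂μ x) (fun n => ?_) (tendsto_pi_nhds.2 fun x =>
        tendsto_integral_thickenedIndicator_of_isClosed (μ x) hF hδ
          tendsto_one_div_add_atTop_nhds_zero_nat)
    exact (h ⟨fun y => (thickenedIndicator (hδ n) F y : ℝ),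
      NNReal.continuous_coe.comp (thickenedIndicator (hδ n) F).continuous⟩).measurable
  have h2 := h1.ennreal_ofReal
  simpa only [measureReal_def, ENNReal.ofReal_toReal (measure_ne_top _ _)] using h2

variable [CompactSpace E]

/-- The Riesz–Markov–Kakutani theorem on a compact space. -/
theorem exists_measure_of_positive (Λ : C(E, ℝ) →ₗ[ℝ] ℝ) (hΛ : ∀ f, 0 ≤ f → 0 ≤ Λ f)
    (h1 : Λ 1 = 1) : ∃ μ : Measure E, IsProbabilityMeasure μ ∧ ∀ f : C(E, ℝ), ∫ x, f x ∂μ = Λ f := by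
  let Λ₀ : CompactlySupportedContinuousMap E ℝ →ₗ[ℝ] ℝ :=
    { toFun := fun f => Λ f.toContinuousMap
      map_add' := fun f g => Λ.map_add f.toContinuousMap g.toContinuousMap
      map_smul' := fun c f => Λ.map_smul c f.toContinuousMap }
  let Λ' : CompactlySupportedContinuousMap E ℝ →ₚ[ℝ] ℝ :=
    PositiveLinearMap.mk₀ Λ₀ fun f hf => hΛ _ hf
  have hint : ∀ f : C(E, ℝ), ∫ x, f x ∂(RealRMK.rieszMeasure Λ') = Λ f := fun f =>
    RealRMK.integral_rieszMeasure Λ' (CompactlySupportedContinuousMap.continuousMapEquiv f)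
  refine ⟨RealRMK.rieszMeasure Λ', ?_, hint⟩
  have h2 := hint 1
  simp only [ContinuousMap.one_apply, integral_const, smul_eq_mul, mul_one, h1,
    measureReal_def] at h2
  exact ⟨(ENNReal.toReal_eq_one_iff _).1 h2⟩

/-- A contraction semigroup on `C(E)` that fixes `1` is the transition semigroup of a Feller
process. -/
theorem exists_fellerSemigroup {T : ℝ≥0 → C(E, ℝ) →ₗ[ℝ] C(E, ℝ)} (hT : IsContractionSemigroup T)
    (h1 : ∀ t, T t 1 = 1) :
    ∃ (κ : ℝ≥0 → Kernel E E) (hκ : IsFellerSemigroup κ), fellerOperator hκ = T := by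
  have hex := fun (t : ℝ≥0) (x : E) => exists_measure_of_positive
    ((ContinuousMap.evalCLM ℝ x).toLinearMap ∘ₗ T t)
    (fun f hf => nonneg_of_norm_le (hT.norm_le t) (h1 t) hf x)
    (by simp [h1])
  choose m hm hmi using hex
  have hmi' : ∀ t x (f : C(E, ℝ)), ∫ y, f y ∂m t x = T t f x := hmi
  have hcont : ∀ t (f : C(E, ℝ)), Continuous fun x => ∫ y, f y ∂m t x := fun t f => by
    simp only [hmi']; exact (T t f).continuous
  let κ : ℝ≥0 → Kernel E E := fun t =>
    { toFun := m t
      measurable' := measurable_of_continuous_integral (hcont t) }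
  have hκm : ∀ t, IsMarkovKernel (κ t) := fun t => ⟨hm t⟩
  have hκi : ∀ t x (f : C(E, ℝ)), ∫ y, f y ∂κ t x = T t f x := hmi
  have hκ : IsFellerSemigroup κ :=
    { markov := hκm
      zero := by
        ext1 x
        refine measure_ext_of_continuousMap fun f => ?_
        rw [hκi, hT.zero, Kernel.id_apply]
        exact (integral_dirac' _ _ f.continuous.stronglyMeasurable).symm
      add := fun s t => by
        ext1 x
        refine measure_ext_of_continuousMap fun f => ?_
        rw [hκi, Kernel.integral_comp (ContinuousMap.integrable f _), add_comm, hT.add]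
        simp only [hκi]
      continuous_integral := hcont
      tendsto_zero := fun f => by
        refine (hT.tendsto_zero f).congr fun t => ?_
        ext x
        exact (hmi' t x f).symm }
  refine ⟨κ, hκ, ?_⟩
  funext t
  ext f x
  exact hmi t x f

end Metric

end FellerRepresentation

/-! ### Existence and uniqueness of sticky Brownian motion -/

section StickyExistence

variable {ω L : ℝ}

theorem isGeneratorPair_of_stickyExtension {hL : 0 < L}
    {κ : ℝ≥0 → Kernel (Icc (0 : ℝ) L) (Icc (0 : ℝ) L)} (hκ : IsFellerSemigroup κ)
    (h : fellerGenerator hκ = stickyGenerator ω L hL) {f g : C(Icc (0 : ℝ) L, ℝ)} :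
    IsGeneratorPair (fellerOperator hκ) f g ↔ ∃ F F' F'', StickyExtension ω hL f g F F' F'' := by
  rw [← mem_graph_stickyGenerator, ← h]
  exact mem_graph_semigroupGenerator.symm

theorem existsUnique_stickyBrownianMotion (hω : 0 < ω) (hL : 0 < L) :
    ∃! κ : ℝ≥0 → Kernel (Icc (0 : ℝ) L) (Icc (0 : ℝ) L), IsStickyBrownianMotion ω L hL κ := by
  obtain ⟨T, hT, hTA⟩ := exists_contractionSemigroup (stickyGenerator ω L hL)
    dense_domain_stickyGenerator (fun c hc f => stickyGenerator_dissipative hω hc f)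
    (fun c hc h => stickyGenerator_surjective hω hc h)
  have hp : IsGeneratorPair T 1 0 := by
    rw [← mem_graph_semigroupGenerator, hTA, mem_graph_stickyGenerator]
    exact ⟨_, _, _, stickyExtension_one⟩
  have h1 : ∀ t, T t 1 = 1 := fun t => by
    have h := hT.norm_map_sub_sub_le hp 0 t.2 (ε := 0) (by simp)
    simp only [NNReal.val_eq_coe, Real.toNNReal_coe, sub_self, norm_zero, add_zero,
      zero_mul, smul_zero, sub_zero] at h
    exact sub_eq_zero.1 (norm_le_zero_iff.1 h)
  obtain ⟨κ, hκ, hκT⟩ := exists_fellerSemigroup hT h1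
  have hκA : fellerGenerator hκ = stickyGenerator ω L hL := by
    rw [← hTA, ← hκT]; rfl
  refine ⟨κ, ⟨hκ, hκA⟩, ?_⟩
  rintro κ' ⟨hκ', hκA'⟩
  refine kernel_eq_of_fellerOperator_eq hκ' hκ fun t f =>
    (isContractionSemigroup_fellerOperator hκ').eq_of_isGeneratorPair
      (isContractionSemigroup_fellerOperator hκ) ?_ (fun f g hfg => ?_) t f
  · have hd : Dense ((stickyGenerator ω L hL).domain : Set C(Icc (0 : ℝ) L, ℝ)) :=
      dense_domain_stickyGenerator
    rw [← hκA'] at hd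
    exact hd
  · rw [isGeneratorPair_of_stickyExtension hκ hκA]
    exact (isGeneratorPair_of_stickyExtension hκ' hκA').1 hfg

end StickyExistence

/-! ### Markov kernels on `L²` -/

section L2

variable {E : Type*} [MeasurableSpace E]

theorem norm_l2Operator_le (κ : Kernel E E) [IsMarkovKernel κ] {μ : Measure E}
    (hμ : κ.Invariant μ) (f : Lp ℝ 2 μ) : ‖l2Operator κ μ hμ f‖ ≤ ‖f‖ := by
  have hf : StronglyMeasurable (f : E → ℝ) := Lp.stronglyMeasurable f
  change ‖(memLp_kernel_integral κ hμ f).toLp _‖ ≤ ‖f‖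
  rw [Lp.norm_toLp, Lp.norm_def]
  refine ENNReal.toReal_mono (Lp.eLpNorm_ne_top f) ?_
  rw [eLpNorm_eq_lintegral_rpow_enorm_toReal (by simp) (by simp),
    eLpNorm_eq_lintegral_rpow_enorm_toReal (by simp) (by simp)]
  refine ENNReal.rpow_le_rpow ?_ (by simp)
  refine le_of_le_of_eq ?_ (lintegral_invariant κ hμ (hf.enorm.pow_const _))
  refine lintegral_mono fun x => ?_
  have h1 : ‖∫ y, f y ∂κ x‖ₑ ≤ eLpNorm (f : E → ℝ) 2 (κ x) :=
    (enorm_integral_le_lintegral_enorm _).trans <| by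
      rw [← eLpNorm_one_eq_lintegral_enorm]
      exact eLpNorm_le_eLpNorm_of_exponent_le (by norm_num) hf.aestronglyMeasurable
  calc ‖∫ y, f y ∂κ x‖ₑ ^ (2 : ℝ≥0∞).toReal
      ≤ (eLpNorm (f : E → ℝ) 2 (κ x)) ^ (2 : ℝ≥0∞).toReal := by gcongr
    _ = _ := by
      rw [eLpNorm_eq_lintegral_rpow_enorm_toReal (by simp) (by simp), ← ENNReal.rpow_mul,
        one_div, inv_mul_cancel₀ (by simp), ENNReal.rpow_one]

theorem coeFn_l2Operator (κ : Kernel E E) [IsMarkovKernel κ] {μ : Measure E}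
    (hμ : κ.Invariant μ) (f : Lp ℝ 2 μ) {f₀ : E → ℝ} (hf : f =ᵐ[μ] f₀) :
    l2Operator κ μ hμ f =ᵐ[μ] fun x => ∫ y, f₀ y ∂κ x := by
  refine (MemLp.coeFn_toLp (memLp_kernel_integral κ hμ f)).trans ?_
  filter_upwards [ae_kernel_of_ae κ hμ hf] with x hx using integral_congr_ae hx

/-- A Markov kernel that is symmetric on `L²(μ)` is reversible. -/
theorem isReversible_of_l2Operator_symm (κ : Kernel E E) [IsMarkovKernel κ] {μ : Measure E}
    [IsFiniteMeasure μ] (hμ : κ.Invariant μ)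
    (h : ∀ f g : Lp ℝ 2 μ, inner ℝ (l2Operator κ μ hμ f) g = inner ℝ f (l2Operator κ μ hμ g)) :
    κ.IsReversible μ := by
  have key : ∀ {A B : Set E} (hA : MeasurableSet A) (hB : MeasurableSet B),
      inner ℝ (indicatorConstLp 2 hA (measure_ne_top μ A) (1 : ℝ))
        (l2Operator κ μ hμ (indicatorConstLp 2 hB (measure_ne_top μ B) (1 : ℝ))) =
        (∫⁻ x in A, κ x B ∂μ).toReal := fun {A B} hA hB => by
    rw [L2.inner_indicatorConstLp_one]
    have h1 := coeFn_l2Operator κ hμ _ (indicatorConstLp_coeFn (p := 2) (hs := hB)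
      (hμs := measure_ne_top μ B) (c := (1 : ℝ)))
    rw [setIntegral_congr_ae hA (h1.mono fun x hx _ => hx)]
    simp only [integral_indicator_const _ hB, smul_eq_mul, mul_one, measureReal_def]
    exact integral_toReal (κ.measurable_coe hB).aemeasurable
      (Eventually.of_forall fun x => measure_lt_top _ _)
  intro A B hA hB
  have hfin : ∀ A B : Set E, ∫⁻ x in A, κ x B ∂μ ≠ ∞ := fun A B => by
    refine ((lintegral_mono (fun x => prob_le_one (μ := κ x) (s := B))).trans_lt ?_).ne
    simp
  rw [← ENNReal.toReal_eq_toReal_iff' (hfin _ _) (hfin _ _), ← key hA hB, ← key hB hA, ← h,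
    real_inner_comm]

section Feller

variable [TopologicalSpace E] [CompactSpace E] [BorelSpace E]

theorem integral_bind_kernel (κ : Kernel E E) [IsMarkovKernel κ] (ν : Measure E)
    [IsFiniteMeasure ν] (f : C(E, ℝ)) : ∫ x, f x ∂(ν.bind κ) = ∫ x, ∫ y, f y ∂κ x ∂ν := by
  have h := Kernel.integral_comp (η := κ) (κ := Kernel.const Unit ν) (a := ())
    (ContinuousMap.integrable f _)
  rwa [Kernel.comp_const, Kernel.const_apply, Kernel.const_apply] at h

theorem integral_fellerOperator {κ : ℝ≥0 → Kernel E E} (hκ : IsFellerSemigroup κ)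
    {ν : Measure E} [IsFiniteMeasure ν] (hν : IsInvariantMeasure κ ν) (t : ℝ≥0) (f : C(E, ℝ)) :
    ∫ x, fellerOperator hκ t f x ∂ν = ∫ x, f x ∂ν := by
  have := hκ.markov t
  simp only [fellerOperator_apply]
  conv_rhs => rw [← (hν t).def]
  exact (integral_bind_kernel _ _ f).symm

theorem isInvariantMeasure_of_integral [HasOuterApproxClosed E] {κ : ℝ≥0 → Kernel E E}
    (hκ : ∀ t, IsMarkovKernel (κ t)) {ν : Measure E} [IsFiniteMeasure ν]
    (h : ∀ t (f : C(E, ℝ)), ∫ x, ∫ y, f y ∂κ t x ∂ν = ∫ x, f x ∂ν) : IsInvariantMeasure κ ν := by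
  intro t
  refine measure_ext_of_continuousMap fun f => ?_
  rw [← h t f]
  exact integral_bind_kernel _ _ f

theorem continuous_integral_continuousMap (ν : Measure E) [IsProbabilityMeasure ν] :
    Continuous fun u : C(E, ℝ) => ∫ x, u x ∂ν :=
  continuous_iff_continuousAt.2 fun u => tendsto_iff_norm_sub_tendsto_zero.2 <| by
    refine squeeze_zero (fun _ => norm_nonneg _) (fun w => ?_)
      (tendsto_iff_norm_sub_tendsto_zero.1 (tendsto_id (x := 𝓝 u)))
    rw [← integral_sub (ContinuousMap.integrable w ν) (ContinuousMap.integrable u ν)]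
    exact norm_integral_continuousMap_le ν (w - u)

theorem integral_eq_zero_of_isGeneratorPair {κ : ℝ≥0 → Kernel E E} (hκ : IsFellerSemigroup κ)
    {ν : Measure E} [IsProbabilityMeasure ν] (hν : IsInvariantMeasure κ ν) {f g : C(E, ℝ)}
    (h : IsGeneratorPair (fellerOperator hκ) f g) : ∫ x, g x ∂ν = 0 := by
  have hc := continuous_integral_continuousMap ν
  refine tendsto_nhds_unique ((hc.tendsto g).comp h) (tendsto_const_nhds.congr fun t => ?_)
  have h1 := integral_fellerOperator hκ hν t f
  simp only [Function.comp, ContinuousMap.smul_apply, ContinuousMap.sub_apply, smul_eq_mul]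
  rw [integral_const_mul, integral_sub (ContinuousMap.integrable _ ν)
    (ContinuousMap.integrable f ν), h1, sub_self, mul_zero]

theorem l2Operator_toLp {κ : ℝ≥0 → Kernel E E} (hκ : IsFellerSemigroup κ) (t : ℝ≥0)
    [IsMarkovKernel (κ t)] {μ : Measure E} [IsFiniteMeasure μ] (hμ : (κ t).Invariant μ) (f : C(E, ℝ)) :
    l2Operator (κ t) μ hμ (ContinuousMap.toLp 2 μ ℝ f) =
      ContinuousMap.toLp 2 μ ℝ (fellerOperator hκ t f) :=
  Lp.ext <| (coeFn_l2Operator (κ t) hμ _ (ContinuousMap.coeFn_toLp μ f)).trans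
    (ContinuousMap.coeFn_toLp μ (fellerOperator hκ t f)).symm

end Feller

section Metric

variable [MetricSpace E] [CompactSpace E] [BorelSpace E]

theorem dense_range_toLp (μ : Measure E) [IsFiniteMeasure μ] :
    Dense (range (ContinuousMap.toLp 2 μ ℝ : C(E, ℝ) →L[ℝ] Lp ℝ 2 μ)) :=
  ContinuousMap.toLp_denseRange ℝ μ ℝ (by norm_num)

/-- The operators of a Feller process form a contraction semigroup on `L²`, by density of the
continuous functions. -/
theorem isContractionSemigroup_l2Operator {κ : ℝ≥0 → Kernel E E} (hκ : IsFellerSemigroup κ)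
    {μ : Measure E} [IsFiniteMeasure μ] (hμ : IsInvariantMeasure κ μ) :
    IsContractionSemigroup fun t => have := hκ.markov t; l2Operator (κ t) μ (hμ t) := by
  have := hκ.markov
  have hT := isContractionSemigroup_fellerOperator hκ
  have hn : ∀ t f, ‖l2Operator (κ t) μ (hμ t) f‖ ≤ ‖f‖ := fun t f => norm_l2Operator_le _ _ f
  have hc : ∀ t, Continuous (l2Operator (κ t) μ (hμ t)) := fun t =>
    (LipschitzWith.of_dist_le_mul (K := 1) fun x y => by
      rw [dist_eq_norm, dist_eq_norm, NNReal.coe_one, one_mul, ← map_sub]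
      exact hn t _).continuous
  have hd := dense_range_toLp μ
  refine ⟨fun f => ?_, fun s t f => ?_, hn, tendsto_of_dense hn hd ?_⟩
  · refine congrFun (Continuous.ext_on hd (hc 0) continuous_id ?_) f
    rintro _ ⟨u, rfl⟩
    rw [l2Operator_toLp hκ, hT.zero]; rfl
  · refine congrFun (Continuous.ext_on hd (hc (s + t)) ((hc s).comp (hc t)) ?_) f
    rintro _ ⟨u, rfl⟩
    simp only [Function.comp]
    rw [l2Operator_toLp hκ, l2Operator_toLp hκ, l2Operator_toLp hκ, hT.add]
  · rintro _ ⟨u, rfl⟩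
    simp only [l2Operator_toLp hκ]
    exact ((ContinuousMap.toLp 2 μ ℝ).continuous.tendsto u).comp (hT.tendsto_zero u)

theorem isGeneratorPair_l2Operator {κ : ℝ≥0 → Kernel E E} (hκ : IsFellerSemigroup κ)
    {μ : Measure E} [IsFiniteMeasure μ] (hμ : IsInvariantMeasure κ μ) {f g : C(E, ℝ)}
    (h : IsGeneratorPair (fellerOperator hκ) f g) :
    IsGeneratorPair (fun t => have := hκ.markov t; l2Operator (κ t) μ (hμ t))
      (ContinuousMap.toLp 2 μ ℝ f) (ContinuousMap.toLp 2 μ ℝ g) := by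
  have := hκ.markov
  refine (((ContinuousMap.toLp 2 μ ℝ).continuous.tendsto g).comp h).congr fun t => ?_
  simp only [Function.comp, map_smul, map_sub]
  rw [← l2Operator_toLp hκ t (hμ t)]

/-- If the `C⁰`-generator is symmetric for `⟨·,·⟩_μ`, then so is the semigroup on `L²`. -/
theorem l2_symm_of_generator {κ : ℝ≥0 → Kernel E E} (hκ : IsFellerSemigroup κ)
    (hd : Dense {f | ∃ g, IsGeneratorPair (fellerOperator hκ) f g})
    {μ : Measure E} [IsFiniteMeasure μ]
    (hb : ∀ f g u v, IsGeneratorPair (fellerOperator hκ) f g →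
      IsGeneratorPair (fellerOperator hκ) u v → ∫ x, g x * u x ∂μ = ∫ x, f x * v x ∂μ)
    (t : ℝ≥0) (f u : C(E, ℝ)) :
    ∫ x, fellerOperator hκ t f x * u x ∂μ = ∫ x, f x * fellerOperator hκ t u x ∂μ := by
  let b : C(E, ℝ) →L[ℝ] C(E, ℝ) →L[ℝ] ℝ :=
    (innerSL ℝ).bilinearComp (ContinuousMap.toLp 2 μ ℝ) (ContinuousMap.toLp 2 μ ℝ)
  have hbi : ∀ f u : C(E, ℝ), b f u = ∫ x, f x * u x ∂μ := fun f u => by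
    refine (ContinuousMap.inner_toLp μ f u).trans (integral_congr_ae (Eventually.of_forall fun x => ?_))
    exact mul_comm _ _
  have := (isContractionSemigroup_fellerOperator hκ).bilin_symm hd b (fun f g u v hfg huv => by
    rw [hbi, hbi]; exact hb f g u v hfg huv) t f u
  rwa [hbi, hbi] at this

end Metric

end L2

/-! ### Sticky Brownian motion on `L²` -/

section StickyL2

variable {ω L : ℝ} {hL : 0 < L} {κ : ℝ≥0 → Kernel (Icc (0 : ℝ) L) (Icc (0 : ℝ) L)}

theorem sticky_integral_symm (hω : 0 < ω) (hκ : IsFellerSemigroup κ)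
    (h : fellerGenerator hκ = stickyGenerator ω L hL) (t : ℝ≥0) (f u : C(Icc (0 : ℝ) L, ℝ)) :
    ∫ x, fellerOperator hκ t f x * u x ∂stickyMeasure ω L hL =
      ∫ x, f x * fellerOperator hκ t u x ∂stickyMeasure ω L hL := by
  refine l2_symm_of_generator hκ ?_ (fun f g u v hfg huv => ?_) t f u
  · have hd : Dense ((stickyGenerator ω L hL).domain : Set C(Icc (0 : ℝ) L, ℝ)) :=
      dense_domain_stickyGenerator
    rw [← h] at hd
    exact hd
  · obtain ⟨F, F', F'', hF⟩ := (isGeneratorPair_of_stickyExtension hκ h).1 hfg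
    obtain ⟨U, U', U'', hU⟩ := (isGeneratorPair_of_stickyExtension hκ h).1 huv
    exact hF.integral_symm hω hU

theorem sticky_isInvariantMeasure (hω : 0 < ω) (hκ : IsFellerSemigroup κ)
    (h : fellerGenerator hκ = stickyGenerator ω L hL) :
    IsInvariantMeasure κ (stickyMeasure ω L hL) := by
  refine isInvariantMeasure_of_integral hκ.markov fun t f => ?_
  have h1 := sticky_integral_symm hω hκ h t f 1
  rw [fellerOperator_one hκ] at h1
  simp only [ContinuousMap.one_apply, mul_one] at h1
  exact h1

/-- An invariant probability measure annihilates the range of the generator, which consists of all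
functions of mean zero for `stickyMeasure`. -/
theorem sticky_invariant_unique (hω : 0 < ω) (hκ : IsFellerSemigroup κ)
    (h : fellerGenerator hκ = stickyGenerator ω L hL) (ν : Measure (Icc (0 : ℝ) L))
    [IsProbabilityMeasure ν] (hν : IsInvariantMeasure κ ν) : ν = stickyMeasure ω L hL := by
  have := isProbabilityMeasure_stickyMeasure hω hL
  refine measure_ext_of_continuousMap fun f => ?_
  set c := ∫ x, f x ∂stickyMeasure ω L hL with hc
  have h0 : ∫ x, (f - c • (1 : C(Icc (0 : ℝ) L, ℝ))) x ∂stickyMeasure ω L hL = 0 := by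
    simp only [ContinuousMap.sub_apply, ContinuousMap.smul_apply, ContinuousMap.one_apply,
      smul_eq_mul, mul_one]
    rw [integral_sub (ContinuousMap.integrable f _) (integrable_const _), ← hc]
    simp
  obtain ⟨u, hu⟩ := exists_stickyGenerator_eq hω h0
  have hp : IsGeneratorPair (fellerOperator hκ) u (f - c • (1 : C(Icc (0 : ℝ) L, ℝ))) := by
    rw [isGeneratorPair_of_stickyExtension hκ h, ← hu]
    exact exists_stickyExtension u
  have h1 := integral_eq_zero_of_isGeneratorPair hκ hν hp
  simp only [ContinuousMap.sub_apply, ContinuousMap.smul_apply, ContinuousMap.one_apply,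
      smul_eq_mul, mul_one] at h1
  rw [integral_sub (ContinuousMap.integrable f _) (integrable_const _)] at h1
  simpa [sub_eq_zero] using h1

theorem sticky_isReversible (hω : 0 < ω) (hκ : IsFellerSemigroup κ)
    (h : fellerGenerator hκ = stickyGenerator ω L hL) (t : ℝ≥0) :
    (κ t).IsReversible (stickyMeasure ω L hL) := by
  have hm := hκ.markov t
  have hμ := sticky_isInvariantMeasure hω hκ h
  have hd := dense_range_toLp (stickyMeasure ω L hL)
  have hc : Continuous (l2Operator (κ t) _ (hμ t)) :=
    (LipschitzWith.of_dist_le_mul (K := 1) fun x y => by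
      rw [dist_eq_norm, dist_eq_norm, NNReal.coe_one, one_mul, ← map_sub]
      exact norm_l2Operator_le _ _ _).continuous
  refine isReversible_of_l2Operator_symm (κ t) (hμ t) fun f g => ?_
  refine congrFun (Continuous.ext_on hd (hc.inner continuous_const)
    (continuous_id.inner continuous_const) ?_) f
  rintro _ ⟨f, rfl⟩
  refine congrFun (Continuous.ext_on hd (continuous_const.inner continuous_id)
    (continuous_const.inner hc) ?_) g
  rintro _ ⟨g, rfl⟩
  simp only [id]
  rw [l2Operator_toLp hκ, l2Operator_toLp hκ, ContinuousMap.inner_toLp, ContinuousMap.inner_toLp]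
  have h1 := sticky_integral_symm hω hκ h t f g
  simpa only [conj_trivial, mul_comm] using h1

theorem sticky_mem_graph_l2Generator (hκ : IsFellerSemigroup κ)
    (hμ : IsInvariantMeasure κ (stickyMeasure ω L hL)) (f : (fellerGenerator hκ).domain) :
    (stickyToL2 ω L hL f, stickyToL2 ω L hL (fellerGenerator hκ f)) ∈
      (l2Generator hκ.toIsMarkovSemigroup hμ).graph :=
  mem_graph_semigroupGenerator.2 <| isGeneratorPair_l2Operator hκ hμ <|
    mem_graph_semigroupGenerator.1 ((fellerGenerator hκ).mem_graph f)

theorem sticky_isClosed_l2Generator (hκ : IsFellerSemigroup κ)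
    (hμ : IsInvariantMeasure κ (stickyMeasure ω L hL)) :
    (l2Generator hκ.toIsMarkovSemigroup hμ).IsClosed :=
  (isContractionSemigroup_l2Operator hκ hμ).isClosed_generator

theorem sticky_hasCore (hω : 0 < ω) (hκ : IsFellerSemigroup κ)
    (h : fellerGenerator hκ = stickyGenerator ω L hL)
    (hμ : IsInvariantMeasure κ (stickyMeasure ω L hL)) :
    (l2Generator hκ.toIsMarkovSemigroup hμ).HasCore
      ((fellerGenerator hκ).domain.map (stickyToL2 ω L hL)) := by
  refine (isContractionSemigroup_l2Operator hκ hμ).hasCore_of_dense _ ?_ ?_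
  · rintro _ ⟨f, hf, rfl⟩
    exact LinearPMap.mem_domain_of_mem_graph (sticky_mem_graph_l2Generator hκ hμ ⟨f, hf⟩)
  · refine (dense_range_toLp (stickyMeasure ω L hL)).mono ?_
    rintro _ ⟨u, rfl⟩
    obtain ⟨f, hf⟩ := stickyGenerator_surjective (hL := hL) hω one_pos u
    have hp : IsGeneratorPair (fellerOperator hκ) f (stickyGenerator ω L hL f) :=
      (isGeneratorPair_of_stickyExtension hκ h).2 (exists_stickyExtension f)
    refine ⟨stickyToL2 ω L hL f, ⟨f, hp.mem_domain, rfl⟩, _, isGeneratorPair_l2Operator hκ hμ hp, ?_⟩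
    rw [← hf, one_smul, map_sub]
    rfl

end StickyL2

/-! ### The first jump of the run-and-tumble process -/

section FirstJump

instance isProbabilityMeasure_exp_one : IsProbabilityMeasure (expMeasure 1) :=
  isProbabilityMeasure_expMeasure one_pos

variable {ω L : ℝ}

instance isProbabilityMeasure_drivingMeasure (hω : 0 < ω) :
    IsProbabilityMeasure (drivingMeasure hω) := by unfold drivingMeasure; infer_instance

/-- The law of a single entry of the driving sequence. -/
def stepMeasure (hω : 0 < ω) : Measure (ℝ × (Velocity → Velocity)) :=
  (expMeasure 1).prod (Measure.pi fun v => (jumpLaw hω v).toMeasure)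

instance isProbabilityMeasure_stepMeasure (hω : 0 < ω) :
    IsProbabilityMeasure (stepMeasure hω) := by unfold stepMeasure; infer_instance

/-- The driving sequence with first entry `c`, followed by `o`. -/
def consDriving (c : ℝ × (Velocity → Velocity)) (o : Driving) : Driving
  | 0 => c
  | n + 1 => o n

theorem measurable_consDriving :
    Measurable fun p : (ℝ × (Velocity → Velocity)) × Driving => consDriving p.1 p.2 := by
  refine measurable_pi_iff.2 fun n => ?_
  cases n with
  | zero => exact measurable_fst
  | succ n => exact (measurable_pi_apply n).comp measurable_snd

/-- A driving sequence consists of its first entry and of an independent copy of itself. -/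
theorem map_consDriving (hω : 0 < ω) :
    ((stepMeasure hω).prod (drivingMeasure hω)).map (fun p => consDriving p.1 p.2) =
      drivingMeasure hω := by
  classical
  refine Measure.eq_infinitePi _ fun s t ht => ?_
  change _ = ∏ i ∈ s, stepMeasure hω (t i)
  rw [Measure.map_apply measurable_consDriving
    (MeasurableSet.pi s.countable_toSet fun i _ => ht i)]
  let s' : Finset ℕ := s.preimage Nat.succ Nat.succ_injective.injOn
  have hpre : (fun p : (ℝ × (Velocity → Velocity)) × Driving => consDriving p.1 p.2) ⁻¹'
      (Set.pi s t) = (if 0 ∈ s then t 0 else univ) ×ˢ Set.pi s' fun i => t (i + 1) := by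
    ext ⟨c, o⟩
    simp only [mem_preimage, Set.mem_pi, mem_prod, Finset.mem_coe, s', Finset.mem_preimage]
    constructor
    · intro h
      refine ⟨?_, fun i hi => h (i + 1) hi⟩
      split_ifs with h0
      · exact h 0 h0
      · trivial
    · rintro ⟨h0, h1⟩ i hi
      cases i with
      | zero => rw [if_pos hi] at h0; exact h0
      | succ i => exact h1 i hi
  have hpi : drivingMeasure hω (Set.pi s' fun i => t (i + 1)) =
      ∏ i ∈ s', stepMeasure hω (t (i + 1)) :=
    Measure.infinitePi_pi _ fun i _ => ht (i + 1)
  rw [hpre, Measure.prod_prod, hpi]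
  have hs : s.erase 0 = s'.map ⟨Nat.succ, Nat.succ_injective⟩ := by
    ext i
    cases i with
    | zero => simp
    | succ i => simp [s']
  by_cases h0 : 0 ∈ s
  · rw [if_pos h0, ← Finset.mul_prod_erase s _ h0, hs, Finset.prod_map]
    rfl
  · rw [if_neg h0, measure_univ, one_mul]
    conv_rhs => rw [← Finset.erase_eq_of_notMem h0, hs, Finset.prod_map]
    rfl

theorem velocityChain_cons (v : Velocity) (c : ℝ × (Velocity → Velocity)) (o : Driving) (n : ℕ) :
    velocityChain v (consDriving c o) (n + 1) = velocityChain (c.2 v) o n := by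
  induction n with
  | zero => rfl
  | succ n ih =>
    change (consDriving c o (n + 1)).2 (velocityChain v (consDriving c o) (n + 1)) = _
    rw [ih]; rfl

theorem holdingTime_cons (v : Velocity) (c : ℝ × (Velocity → Velocity)) (o : Driving) (n : ℕ) :
    holdingTime ω v (consDriving c o) (n + 1) = holdingTime ω (c.2 v) o n := by
  unfold holdingTime
  rw [velocityChain_cons]; rfl

theorem holdingTime_cons_zero (v : Velocity) (c : ℝ × (Velocity → Velocity)) (o : Driving) :
    holdingTime ω v (consDriving c o) 0 = c.1 / (2 * ω) := by
  unfold holdingTime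
  rw [exitRate_eq]; rfl

theorem jumpTime_cons (v : Velocity) (c : ℝ × (Velocity → Velocity)) (o : Driving) (n : ℕ) :
    jumpTime ω v (consDriving c o) (n + 1) = c.1 / (2 * ω) + jumpTime ω (c.2 v) o n := by
  unfold jumpTime
  rw [Finset.sum_range_succ', holdingTime_cons_zero, add_comm]
  simp only [holdingTime_cons]

theorem positionChain_cons (hL : 0 < L) (z : Icc (0 : ℝ) L × Velocity)
    (c : ℝ × (Velocity → Velocity)) (o : Driving) (n : ℕ) :
    positionChain ω hL z (consDriving c o) (n + 1) =
      positionChain ω hL (moveClamped hL z.1 z.2 (c.1 / (2 * ω)), c.2 z.2) o n := by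
  induction n with
  | zero =>
    change moveClamped hL z.1 z.2 (holdingTime ω z.2 (consDriving c o) 0) = _
    rw [holdingTime_cons_zero]; rfl
  | succ n ih =>
    change moveClamped hL (positionChain ω hL z (consDriving c o) (n + 1))
      (velocityChain z.2 (consDriving c o) (n + 1)) (holdingTime ω z.2 (consDriving c o) (n + 1)) = _
    rw [ih, velocityChain_cons, holdingTime_cons]; rfl

theorem jumpCount_cons_of_lt (v : Velocity) (c : ℝ × (Velocity → Velocity)) (o : Driving) {t : ℝ≥0}
    (h : (t : ℝ) < c.1 / (2 * ω)) : jumpCount ω t v (consDriving c o) = 0 := by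
  refine Nat.sInf_eq_zero.2 (Or.inl ?_)
  change (t : ℝ) < jumpTime ω v (consDriving c o) (0 + 1)
  rw [jumpTime_cons]
  simpa [jumpTime] using h

theorem jumpCount_cons_of_le (v : Velocity) (c : ℝ × (Velocity → Velocity)) (o : Driving)
    {t s : ℝ≥0} (h : (t : ℝ) = c.1 / (2 * ω) + s)
    (hex : ∃ n, (s : ℝ) < jumpTime ω (c.2 v) o (n + 1)) :
    jumpCount ω t v (consDriving c o) = jumpCount ω s (c.2 v) o + 1 := by
  have key : ∀ n, (t : ℝ) < jumpTime ω v (consDriving c o) (n + 1 + 1) ↔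
      (s : ℝ) < jumpTime ω (c.2 v) o (n + 1) := fun n => by
    rw [jumpTime_cons, h, add_lt_add_iff_left]
  have h0 : ¬ (t : ℝ) < jumpTime ω v (consDriving c o) (0 + 1) := by
    rw [jumpTime_cons, h, add_lt_add_iff_left]
    simp [jumpTime]
  unfold jumpCount
  have hne : {n | (s : ℝ) < jumpTime ω (c.2 v) o (n + 1)}.Nonempty := hex
  have hmem := Nat.sInf_mem hne
  refine le_antisymm (Nat.sInf_le ((key _).2 hmem)) ?_
  have hne' : {n | (t : ℝ) < jumpTime ω v (consDriving c o) (n + 1)}.Nonempty :=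
    ⟨_, (key _).2 hmem⟩
  have hmem' := Nat.sInf_mem hne'
  rcases hk : sInf {n | (t : ℝ) < jumpTime ω v (consDriving c o) (n + 1)} with _ | m
  · rw [hk] at hmem'
    exact absurd hmem' h0
  · rw [hk] at hmem'
    exact Nat.succ_le_succ (Nat.sInf_le ((key _).1 hmem'))

/-- Before the first jump, the position moves with the initial velocity. -/
theorem rtpProcess_cons_of_lt (hL : 0 < L) (z : Icc (0 : ℝ) L × Velocity)
    (c : ℝ × (Velocity → Velocity)) (o : Driving) {t : ℝ≥0} (h : (t : ℝ) < c.1 / (2 * ω)) :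
    rtpProcess ω hL t z (consDriving c o) = (moveClamped hL z.1 z.2 t, z.2) := by
  unfold rtpProcess
  rw [jumpCount_cons_of_lt _ _ _ h]
  simp [positionChain, velocityChain, jumpTime]

/-- After the first jump, the process starts afresh. -/
theorem rtpProcess_cons_of_le (hL : 0 < L) (z : Icc (0 : ℝ) L × Velocity)
    (c : ℝ × (Velocity → Velocity)) (o : Driving) {t s : ℝ≥0} (h : (t : ℝ) = c.1 / (2 * ω) + s)
    (hex : ∃ n, (s : ℝ) < jumpTime ω (c.2 z.2) o (n + 1)) :
    rtpProcess ω hL t z (consDriving c o) =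
      rtpProcess ω hL s (moveClamped hL z.1 z.2 (c.1 / (2 * ω)), c.2 z.2) o := by
  unfold rtpProcess
  rw [jumpCount_cons_of_le _ _ _ h hex]
  simp only [positionChain_cons, velocityChain_cons, jumpTime_cons]
  congr 2
  rw [h]; ring

theorem expMeasure_Iic_lt_one (N : ℝ) : expMeasure 1 (Iic N) < 1 := by
  rw [← ofReal_cdf, cdf_expMeasure_eq one_pos, ENNReal.ofReal_lt_one]
  split_ifs
  · linarith [Real.exp_pos (-(1 * N))]
  · exact one_pos

theorem expMeasure_Iio_zero : expMeasure 1 (Iio 0) = 0 := by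
  refine measure_mono_null Iio_subset_Iic_self ?_
  rw [← ofReal_cdf, cdf_expMeasure_eq one_pos]
  simp

/-- Almost surely, only finitely many jumps occur in finite time, since there are arbitrarily long
holding times. -/
theorem ae_exists_lt_jumpTime (hω : 0 < ω) :
    ∀ᵐ o ∂drivingMeasure hω, ∀ (t : ℝ≥0) (v : Velocity), ∃ n, (t : ℝ) < jumpTime ω v o (n + 1) := by
  have hpos : ∀ᵐ o ∂drivingMeasure hω, ∀ n, 0 ≤ (o n).1 := by
    refine ae_all_iff.2 fun n => ?_
    have h1 : ∀ᵐ c ∂stepMeasure hω, 0 ≤ c.1 := by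
      have h2 : ∀ᵐ x ∂expMeasure 1, (0 : ℝ) ≤ x := by
        rw [ae_iff]
        simp only [not_le]
        exact expMeasure_Iio_zero
      exact Measure.quasiMeasurePreserving_fst.ae h2
    exact (measurePreserving_eval_infinitePi (fun _ : ℕ => stepMeasure hω)
      n).quasiMeasurePreserving.ae h1
  have hbig : ∀ᵐ o ∂drivingMeasure hω, ∀ N : ℕ, ∃ n, (N : ℝ) < (o n).1 := by
    refine ae_all_iff.2 fun N => ?_
    rw [ae_iff]
    have h1 : stepMeasure hω (Iic (N : ℝ) ×ˢ univ) < 1 := by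
      rw [stepMeasure, Measure.prod_prod, measure_univ, mul_one]
      exact expMeasure_Iic_lt_one N
    refine le_antisymm (ge_of_tendsto (ENNReal.tendsto_pow_atTop_nhds_zero_of_lt_one h1)
      (Eventually.of_forall fun m => ?_)) bot_le
    have h2 : drivingMeasure hω (Set.pi (Finset.range m) fun _ => Iic (N : ℝ) ×ˢ univ) =
        ∏ i ∈ Finset.range m, stepMeasure hω (Iic (N : ℝ) ×ˢ univ) :=
      Measure.infinitePi_pi _ fun i _ => measurableSet_Iic.prod MeasurableSet.univ
    rw [Finset.prod_const, Finset.card_range] at h2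
    rw [← h2]
    refine measure_mono fun o ho i _ => ?_
    simp only [mem_ofPred_eq, not_exists, not_lt] at ho
    exact ⟨ho i, trivial⟩
  filter_upwards [hpos, hbig] with o h0 hN t v
  obtain ⟨N, hNt⟩ := exists_nat_gt ((t : ℝ) * (2 * ω))
  obtain ⟨n, hn⟩ := hN N
  have hq : 0 < 2 * ω := by positivity
  refine ⟨n, ?_⟩
  have h1 : ∀ k, 0 ≤ holdingTime ω v o k := fun k => by
    unfold holdingTime
    rw [exitRate_eq]
    exact div_nonneg (h0 k) hq.le
  unfold jumpTime
  refine lt_of_lt_of_le ?_ (Finset.single_le_sum (fun k _ => h1 k) (Finset.self_mem_range_succ n))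
  unfold holdingTime
  rw [exitRate_eq, lt_div_iff₀ hq]
  linarith

/-! ### Measurability in time and space -/

theorem measurable_jumpCount_uncurry (ω : ℝ) :
    Measurable fun p : ℝ≥0 × Velocity × Driving => jumpCount ω p.1 p.2.1 p.2.2 := by
  let S : ℕ → Set (ℝ≥0 × Velocity × Driving) := fun n =>
    {p | (p.1 : ℝ) < jumpTime ω p.2.1 p.2.2 (n + 1)}
  have hm : ∀ n, MeasurableSet (S n) := fun n =>
    measurableSet_lt (measurable_coe_nnreal_real.comp measurable_fst)
      ((measurable_jumpTime ω (n + 1)).comp measurable_snd)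
  refine measurable_to_countable' fun m => ?_
  -- the intersection over all `n` accounts for `sInf ∅ = 0`
  have he : (fun p : ℝ≥0 × Velocity × Driving => jumpCount ω p.1 p.2.1 p.2.2) ⁻¹' {m} =
      (S m ∪ ({_p | m = 0} ∩ ⋂ n, (S n)ᶜ)) ∩ ⋂ n, ⋂ (_ : n < m), (S n)ᶜ := by
    ext p
    have hS : ∀ n, p ∈ S n ↔ n ∈ {n | (p.1 : ℝ) < jumpTime ω p.2.1 p.2.2 (n + 1)} :=
      fun n => Iff.rfl
    simp only [mem_preimage, mem_singleton_iff, mem_inter_iff, mem_union, mem_iInter, mem_compl_iff,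
      hS, jumpCount]
    set N := {n | (p.1 : ℝ) < jumpTime ω p.2.1 p.2.2 (n + 1)}
    constructor
    · rintro rfl
      refine ⟨?_, fun n hn => Nat.notMem_of_lt_sInf hn⟩
      by_cases h : N.Nonempty
      · exact Or.inl (Nat.sInf_mem h)
      · rw [not_nonempty_iff_eq_empty] at h
        exact Or.inr ⟨by rw [h]; exact Nat.sInf_empty, eq_empty_iff_forall_notMem.1 h⟩
    · rintro ⟨h1 | ⟨h0, h1⟩, h2⟩
      · exact le_antisymm (Nat.sInf_le h1) (not_lt.1 fun h3 => h2 _ h3 (Nat.sInf_mem ⟨m, h1⟩))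
      · rw [show m = 0 from h0]
        exact Nat.sInf_eq_zero.2 (Or.inr (eq_empty_iff_forall_notMem.2 h1))
  rw [he]
  exact ((hm m).union ((MeasurableSet.const _).inter (MeasurableSet.iInter fun n =>
    (hm n).compl))).inter (MeasurableSet.iInter fun n => MeasurableSet.iInter fun _ => (hm n).compl)

theorem measurable_rtpProcess_uncurry (ω : ℝ) {L : ℝ} (hL : 0 < L) :
    Measurable fun p : (ℝ≥0 × Icc (0 : ℝ) L × Velocity) × Driving =>
      rtpProcess ω hL p.1.1 p.1.2 p.2 := by
  have hp : Measurable fun p : (ℝ≥0 × Icc (0 : ℝ) L × Velocity) × Driving => (p.1.2.2, p.2) :=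
    (measurable_snd.comp (measurable_snd.comp measurable_fst)).prodMk measurable_snd
  have hz : Measurable fun p : (ℝ≥0 × Icc (0 : ℝ) L × Velocity) × Driving => (p.1.2, p.2) :=
    (measurable_snd.comp measurable_fst).prodMk measurable_snd
  have ht : Measurable fun p : (ℝ≥0 × Icc (0 : ℝ) L × Velocity) × Driving => p.1.1 :=
    measurable_fst.comp measurable_fst
  have hn : Measurable fun p : (ℝ≥0 × Icc (0 : ℝ) L × Velocity) × Driving =>
      jumpCount ω p.1.1 p.1.2.2 p.2 := (measurable_jumpCount_uncurry ω).comp (ht.prodMk hp)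
  have key : Measurable fun q : ((ℝ≥0 × Icc (0 : ℝ) L × Velocity) × Driving) × ℕ =>
      (moveClamped hL (positionChain ω hL q.1.1.2 q.1.2 q.2) (velocityChain q.1.1.2.2 q.1.2 q.2)
        (q.1.1.1 - jumpTime ω q.1.1.2.2 q.1.2 q.2), velocityChain q.1.1.2.2 q.1.2 q.2) := by
    refine measurable_from_prod_countable_left fun n => ?_
    have hv := (measurable_velocityChain n).comp hp
    exact ((measurable_moveClamped hL).comp (((measurable_positionChain ω hL n).comp hz).prodMk
      (hv.prodMk ((measurable_coe_nnreal_real.comp ht).sub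
        ((measurable_jumpTime ω n).comp hp))))).prodMk hv
  exact key.comp (measurable_id.prodMk hn)

end FirstJump

/-! ### The renewal equation -/

section Renewal

variable {ω L : ℝ}

/-- The velocity `-2`. -/
abbrev velNeg : Velocity := ⟨-2, by decide⟩

/-- The velocity `0`. -/
abbrev velZero : Velocity := ⟨0, by decide⟩

/-- The velocity `2`. -/
abbrev velPos : Velocity := ⟨2, by decide⟩

theorem sum_velocity {M : Type*} [AddCommMonoid M] (f : Velocity → M) :
    ∑ v, f v = f velNeg + (f velZero + f velPos) := by
  have h1 : (Finset.univ : Finset Velocity) = {velNeg, velZero, velPos} := by decide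
  rw [h1, Finset.sum_insert (by decide), Finset.sum_insert (by decide), Finset.sum_singleton]

theorem velocity_cases (v : Velocity) : v = velNeg ∨ v = velZero ∨ v = velPos := by
  revert v; decide

/-- The mean of `w` over the velocity after a jump out of `v`. -/
def jumpAverage (hω : 0 < ω) (w : Velocity → ℝ) (v : Velocity) : ℝ :=
  ∑ u, (jumpLaw hω v u).toReal * w u

theorem jumpLaw_toReal (hω : 0 < ω) (v u : Velocity) :
    (jumpLaw hω v u).toReal = if u = v then 0 else tumbleRate ω v u / (2 * ω) := by
  unfold jumpLaw
  rw [PMF.ofFintype_apply]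
  split_ifs with h
  · simp
  · rw [ENNReal.toReal_ofReal, exitRate_eq]
    rw [exitRate_eq]
    exact div_nonneg (tumbleRate_nonneg hω (Ne.symm h)) (by positivity)

theorem jumpAverage_velNeg (hω : 0 < ω) (w : Velocity → ℝ) :
    jumpAverage hω w velNeg = w velZero := by
  have := hω.ne'
  rw [jumpAverage, sum_velocity]
  simp only [jumpLaw_toReal, tumbleRate]
  simp [this]

theorem jumpAverage_velZero (hω : 0 < ω) (w : Velocity → ℝ) :
    jumpAverage hω w velZero = (w velNeg + w velPos) / 2 := by
  have := hω.ne'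
  rw [jumpAverage, sum_velocity]
  simp only [jumpLaw_toReal, tumbleRate]
  simp
  field_simp

theorem jumpAverage_velPos (hω : 0 < ω) (w : Velocity → ℝ) :
    jumpAverage hω w velPos = w velZero := by
  have := hω.ne'
  rw [jumpAverage, sum_velocity]
  simp only [jumpLaw_toReal, tumbleRate]
  simp [this]

theorem jumpAverage_sub (hω : 0 < ω) (w w' : Velocity → ℝ) (v : Velocity) :
    jumpAverage hω w v - jumpAverage hω w' v = jumpAverage hω (fun u => w u - w' u) v := by
  simp only [jumpAverage, ← Finset.sum_sub_distrib, mul_sub]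

theorem jumpAverage_const (hω : 0 < ω) (c : ℝ) (v : Velocity) :
    jumpAverage hω (fun _ => c) v = c := by
  rcases velocity_cases v with rfl | rfl | rfl
  · rw [jumpAverage_velNeg]
  · rw [jumpAverage_velZero]; ring
  · rw [jumpAverage_velPos]

theorem abs_jumpAverage_le (hω : 0 < ω) {w : Velocity → ℝ} {C : ℝ} (h : ∀ u, |w u| ≤ C)
    (v : Velocity) : |jumpAverage hω w v| ≤ C := by
  rcases velocity_cases v with rfl | rfl | rfl
  · rw [jumpAverage_velNeg]; exact h _
  · rw [jumpAverage_velZero, abs_div, abs_two, div_le_iff₀ two_pos]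
    have := abs_add_le (w velNeg) (w velPos)
    linarith [h velNeg, h velPos]
  · rw [jumpAverage_velPos]; exact h _

theorem measurable_jumpAverage (hω : 0 < ω) {α : Type*} [MeasurableSpace α]
    {w : α → Velocity → ℝ} (h : ∀ u, Measurable fun a => w a u) (v : Velocity) :
    Measurable fun a => jumpAverage hω (w a) v :=
  Finset.measurable_sum _ fun u _ => (h u).const_mul _

theorem integral_jump (hω : 0 < ω) (w : Velocity → ℝ) (v : Velocity) :
    ∫ j : Velocity → Velocity, w (j v) ∂(Measure.pi fun v => (jumpLaw hω v).toMeasure) =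
      jumpAverage hω w v := by
  have h := (measurePreserving_eval (fun v => (jumpLaw hω v).toMeasure) v)
  have hw : Measurable w := measurable_of_countable _
  have h1 := integral_map (μ := Measure.pi fun v => (jumpLaw hω v).toMeasure)
    h.measurable.aemeasurable (f := w) hw.aestronglyMeasurable
  rw [h.map_eq, PMF.integral_eq_sum] at h1
  exact h1.symm

theorem integral_expMeasure (G : ℝ → ℝ) :
    ∫ x, G x ∂expMeasure 1 = ∫ x in Ioi 0, Real.exp (-x) * G x := by
  have h1 : expMeasure 1 = volume.withDensity (exponentialPDF 1) := rfl
  have hm : Measurable (exponentialPDF 1) := (measurable_exponentialPDFReal 1).ennreal_ofReal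
  rw [h1, integral_withDensity_eq_integral_toReal_smul hm
    (Eventually.of_forall fun x => ENNReal.ofReal_lt_top), ← integral_indicator measurableSet_Ioi]
  refine integral_congr_ae ?_
  filter_upwards [Measure.ae_ne volume (0 : ℝ)] with x hx
  by_cases h : 0 < x
  · rw [indicator_of_mem (mem_Ioi.2 h), exponentialPDF_of_nonneg h.le,
      ENNReal.toReal_ofReal (by positivity)]
    simp
  · rw [indicator_of_notMem (by simpa using h),
      exponentialPDF_of_neg (lt_of_le_of_ne (not_lt.1 h) hx)]
    simp

theorem integrableOn_exp_neg_mul {G : ℝ → ℝ} (hG : Measurable G) {C : ℝ} (hC : ∀ x, |G x| ≤ C) :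
    IntegrableOn (fun x => Real.exp (-x) * G x) (Ioi 0) := by
  have h1 : IntegrableOn (fun x : ℝ => Real.exp (-x)) (Ioi 0) := by
    simpa using integrableOn_exp_mul_Ioi (a := -1) (by norm_num) 0
  exact h1.mul_bdd (c := C) hG.aestronglyMeasurable (Eventually.of_forall hC)

/-- Splitting an expectation over an exponential time `τ / q` at the time `t`. -/
theorem integral_expMeasure_ite {q t : ℝ} (hq : 0 < q) (ht : 0 ≤ t) (a : ℝ) {v : ℝ → ℝ}
    (hv : Measurable v) {C : ℝ} (hC : ∀ x, |v x| ≤ C) :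
    ∫ x, (if t < x / q then a else v (x / q)) ∂expMeasure 1 =
      Real.exp (-(q * t)) * a + ∫ r in (0 : ℝ)..t, q * Real.exp (-(q * r)) * v r := by
  have hqt : 0 ≤ q * t := by positivity
  have hG : Measurable fun x : ℝ => if t < x / q then a else v (x / q) :=
    Measurable.ite (measurableSet_lt measurable_const (measurable_id.div_const q)) measurable_const
      (hv.comp (measurable_id.div_const q))
  have hGC : ∀ x : ℝ, |if t < x / q then a else v (x / q)| ≤ max |a| C := fun x => by
    split_ifs
    · exact le_max_left _ _
    · exact (hC _).trans (le_max_right _ _)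
  have hint := integrableOn_exp_neg_mul hG hGC
  rw [integral_expMeasure, ← Ioc_union_Ioi_eq_Ioi hqt, setIntegral_union Ioc_disjoint_Ioi_same
    measurableSet_Ioi (hint.mono_set Ioc_subset_Ioi_self) (hint.mono_set (Ioi_subset_Ioi hqt)),
    add_comm]
  congr 1
  · have h1 : ∫ x in Ioi (q * t), Real.exp (-x) * (if t < x / q then a else v (x / q)) =
        ∫ x in Ioi (q * t), Real.exp (-x) * a := by
      refine setIntegral_congr_fun measurableSet_Ioi fun x hx => ?_
      have : t < x / q := by rw [lt_div_iff₀ hq, mul_comm]; exact hx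
      simp only [this, if_true]
    rw [h1, integral_mul_const, integral_exp_neg_Ioi]
  · have h1 := intervalIntegral.mul_integral_comp_mul_left (a := 0) (b := t)
      (f := fun x => Real.exp (-x) * v (x / q)) q
    rw [mul_zero, intervalIntegral.integral_of_le (b := q * t) hqt,
      ← intervalIntegral.integral_const_mul] at h1
    have h2 : ∫ x in Ioc 0 (q * t), Real.exp (-x) * (if t < x / q then a else v (x / q)) =
        ∫ x in Ioc 0 (q * t), Real.exp (-x) * v (x / q) := by
      refine setIntegral_congr_fun measurableSet_Ioc fun x hx => ?_
      have : ¬ t < x / q := by rw [not_lt, div_le_iff₀ hq, mul_comm]; exact hx.2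
      simp only [this, if_false]
    rw [h2, ← h1]
    refine intervalIntegral.integral_congr fun r _ => ?_
    simp only [mul_div_cancel_left₀ _ hq.ne']
    ring

/-- The expectation of `h` at time `t`, as a function of the real number `t` and the initial
value. -/
def rtpMean (hω : 0 < ω) (hL : 0 < L) (h : Icc (0 : ℝ) L × Velocity → ℝ) (t : ℝ)
    (z : Icc (0 : ℝ) L × Velocity) : ℝ :=
  ∫ o, h (rtpProcess ω hL t.toNNReal z o) ∂drivingMeasure hω

theorem integral_rtpKernel (hω : 0 < ω) (hL : 0 < L) {h : Icc (0 : ℝ) L × Velocity → ℝ}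
    (hh : Measurable h) (t : ℝ≥0) (z : Icc (0 : ℝ) L × Velocity) :
    ∫ y, h y ∂rtpKernel hω hL t z = rtpMean hω hL h t z := by
  rw [rtpMean, Real.toNNReal_coe]
  exact integral_map ((measurable_rtpProcess ω hL t).comp measurable_prodMk_left).aemeasurable
    hh.aestronglyMeasurable

theorem measurable_rtpMean (hω : 0 < ω) (hL : 0 < L) {h : Icc (0 : ℝ) L × Velocity → ℝ}
    (hh : Measurable h) :
    Measurable fun p : ℝ × Icc (0 : ℝ) L × Velocity => rtpMean hω hL h p.1 p.2 := by
  have h1 : Measurable fun p : (ℝ × Icc (0 : ℝ) L × Velocity) × Driving =>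
      h (rtpProcess ω hL p.1.1.toNNReal p.1.2 p.2) :=
    hh.comp ((measurable_rtpProcess_uncurry ω hL).comp
      (((measurable_real_toNNReal.comp (measurable_fst.comp measurable_fst)).prodMk
        (measurable_snd.comp measurable_fst)).prodMk measurable_snd))
  exact h1.stronglyMeasurable.integral_prod_right'.measurable

theorem abs_rtpMean_le (hω : 0 < ω) (hL : 0 < L) {h : Icc (0 : ℝ) L × Velocity → ℝ} {C : ℝ}
    (hC : ∀ z, |h z| ≤ C) (t : ℝ) (z : Icc (0 : ℝ) L × Velocity) : |rtpMean hω hL h t z| ≤ C := by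
  have := norm_integral_le_of_norm_le_const (μ := drivingMeasure hω)
    (f := fun o => h (rtpProcess ω hL t.toNNReal z o)) (C := C) (Eventually.of_forall fun o => hC _)
  simpa [rtpMean] using this

/-- The expectation over the first jump: its time and the velocity after it. -/
theorem integral_stepMeasure_ite (hω : 0 < ω) {t : ℝ} (ht : 0 ≤ t) {a C : ℝ} (ha : |a| ≤ C)
    {W : ℝ → Velocity → ℝ} (hW : ∀ u, Measurable fun r => W r u) (hC : ∀ r u, |W r u| ≤ C)
    (v : Velocity) :
    ∫ c, (if t < c.1 / (2 * ω) then a else W (c.1 / (2 * ω)) (c.2 v)) ∂stepMeasure hω =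
      Real.exp (-(2 * ω * t)) * a +
        ∫ r in (0 : ℝ)..t, 2 * ω * Real.exp (-(2 * ω * r)) * jumpAverage hω (W r) v := by
  have hq : 0 < 2 * ω := by positivity
  have hcm : Measurable fun c : ℝ × (Velocity → Velocity) => c.1 / (2 * ω) :=
    measurable_fst.div_const _
  have hWm : Measurable fun p : ℝ × Velocity => W p.1 p.2 :=
    measurable_from_prod_countable_left hW
  have hWc : Measurable fun c : ℝ × (Velocity → Velocity) => W (c.1 / (2 * ω)) (c.2 v) :=
    hWm.comp (hcm.prodMk ((measurable_pi_apply v).comp measurable_snd))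
  have hint : Integrable (fun c : ℝ × (Velocity → Velocity) => if t < c.1 / (2 * ω) then a else
      W (c.1 / (2 * ω)) (c.2 v)) (stepMeasure hω) := by
    refine Integrable.of_bound (Measurable.ite (measurableSet_lt measurable_const hcm)
      measurable_const hWc).aestronglyMeasurable C (Eventually.of_forall fun c => ?_)
    rw [Real.norm_eq_abs]
    split_ifs
    · exact ha
    · exact hC _ _
  rw [stepMeasure, integral_prod _ hint, ← integral_expMeasure_ite hq ht _
    (measurable_jumpAverage hω hW v) (fun r => abs_jumpAverage_le hω (hC r) v)]
  refine integral_congr_ae (Eventually.of_forall fun x => ?_)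
  simp only
  split_ifs
  · simp
  · exact integral_jump hω (W (x / (2 * ω))) v

/-- Conditioning on the first jump time and the velocity after the first jump. -/
theorem rtpMean_eq (hω : 0 < ω) (hL : 0 < L) {h : Icc (0 : ℝ) L × Velocity → ℝ}
    (hh : Measurable h) {C : ℝ} (hC : ∀ z, |h z| ≤ C) {t : ℝ} (ht : 0 ≤ t)
    (z : Icc (0 : ℝ) L × Velocity) :
    rtpMean hω hL h t z = Real.exp (-(2 * ω * t)) * h (moveClamped hL z.1 z.2 t, z.2) +
      ∫ r in (0 : ℝ)..t, 2 * ω * Real.exp (-(2 * ω * r)) *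
        jumpAverage hω (fun w => rtpMean hω hL h (t - r) (moveClamped hL z.1 z.2 r, w)) z.2 := by
  have hq : 0 < 2 * ω := by positivity
  have hprocm : Measurable fun o : Driving => h (rtpProcess ω hL t.toNNReal z o) :=
    hh.comp ((measurable_rtpProcess ω hL t.toNNReal).comp measurable_prodMk_left)
  have hstep : ∀ c : ℝ × (Velocity → Velocity),
      ∫ o, h (rtpProcess ω hL t.toNNReal z (consDriving c o)) ∂drivingMeasure hω =
        if t < c.1 / (2 * ω) then h (moveClamped hL z.1 z.2 t, z.2) else
          rtpMean hω hL h (t - c.1 / (2 * ω)) (moveClamped hL z.1 z.2 (c.1 / (2 * ω)), c.2 z.2) :=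
    fun c => by
      split_ifs with hc
      · have : ∀ o, rtpProcess ω hL t.toNNReal z (consDriving c o) =
            (moveClamped hL z.1 z.2 t, z.2) := fun o => by
          rw [rtpProcess_cons_of_lt hL z c o (by rwa [Real.coe_toNNReal _ ht]),
            Real.coe_toNNReal _ ht]
        simp only [this, integral_const, probReal_univ, one_smul]
      · refine integral_congr_ae ?_
        filter_upwards [ae_exists_lt_jumpTime hω] with o ho
        rw [rtpProcess_cons_of_le hL z c o (s := (t - c.1 / (2 * ω)).toNNReal) ?_ (ho _ _)]
        rw [Real.coe_toNNReal _ ht, Real.coe_toNNReal _ (sub_nonneg.2 (not_lt.1 hc))]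
        ring
  have hb : ∀ (μ : Measure ((ℝ × (Velocity → Velocity)) × Driving)) [IsFiniteMeasure μ],
      Integrable (fun p : (ℝ × (Velocity → Velocity)) × Driving =>
        h (rtpProcess ω hL t.toNNReal z (consDriving p.1 p.2))) μ := fun μ _ =>
    Integrable.of_bound (hprocm.comp measurable_consDriving).aestronglyMeasurable C
      (Eventually.of_forall fun p => hC _)
  have h1 : rtpMean hω hL h t z = ∫ c, (if t < c.1 / (2 * ω) then
      h (moveClamped hL z.1 z.2 t, z.2) else
        rtpMean hω hL h (t - c.1 / (2 * ω)) (moveClamped hL z.1 z.2 (c.1 / (2 * ω)), c.2 z.2))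
        ∂stepMeasure hω := by
    unfold rtpMean
    nth_rewrite 1 [← map_consDriving hω]
    rw [integral_map measurable_consDriving.aemeasurable hprocm.aestronglyMeasurable,
      integral_prod _ (hb _)]
    exact integral_congr_ae (Eventually.of_forall hstep)
  have hmove : Measurable fun r : ℝ => moveClamped hL z.1 z.2 r :=
    (measurable_moveClamped hL).comp
      (measurable_const.prodMk (measurable_const.prodMk measurable_id))
  have hm : ∀ w, Measurable fun r : ℝ => rtpMean hω hL h (t - r) (moveClamped hL z.1 z.2 r, w) :=
    fun w => (measurable_rtpMean hω hL hh).comp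
      ((measurable_id.const_sub t).prodMk (hmove.prodMk measurable_const))
  rw [h1]
  exact integral_stepMeasure_ite hω ht (hC _) hm (fun r u => abs_rtpMean_le hω hL hC _ _) z.2

theorem intervalIntegrable_renewal (hω : 0 < ω) (hL : 0 < L) {h : Icc (0 : ℝ) L × Velocity → ℝ}
    (hh : Measurable h) {C : ℝ} (hC : ∀ z, |h z| ≤ C) (t a b : ℝ) (z : Icc (0 : ℝ) L × Velocity) :
    IntervalIntegrable (fun r => 2 * ω * Real.exp (-(2 * ω * r)) *
      jumpAverage hω (fun w => rtpMean hω hL h (t - r) (moveClamped hL z.1 z.2 r, w)) z.2)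
      volume a b := by
  have hmove : Measurable fun r : ℝ => moveClamped hL z.1 z.2 r :=
    (measurable_moveClamped hL).comp
      (measurable_const.prodMk (measurable_const.prodMk measurable_id))
  have hm : ∀ w, Measurable fun r : ℝ => rtpMean hω hL h (t - r) (moveClamped hL z.1 z.2 r, w) :=
    fun w => (measurable_rtpMean hω hL hh).comp
      ((measurable_id.const_sub t).prodMk (hmove.prodMk measurable_const))
  have h1 : IntervalIntegrable (fun r : ℝ => 2 * ω * Real.exp (-(2 * ω * r))) volume a b :=
    (by fun_prop : Continuous fun r : ℝ => 2 * ω * Real.exp (-(2 * ω * r))).intervalIntegrable _ _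
  have hb : ∀ r, ‖jumpAverage hω (fun w =>
      rtpMean hω hL h (t - r) (moveClamped hL z.1 z.2 r, w)) z.2‖ ≤ C :=
    fun r => abs_jumpAverage_le hω (fun w => abs_rtpMean_le hω hL hC _ _) z.2
  have hms := (measurable_jumpAverage hω hm z.2).aestronglyMeasurable (μ := volume)
  exact ⟨h1.1.mul_bdd (c := C) hms.restrict (Eventually.of_forall hb),
    h1.2.mul_bdd (c := C) hms.restrict (Eventually.of_forall hb)⟩

theorem integral_rate_exp (q t : ℝ) :
    ∫ r in (0 : ℝ)..t, q * Real.exp (-(q * r)) = 1 - Real.exp (-(q * t)) := by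
  have h : ∀ r ∈ uIcc 0 t, HasDerivAt (fun r => -Real.exp (-(q * r))) (q * Real.exp (-(q * r))) r :=
    fun r _ => by
      have h1 : HasDerivAt (fun r : ℝ => -(q * r)) (-q) r := by
        exact ((hasDerivAt_id r).const_mul q).neg.congr_deriv (by simp)
      have h2 := h1.exp.neg
      refine h2.congr_deriv ?_
      ring
  rw [intervalIntegral.integral_eq_sub_of_hasDerivAt h
    ((by fun_prop : Continuous fun r : ℝ => q * Real.exp (-(q * r))).intervalIntegrable _ _)]
  simp
  ring

/-- Uniqueness for the renewal equation: its right-hand side is a contraction in the supremum norm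
over `[0, t]`, with factor `1 - exp (-2ωt)`. -/
theorem renewal_unique (hω : 0 < ω) (hL : 0 < L) {D : ℝ → Icc (0 : ℝ) L × Velocity → ℝ} {C : ℝ}
    (hC : ∀ t z, |D t z| ≤ C)
    (hD : ∀ t z, 0 ≤ t → D t z = ∫ r in (0 : ℝ)..t, 2 * ω * Real.exp (-(2 * ω * r)) *
        jumpAverage hω (fun w => D (t - r) (moveClamped hL z.1 z.2 r, w)) z.2)
    {t : ℝ} (ht : 0 ≤ t) (z : Icc (0 : ℝ) L × Velocity) : D t z = 0 := by
  set θ := 1 - Real.exp (-(2 * ω * t)) with hθ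
  have hq : 0 < 2 * ω := by positivity
  have hθ0 : 0 ≤ θ := by
    have : Real.exp (-(2 * ω * t)) ≤ 1 := Real.exp_le_one_iff.2 (by nlinarith)
    linarith
  have hθ1 : θ < 1 := by linarith [Real.exp_pos (-(2 * ω * t))]
  have key : ∀ n : ℕ, ∀ s z, 0 ≤ s → s ≤ t → |D s z| ≤ C * θ ^ n := fun n => by
    induction n with
    | zero => intro s z _ _; simpa using hC s z
    | succ n ih =>
      intro s z hs hst
      have hK : 0 ≤ C * θ ^ n := (abs_nonneg _).trans (ih s z hs hst)
      rw [hD s z hs]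
      have hg : IntervalIntegrable (fun r : ℝ => 2 * ω * Real.exp (-(2 * ω * r)) * (C * θ ^ n))
          volume 0 s :=
        (by fun_prop : Continuous fun r : ℝ =>
          2 * ω * Real.exp (-(2 * ω * r)) * (C * θ ^ n)).intervalIntegrable _ _
      rw [← Real.norm_eq_abs]
      refine (intervalIntegral.norm_integral_le_of_norm_le hs (Eventually.of_forall fun r hr => ?_)
        hg).trans ?_
      · rw [norm_mul, Real.norm_of_nonneg (by positivity)]
        refine mul_le_mul_of_nonneg_left ?_ (by positivity)
        exact abs_jumpAverage_le hω (fun w => ih _ _ (by linarith [hr.2]) (by linarith [hr.1])) z.2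
      · rw [intervalIntegral.integral_mul_const, integral_rate_exp, pow_succ, mul_comm, ← mul_assoc]
        refine mul_le_mul_of_nonneg_left ?_ hK
        rw [hθ]
        have : Real.exp (-(2 * ω * t)) ≤ Real.exp (-(2 * ω * s)) :=
          Real.exp_le_exp.2 (by nlinarith)
        linarith
  have hlim : Tendsto (fun n : ℕ => C * θ ^ n) atTop (𝓝 0) := by
    simpa using (tendsto_pow_atTop_nhds_zero_of_lt_one hθ0 hθ1).const_mul C
  have := ge_of_tendsto' hlim fun n => key n t z ht le_rfl
  exact abs_nonpos_iff.1 this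

theorem moveClamped_add (hL : 0 < L) (x : Icc (0 : ℝ) L) (v : Velocity) {s t : ℝ} (hs : 0 ≤ s)
    (ht : 0 ≤ t) : moveClamped hL (moveClamped hL x v t) v s = moveClamped hL x v (t + s) := by
  obtain ⟨x, hx0, hxL⟩ := x
  apply Subtype.ext
  simp only [moveClamped, coe_projIcc]
  have hL' := hL.le
  rcases velocity_cases v with rfl | rfl | rfl <;> push_cast <;> grind

/-- The Markov property of the run-and-tumble process, by uniqueness for the renewal equation. -/
theorem rtpMean_add (hω : 0 < ω) (hL : 0 < L) {h : Icc (0 : ℝ) L × Velocity → ℝ}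
    (hh : Measurable h) {C : ℝ} (hC : ∀ z, |h z| ≤ C) {s t : ℝ} (hs : 0 ≤ s) (ht : 0 ≤ t)
    (z : Icc (0 : ℝ) L × Velocity) :
    rtpMean hω hL h (t + s) z = rtpMean hω hL (rtpMean hω hL h s) t z := by
  have hh' : Measurable (rtpMean hω hL h s) :=
    (measurable_rtpMean hω hL hh).comp measurable_prodMk_left
  have hC' : ∀ z, |rtpMean hω hL h s z| ≤ C := fun z => abs_rtpMean_le hω hL hC s z
  have key := renewal_unique hω hL
    (D := fun t z => rtpMean hω hL h (t + s) z - rtpMean hω hL (rtpMean hω hL h s) t z)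
    (C := C + C) (fun t z => (abs_sub _ _).trans (add_le_add (abs_rtpMean_le hω hL hC _ _)
      (abs_rtpMean_le hω hL hC' _ _))) ?_ ht z
  · exact sub_eq_zero.1 key
  intro t z ht
  have h1 := intervalIntegrable_renewal hω hL hh hC (t + s)
  have h2 := intervalIntegrable_renewal hω hL hh' hC' t 0 t z
  simp only [← jumpAverage_sub]
  have e : ∀ r, t - r + s = t + s - r := fun r => by ring
  simp only [mul_sub, e]
  rw [intervalIntegral.integral_sub (h1 0 t z) h2, rtpMean_eq hω hL hh hC (add_nonneg ht hs),
    rtpMean_eq hω hL hh' hC' ht, rtpMean_eq hω hL hh hC hs,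
    ← intervalIntegral.integral_add_adjacent_intervals (h1 0 t z) (h1 t (t + s) z)]
  -- the part of the integral over `[t, t + s]` comes from the first jump after time `t`
  have h3 := intervalIntegral.integral_comp_add_left (a := 0) (b := s)
    (fun r => 2 * ω * Real.exp (-(2 * ω * r)) * jumpAverage hω (fun w =>
      rtpMean hω hL h (t + s - r) (moveClamped hL z.1 z.2 r, w)) z.2) t
  rw [add_zero] at h3
  rw [← h3, moveClamped_add hL _ _ hs ht]
  have h4 : ∫ r in (0 : ℝ)..s, 2 * ω * Real.exp (-(2 * ω * (t + r))) * jumpAverage hω (fun w =>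
      rtpMean hω hL h (t + s - (t + r)) (moveClamped hL z.1 z.2 (t + r), w)) z.2 =
      ∫ r in (0 : ℝ)..s, Real.exp (-(2 * ω * t)) * (2 * ω * Real.exp (-(2 * ω * r)) *
        jumpAverage hω (fun w => rtpMean hω hL h (s - r)
          (moveClamped hL (moveClamped hL z.1 z.2 t) z.2 r, w)) z.2) := by
    refine intervalIntegral.integral_congr fun r hr => ?_
    rw [uIcc_of_le hs] at hr
    have e1 : t + s - (t + r) = s - r := by ring
    have e2 : Real.exp (-(2 * ω * (t + r))) =
        Real.exp (-(2 * ω * t)) * Real.exp (-(2 * ω * r)) := by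
      rw [← Real.exp_add]; congr 1; ring
    simp only [e1, e2, moveClamped_add hL _ _ hr.1 ht]
    ring
  rw [h4]
  have e3 : Real.exp (-(2 * ω * (t + s))) =
      Real.exp (-(2 * ω * t)) * Real.exp (-(2 * ω * s)) := by
    rw [← Real.exp_add]; congr 1; ring
  rw [e3, intervalIntegral.integral_const_mul]
  ring

end Renewal

/-! ### The Feller semigroup of the run-and-tumble process -/

section RtpFeller

variable {ω L : ℝ}

theorem continuous_moveClamped (hL : 0 < L) (v : Velocity) :
    Continuous fun p : Icc (0 : ℝ) L × ℝ => moveClamped hL p.1 v p.2 := by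
  unfold moveClamped
  exact continuous_projIcc.comp (by fun_prop)

theorem moveClamped_zero (hL : 0 < L) (x : Icc (0 : ℝ) L) (v : Velocity) :
    moveClamped hL x v 0 = x := by
  simp [moveClamped]

theorem dist_moveClamped_le (hL : 0 < L) (x : Icc (0 : ℝ) L) (v : Velocity) {r : ℝ} (hr : 0 ≤ r) :
    dist (moveClamped hL x v r) x ≤ 2 * r := by
  obtain ⟨x, hx0, hxL⟩ := x
  rw [Subtype.dist_eq, Real.dist_eq]
  simp only [moveClamped, coe_projIcc]
  have hL' := hL.le
  rw [abs_le]
  rcases velocity_cases v with rfl | rfl | rfl <;> push_cast <;> constructor <;> grind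

theorem continuous_rtpProcess (hL : 0 < L) (t : ℝ≥0) (o : Driving) :
    Continuous fun z => rtpProcess ω hL t z o := by
  refine continuous_prod_of_discrete_right.2 fun v => ?_
  have hp : ∀ n, Continuous fun x : Icc (0 : ℝ) L => positionChain ω hL (x, v) o n := fun n => by
    induction n with
    | zero => exact continuous_id
    | succ n ih =>
      exact (continuous_moveClamped hL (velocityChain v o n)).comp
        (ih.prodMk (continuous_const (y := holdingTime ω v o n)))
  exact ((continuous_moveClamped hL (velocityChain v o (jumpCount ω t v o))).comp
    ((hp (jumpCount ω t v o)).prodMk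
      (continuous_const (y := (t : ℝ) - jumpTime ω v o (jumpCount ω t v o))))).prodMk
    (continuous_const (y := velocityChain v o (jumpCount ω t v o)))

theorem continuous_rtpMean (hω : 0 < ω) (hL : 0 < L) (k : C(Icc (0 : ℝ) L × Velocity, ℝ)) (t : ℝ) :
    Continuous (rtpMean hω hL k t) := by
  refine continuous_of_dominated (F := fun z o => k (rtpProcess ω hL t.toNNReal z o))
    (bound := fun _ => ‖k‖) (fun z => ?_)
    (fun z => Eventually.of_forall fun o => k.norm_coe_le_norm _) (integrable_const _)
    (Eventually.of_forall fun o => k.continuous.comp (continuous_rtpProcess hL _ o))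
  exact (k.continuous.measurable.comp ((measurable_rtpProcess ω hL t.toNNReal).comp
    measurable_prodMk_left)).aestronglyMeasurable

theorem one_sub_exp_le (ω r : ℝ) : 1 - Real.exp (-(2 * ω * r)) ≤ 2 * ω * r := by
  have := Real.add_one_le_exp (-(2 * ω * r))
  linarith

/-- Up to time `r`, the process runs without a jump with probability `exp (-2ωr)`. -/
theorem abs_rtpMean_sub_le (hω : 0 < ω) (hL : 0 < L) {h : Icc (0 : ℝ) L × Velocity → ℝ}
    (hh : Measurable h) {C : ℝ} (hC : ∀ z, |h z| ≤ C) {r : ℝ} (hr : 0 ≤ r)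
    (z : Icc (0 : ℝ) L × Velocity) :
    |rtpMean hω hL h r z - h (moveClamped hL z.1 z.2 r, z.2)| ≤ 2 * C * (2 * ω * r) := by
  have hq : 0 < 2 * ω := by positivity
  have hC0 : 0 ≤ C := (abs_nonneg _).trans (hC z)
  have he := one_sub_exp_le ω r
  have he1 : Real.exp (-(2 * ω * r)) ≤ 1 := Real.exp_le_one_iff.2 (by nlinarith)
  have hb : |∫ s in (0 : ℝ)..r, 2 * ω * Real.exp (-(2 * ω * s)) *
      jumpAverage hω (fun w => rtpMean hω hL h (r - s) (moveClamped hL z.1 z.2 s, w)) z.2| ≤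
      C * (2 * ω * r) := by
    rw [← Real.norm_eq_abs]
    have hg : IntervalIntegrable (fun s : ℝ => 2 * ω * Real.exp (-(2 * ω * s)) * C) volume 0 r :=
      (by fun_prop : Continuous fun s : ℝ =>
        2 * ω * Real.exp (-(2 * ω * s)) * C).intervalIntegrable _ _
    refine (intervalIntegral.norm_integral_le_of_norm_le hr (Eventually.of_forall fun s hs => ?_)
      hg).trans ?_
    · rw [norm_mul, Real.norm_of_nonneg (by positivity)]
      exact mul_le_mul_of_nonneg_left
        (abs_jumpAverage_le hω (fun w => abs_rtpMean_le hω hL hC _ _) z.2) (by positivity)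
    · rw [intervalIntegral.integral_mul_const, integral_rate_exp, mul_comm]
      exact mul_le_mul_of_nonneg_left he hC0
  rw [rtpMean_eq hω hL hh hC hr]
  have h1 := hC (moveClamped hL z.1 z.2 r, z.2)
  rw [abs_le] at hb h1 ⊢
  constructor <;> nlinarith

/-- A continuous function changes uniformly little along the motion of the particle. -/
theorem eventually_abs_moveClamped_sub_le (hL : 0 < L) (k : C(Icc (0 : ℝ) L × Velocity, ℝ)) {ε : ℝ}
    (hε : 0 < ε) : ∃ δ > 0, ∀ r, 0 ≤ r → r < δ → ∀ x v w,
      |k (moveClamped hL x v r, w) - k (x, w)| ≤ ε := by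
  obtain ⟨δ, hδ, h⟩ := Metric.uniformContinuous_iff.1
    (CompactSpace.uniformContinuous_of_continuous k.continuous) ε hε
  refine ⟨δ / 2, by positivity, fun r hr hrδ x v w => ?_⟩
  have h1 : dist (moveClamped hL x v r, w) (x, w) < δ := by
    rw [Prod.dist_eq, dist_self, max_eq_left dist_nonneg]
    linarith [dist_moveClamped_le hL x v hr]
  have := h h1
  rw [Real.dist_eq] at this
  exact this.le

theorem isMarkovKernel_rtpKernel (hω : 0 < ω) (hL : 0 < L) (t : ℝ≥0) :
    IsMarkovKernel (rtpKernel hω hL t) :=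
  ⟨fun _ => Measure.isProbabilityMeasure_map
    ((measurable_rtpProcess ω hL t).comp measurable_prodMk_left).aemeasurable⟩

theorem isFellerSemigroup_rtpKernel (hω : 0 < ω) (hL : 0 < L) :
    IsFellerSemigroup (rtpKernel hω hL) := by
  have hm := isMarkovKernel_rtpKernel hω hL
  have hi : ∀ t (k : C(Icc (0 : ℝ) L × Velocity, ℝ)) z,
      ∫ y, k y ∂rtpKernel hω hL t z = rtpMean hω hL k t z := fun t k z =>
    integral_rtpKernel hω hL k.continuous.measurable t z
  have hk : ∀ (k : C(Icc (0 : ℝ) L × Velocity, ℝ)) z, |k z| ≤ ‖k‖ := fun k => k.norm_coe_le_norm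
  refine ⟨⟨hm, ?_, fun s t => ?_⟩, fun t k => ?_, fun k => ?_⟩
  · ext1 z
    refine measure_ext_of_continuousMap fun k => ?_
    rw [hi, Kernel.id_apply, integral_dirac, NNReal.coe_zero,
      rtpMean_eq hω hL k.continuous.measurable (hk k) le_rfl, moveClamped_zero]
    simp
  · ext1 z
    refine measure_ext_of_continuousMap fun k => ?_
    rw [hi, Kernel.integral_comp (ContinuousMap.integrable k _)]
    simp_rw [hi]
    rw [integral_rtpKernel hω hL (continuous_rtpMean hω hL k s).measurable, NNReal.coe_add,
      add_comm, rtpMean_add hω hL k.continuous.measurable (hk k) s.coe_nonneg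
      t.coe_nonneg]
  · simp_rw [hi]
    exact continuous_rtpMean hω hL k t
  · rw [Metric.tendsto_nhds]
    intro ε hε
    obtain ⟨δ, hδ, h⟩ := eventually_abs_moveClamped_sub_le hL k (half_pos (half_pos hε))
    have h1 : Tendsto (fun t : ℝ≥0 => 2 * ‖k‖ * (2 * ω * t)) (𝓝[>] 0)
        (𝓝 (2 * ‖k‖ * (2 * ω * (0 : ℝ≥0)))) :=
      (Continuous.tendsto (by fun_prop) _).mono_left nhdsWithin_le_nhds
    have h2 : Tendsto (fun t : ℝ≥0 => (t : ℝ)) (𝓝[>] 0) (𝓝 ((0 : ℝ≥0) : ℝ)) :=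
      (Continuous.tendsto (by fun_prop) _).mono_left nhdsWithin_le_nhds
    rw [NNReal.coe_zero, mul_zero, mul_zero] at h1
    rw [NNReal.coe_zero] at h2
    filter_upwards [h1.eventually_lt_const (half_pos (half_pos hε)), h2.eventually_lt_const hδ]
      with t ht1 ht2
    refine lt_of_le_of_lt ((ContinuousMap.dist_le (half_pos hε).le).2 fun z => ?_) (half_lt_self hε)
    change dist (∫ y, k y ∂rtpKernel hω hL t z) (k z) ≤ ε / 2
    rw [hi, Real.dist_eq]
    have e1 := abs_rtpMean_sub_le hω hL k.continuous.measurable (hk k) t.coe_nonneg z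
    have e2 := h t t.coe_nonneg ht2 z.1 z.2 z.2
    have e3 := abs_sub_le (rtpMean hω hL k t z) (k (moveClamped hL z.1 z.2 t, z.2)) (k z)
    linarith

end RtpFeller

/-! ### The invariant measure of the run-and-tumble process -/

section RtpInvariant

variable {ω L : ℝ}

/-- The jump part of the generator of the run-and-tumble process. -/
def jumpPart (hω : 0 < ω) (k : Icc (0 : ℝ) L × Velocity → ℝ) (z : Icc (0 : ℝ) L × Velocity) : ℝ :=
  2 * ω * (jumpAverage hω (fun w => k (z.1, w)) z.2 - k z)

/-- The first-order expansion in time of the transition semigroup. The motion along the velocity is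
kept exact, so that it holds uniformly for all continuous functions, differentiable or not. -/
theorem eventually_abs_rtpMean_sub_le (hω : 0 < ω) (hL : 0 < L)
    (k : C(Icc (0 : ℝ) L × Velocity, ℝ)) {ε : ℝ} (hε : 0 < ε) :
    ∀ᶠ r : ℝ≥0 in 𝓝[>] 0, ∀ z, |rtpMean hω hL k r z - k (moveClamped hL z.1 z.2 r, z.2) -
      r * jumpPart hω k z| ≤ r * ε := by
  have hq : 0 < 2 * ω := by positivity
  -- the integrand below is `2ω` times a sum of five errors of size at most `η`
  set η := ε / (5 * (2 * ω)) with hη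
  have hη0 : 0 < η := by positivity
  have hk : ∀ z, |k z| ≤ ‖k‖ := k.norm_coe_le_norm
  obtain ⟨δ, hδ, hmove⟩ := eventually_abs_moveClamped_sub_le hL k hη0
  have hlim : ∀ c : ℝ, Tendsto (fun r : ℝ≥0 => c * r) (𝓝[>] 0) (𝓝 0) := fun c => by
    have : Tendsto (fun r : ℝ≥0 => c * r) (𝓝[>] 0) (𝓝 (c * (0 : ℝ≥0))) :=
      (Continuous.tendsto (by fun_prop) _).mono_left nhdsWithin_le_nhds
    simpa using this
  filter_upwards [(hlim 1).eventually_lt_const hδ,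
    (hlim (2 * ‖k‖ * (2 * ω))).eventually_lt_const hη0] with r hr1 hr2 z
  have hr : (0 : ℝ) ≤ r := r.coe_nonneg
  rw [one_mul] at hr1
  generalize (r : ℝ) = r at hr hr1 hr2 ⊢
  have hk0 : 0 ≤ ‖k‖ := norm_nonneg k
  set J := jumpAverage hω (fun w => k (z.1, w)) z.2 with hJ
  set m := k (moveClamped hL z.1 z.2 r, z.2) with hm
  have hint := intervalIntegrable_renewal hω hL k.continuous.measurable hk r 0 r z
  have hI : IntervalIntegrable (fun s : ℝ => 2 * ω * Real.exp (-(2 * ω * s)) * m) volume 0 r :=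
    (by fun_prop : Continuous fun s : ℝ =>
      2 * ω * Real.exp (-(2 * ω * s)) * m).intervalIntegrable _ _
  have hc : IntervalIntegrable (fun _ : ℝ => 2 * ω * (J - k z)) volume 0 r :=
    continuous_const.intervalIntegrable _ _
  have key : rtpMean hω hL k r z - m - r * jumpPart hω k z =
      ∫ s in (0 : ℝ)..r, (2 * ω * Real.exp (-(2 * ω * s)) * jumpAverage hω (fun w =>
        rtpMean hω hL k (r - s) (moveClamped hL z.1 z.2 s, w)) z.2 -
        2 * ω * Real.exp (-(2 * ω * s)) * m - 2 * ω * (J - k z)) := by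
    rw [intervalIntegral.integral_sub (hint.sub hI) hc, intervalIntegral.integral_sub hint hI,
      intervalIntegral.integral_mul_const, integral_rate_exp, intervalIntegral.integral_const,
      rtpMean_eq hω hL k.continuous.measurable hk hr, jumpPart, smul_eq_mul]
    ring
  rw [key, ← Real.norm_eq_abs]
  refine (intervalIntegral.norm_integral_le_of_norm_le_const (C := ε) fun s hs => ?_).trans_eq ?_
  · rw [uIoc_of_le hr] at hs
    have hs0 := hs.1.le
    set A := jumpAverage hω (fun w => rtpMean hω hL k (r - s) (moveClamped hL z.1 z.2 s, w)) z.2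
      with hA
    have hmz : |m - k z| ≤ η := hmove r hr hr1 z.1 z.2 z.2
    have hAJ : |A - J| ≤ 3 * η := by
      rw [hA, hJ, jumpAverage_sub]
      refine abs_jumpAverage_le hω (fun w => ?_) _
      have e1 := abs_rtpMean_sub_le hω hL k.continuous.measurable hk (sub_nonneg.2 hs.2)
        (moveClamped hL z.1 z.2 s, w)
      have e4 : 2 * ‖k‖ * (2 * ω * (r - s)) ≤ 2 * ‖k‖ * (2 * ω) * r := by
        have : 0 ≤ 2 * ‖k‖ * (2 * ω) * s := by positivity
        linarith
      have e2 := hmove (r - s) (sub_nonneg.2 hs.2) (by linarith) (moveClamped hL z.1 z.2 s) w w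
      have e3 := hmove s hs0 (by linarith [hs.2]) z.1 z.2 w
      refine (abs_sub_le _ (k (moveClamped hL (moveClamped hL z.1 z.2 s) w (r - s), w)) _).trans ?_
      refine (add_le_add e1 (abs_sub_le _ (k (moveClamped hL z.1 z.2 s, w)) _)).trans ?_
      linarith
    have hJk : |J - k z| ≤ 2 * ‖k‖ := by
      have e1 : |J| ≤ ‖k‖ := abs_jumpAverage_le hω (fun w => hk _) _
      have := abs_sub J (k z)
      linarith [hk z]
    have hexp1 : Real.exp (-(2 * ω * s)) ≤ 1 := Real.exp_le_one_iff.2 (by nlinarith)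
    have hexp0 := Real.exp_pos (-(2 * ω * s))
    have hexp2 := one_sub_exp_le ω s
    have e0 : 2 * ω * Real.exp (-(2 * ω * s)) * A - 2 * ω * Real.exp (-(2 * ω * s)) * m -
        2 * ω * (J - k z) = 2 * ω * (Real.exp (-(2 * ω * s)) * ((A - J) - (m - k z)) -
          (1 - Real.exp (-(2 * ω * s))) * (J - k z)) := by ring
    have e1 : |Real.exp (-(2 * ω * s)) * ((A - J) - (m - k z))| ≤ 4 * η := by
      rw [abs_mul, abs_of_pos hexp0]
      have := abs_sub (A - J) (m - k z)
      calc _ ≤ 1 * |(A - J) - (m - k z)| := by gcongr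
        _ ≤ _ := by linarith
    have e2 : |(1 - Real.exp (-(2 * ω * s))) * (J - k z)| ≤ η := by
      rw [abs_mul, abs_of_nonneg (by linarith)]
      calc _ ≤ 2 * ω * r * (2 * ‖k‖) :=
            mul_le_mul (hexp2.trans (mul_le_mul_of_nonneg_left hs.2 hq.le)) hJk (abs_nonneg _)
              (by positivity)
        _ ≤ η := by linarith
    rw [Real.norm_eq_abs, e0, abs_mul, abs_of_pos hq]
    calc _ ≤ 2 * ω * (4 * η + η) := by
          gcongr
          exact (abs_sub _ _).trans (add_le_add e1 e2)
      _ = ε := by rw [hη]; field_simp; ring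
  · rw [sub_zero, abs_of_nonneg hr, mul_comm]

theorem isFiniteMeasure_rtpMeasure (hL : 0 < L) : IsFiniteMeasure (rtpMeasure ω L hL) := by
  have hf : ∀ (a : ℝ) (m : Measure (Icc (0 : ℝ) L)) [IsFiniteMeasure m],
      IsFiniteMeasure (ENNReal.ofReal a • m) := fun a m _ =>
    Measure.smul_finite m ENNReal.ofReal_ne_top
  unfold rtpMeasure
  infer_instance

/-- Integrals with respect to the invariant measure. -/
theorem integral_rtpMeasure (hω : 0 < ω) (hL : 0 < L) {h : Icc (0 : ℝ) L × Velocity → ℝ}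
    (hh : Measurable h) {C : ℝ} (hC : ∀ z, |h z| ≤ C) :
    ∫ z, h z ∂rtpMeasure ω L hL = (2 + ω * L)⁻¹ * ∑ v : Velocity,
      (leftWeight v * h (leftEnd hL, v) + bulkWeight ω v * ∫ x, h (x, v) ∂lebesgueIcc L +
        rightWeight v * h (rightEnd hL, v)) := by
  have hp := two_add_mul_pos hω hL
  have hl : ∀ v, 0 ≤ leftWeight v := fun v => by unfold leftWeight; split_ifs <;> norm_num
  have hr : ∀ v, 0 ≤ rightWeight v := fun v => by unfold rightWeight; split_ifs <;> norm_num
  have hb : ∀ v, 0 ≤ bulkWeight ω v := fun v => by unfold bulkWeight; split_ifs <;> positivity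
  have hf : ∀ (a : ℝ) (m : Measure (Icc (0 : ℝ) L)) [IsFiniteMeasure m],
      IsFiniteMeasure (ENNReal.ofReal a • m) := fun a m _ =>
    Measure.smul_finite m ENNReal.ofReal_ne_top
  have hint : ∀ (v : Velocity) (m : Measure (Icc (0 : ℝ) L)) [IsFiniteMeasure m],
      Integrable (fun x => h (x, v)) m := fun v m _ =>
    Integrable.of_bound (hh.comp measurable_prodMk_right).aestronglyMeasurable C
      (Eventually.of_forall fun x => hC _)
  have hint' : ∀ (m : Measure (Icc (0 : ℝ) L × Velocity)) [IsFiniteMeasure m],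
      Integrable h m := fun m _ =>
    Integrable.of_bound hh.aestronglyMeasurable C (Eventually.of_forall fun x => hC _)
  rw [rtpMeasure, integral_finsetSum_measure fun v _ => hint' _, Finset.mul_sum]
  refine Finset.sum_congr rfl fun v _ => ?_
  rw [Measure.prod_dirac, integral_map measurable_prodMk_right.aemeasurable
    hh.aestronglyMeasurable, integral_add_measure (hint v _) (hint v _),
    integral_add_measure (hint v _) (hint v _), integral_smul_measure, integral_smul_measure,
    integral_smul_measure, integral_dirac, integral_dirac,
    ENNReal.toReal_ofReal (div_nonneg (hl v) hp.le), ENNReal.toReal_ofReal (div_nonneg (hb v) hp.le),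
    ENNReal.toReal_ofReal (div_nonneg (hr v) hp.le)]
  simp only [smul_eq_mul, div_eq_mul_inv]
  change _ * h (leftEnd hL, v) + _ + _ * h (rightEnd hL, v) = _
  ring

theorem map_fst_rtpMeasure (hω : 0 < ω) (hL : 0 < L) :
    (rtpMeasure ω L hL).map Prod.fst = stickyMeasure ω L hL := by
  have : IsFiniteMeasure (rtpMeasure ω L hL) := isFiniteMeasure_rtpMeasure hL
  refine measure_ext_of_continuousMap fun f => ?_
  rw [integral_map measurable_fst.aemeasurable f.continuous.aestronglyMeasurable,
    integral_rtpMeasure hω hL (h := fun z => f z.1) (f.continuous.measurable.comp measurable_fst)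
      (fun z => f.norm_coe_le_norm z.1), integral_stickyMeasure hω hL, ← integral_lebesgueIcc hL,
      sum_velocity]
  simp only [leftWeight, rightWeight, bulkWeight]
  norm_num
  left
  ring

theorem measurePreserving_fst_rtpMeasure (hω : 0 < ω) (hL : 0 < L) :
    MeasurePreserving Prod.fst (rtpMeasure ω L hL) (stickyMeasure ω L hL) :=
  ⟨measurable_fst, map_fst_rtpMeasure hω hL⟩

theorem isProbabilityMeasure_rtpMeasure (hω : 0 < ω) (hL : 0 < L) :
    IsProbabilityMeasure (rtpMeasure ω L hL) := by
  have := isProbabilityMeasure_stickyMeasure hω hL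
  rw [← map_fst_rtpMeasure hω hL] at this
  exact Measure.isProbabilityMeasure_of_map Prod.fst

/-- If `K` extends `k` to the real line by constants, then the integral of `k` along the motion is
the integral of `K` over the translated interval. -/
theorem tendsto_integral_moveClamped_sub (hL : 0 < L) (k : C(Icc (0 : ℝ) L, ℝ)) (v : Velocity) :
    Tendsto (fun r : ℝ≥0 => (r : ℝ)⁻¹ * ((∫ x, k (moveClamped hL x v r) ∂lebesgueIcc L) -
      ∫ x, k x ∂lebesgueIcc L)) (𝓝[>] 0) (𝓝 (v.1 * (k (rightEnd hL) - k (leftEnd hL)))) := by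
  set K := IccExtend hL.le k with hK
  have hKc : Continuous K := k.continuous.Icc_extend'
  set P : ℝ → ℝ := fun u => ∫ y in (0 : ℝ)..u, K y with hP
  have hPd : ∀ u, HasDerivAt P (K u) u := fun u =>
    intervalIntegral.integral_hasDerivAt_right (hKc.intervalIntegrable _ _)
      (hKc.stronglyMeasurableAtFilter _ _) hKc.continuousAt
  have hshift : ∀ r : ℝ, ∫ x, k (moveClamped hL x v r) ∂lebesgueIcc L =
      P (L + v.1 * r) - P (v.1 * r) := fun r => by
    rw [integral_lebesgueIcc hL, hP, intervalIntegral.integral_interval_sub_left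
      (hKc.intervalIntegrable _ _) (hKc.intervalIntegrable _ _)]
    have := intervalIntegral.integral_comp_add_right (a := 0) (b := L) K ((v.1 : ℝ) * r)
    rw [zero_add] at this
    rw [← this]
    refine intervalIntegral.integral_congr fun x hx => ?_
    rw [uIcc_of_le hL.le] at hx
    rw [IccExtend_of_mem _ _ hx]
    rfl
  have hd : HasDerivAt (fun r : ℝ => P (L + v.1 * r) - P (v.1 * r)) (v.1 * (K L - K 0)) 0 := by
    have h0 : HasDerivAt (fun r : ℝ => (v.1 : ℝ) * r) v.1 0 := by
      simpa using (hasDerivAt_id (0 : ℝ)).const_mul (v.1 : ℝ)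
    have h1 := (hPd (L + v.1 * 0)).comp 0 (h0.const_add L)
    have h2 := (hPd (v.1 * 0)).comp 0 h0
    refine (h1.sub h2).congr_deriv ?_
    simp only [mul_zero, add_zero]
    ring
  have h1 := hd.tendsto_slope_zero_right.comp tendsto_coe_nnreal_nhdsGT_zero
  have e0 : K 0 = k (leftEnd hL) := IccExtend_left _ _
  have eL : K L = k (rightEnd hL) := IccExtend_right _ _
  rw [e0, eL] at h1
  refine h1.congr fun r => ?_
  have h3 := hshift 0
  simp only [moveClamped_zero] at h3
  simp only [Function.comp, zero_add, smul_eq_mul]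
  rw [hshift, h3]

theorem measurable_jumpPart (hω : 0 < ω) {k : Icc (0 : ℝ) L × Velocity → ℝ} (hk : Measurable k) :
    Measurable (jumpPart hω k) :=
  measurable_from_prod_countable_left fun v =>
    ((measurable_jumpAverage hω (fun _ => hk.comp measurable_prodMk_right) v).sub
      (hk.comp measurable_prodMk_right)).const_mul _

theorem abs_jumpPart_le (hω : 0 < ω) {k : Icc (0 : ℝ) L × Velocity → ℝ} {C : ℝ}
    (hC : ∀ z, |k z| ≤ C) (z : Icc (0 : ℝ) L × Velocity) : |jumpPart hω k z| ≤ 2 * ω * (C + C) := by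
  rw [jumpPart, abs_mul, abs_of_pos (by positivity)]
  gcongr
  exact (abs_sub _ _).trans (add_le_add (abs_jumpAverage_le hω (fun w => hC _) _) (hC z))

/-- The flow through the bulk and the jumps at the end points balance. -/
theorem tendsto_integral_rtpMeasure_move (hω : 0 < ω) (hL : 0 < L)
    (k : C(Icc (0 : ℝ) L × Velocity, ℝ)) :
    Tendsto (fun r : ℝ≥0 => (r : ℝ)⁻¹ *
      ((∫ z, k (moveClamped hL z.1 z.2 r, z.2) ∂rtpMeasure ω L hL) - ∫ z, k z ∂rtpMeasure ω L hL))
      (𝓝[>] 0) (𝓝 (-∫ z, jumpPart hω k z ∂rtpMeasure ω L hL)) := by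
  have hk : ∀ z, |k z| ≤ ‖k‖ := k.norm_coe_le_norm
  have hp := two_add_mul_pos hω hL
  let kv : Velocity → C(Icc (0 : ℝ) L, ℝ) := fun v =>
    ⟨fun x => k (x, v), k.continuous.comp (continuous_id.prodMk continuous_const)⟩
  have hmove : ∀ r : ℝ, Measurable fun z : Icc (0 : ℝ) L × Velocity =>
      k (moveClamped hL z.1 z.2 r, z.2) := fun r =>
    k.continuous.measurable.comp (((measurable_moveClamped hL).comp
      (measurable_fst.prodMk (measurable_snd.prodMk measurable_const))).prodMk measurable_snd)
  have hl : ∀ r : ℝ≥0, moveClamped hL (leftEnd hL) velNeg r = leftEnd hL := fun r =>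
    projIcc_of_le_left hL.le (by simp)
  have hr : ∀ r : ℝ≥0, moveClamped hL (rightEnd hL) velPos r = rightEnd hL := fun r =>
    projIcc_of_right_le hL.le (by simp)
  have h0 : ∀ (x : Icc (0 : ℝ) L) (r : ℝ≥0), moveClamped hL x velZero r = x := fun x r => by
    simp [moveClamped]
  have h1 := ((tendsto_integral_moveClamped_sub hL (kv velNeg) velNeg).const_mul (ω / 4)).add
    ((tendsto_integral_moveClamped_sub hL (kv velPos) velPos).const_mul (ω / 4))
  have h2 := h1.const_mul (2 + ω * L)⁻¹
  have hi : ∀ v, Integrable (kv v) (lebesgueIcc L) := fun v => ContinuousMap.integrable _ _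
  -- in `∫ jumpPart k`, the bulk terms cancel and only the endpoints remain
  have e : (2 + ω * L)⁻¹ * (ω / 4 * (((velNeg : Velocity).1 : ℝ) *
      (kv velNeg (rightEnd hL) - kv velNeg (leftEnd hL))) + ω / 4 * (((velPos : Velocity).1 : ℝ) *
      (kv velPos (rightEnd hL) - kv velPos (leftEnd hL)))) =
      -∫ z, jumpPart hω k z ∂rtpMeasure ω L hL := by
    rw [integral_rtpMeasure hω hL (measurable_jumpPart hω k.continuous.measurable)
      (abs_jumpPart_le hω hk), sum_velocity]
    simp only [jumpPart, jumpAverage_velNeg, jumpAverage_velZero, jumpAverage_velPos]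
    have e1 : ∫ x, 2 * ω * (k (x, velZero) - k (x, velNeg)) ∂lebesgueIcc L =
        2 * ω * ((∫ x, kv velZero x ∂lebesgueIcc L) - ∫ x, kv velNeg x ∂lebesgueIcc L) := by
      rw [← integral_sub (hi _) (hi _), ← integral_const_mul]; rfl
    have e2 : ∫ x, 2 * ω * (k (x, velZero) - k (x, velPos)) ∂lebesgueIcc L =
        2 * ω * ((∫ x, kv velZero x ∂lebesgueIcc L) - ∫ x, kv velPos x ∂lebesgueIcc L) := by
      rw [← integral_sub (hi _) (hi _), ← integral_const_mul]; rfl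
    have e3 : ∫ x, 2 * ω * ((k (x, velNeg) + k (x, velPos)) / 2 - k (x, velZero)) ∂lebesgueIcc L =
        2 * ω * (((∫ x, kv velNeg x ∂lebesgueIcc L) + ∫ x, kv velPos x ∂lebesgueIcc L) / 2 -
          ∫ x, kv velZero x ∂lebesgueIcc L) := by
      rw [← integral_add (hi _) (hi _), ← integral_div,
        ← integral_sub (Integrable.div_const (f := fun x => kv velNeg x + kv velPos x)
          ((hi _).add (hi _)) 2) (hi _), ← integral_const_mul]; rfl
    rw [e1, e2, e3]
    simp only [leftWeight, rightWeight, bulkWeight, kv, ContinuousMap.coe_mk]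
    norm_num
    ring
  rw [e] at h2
  refine h2.congr fun r => ?_
  rw [integral_rtpMeasure hω hL (hmove r) (fun z => hk _),
    integral_rtpMeasure hω hL k.continuous.measurable hk, sum_velocity, sum_velocity]
  simp only [hl, hr, h0, leftWeight, rightWeight, bulkWeight]
  norm_num
  change (2 + ω * L)⁻¹ * (ω / 4 * (_ *
      ((∫ x, k (moveClamped hL x velNeg r, velNeg) ∂lebesgueIcc L) -
    ∫ x, k (x, velNeg) ∂lebesgueIcc L)) + ω / 4 * (_ *
      ((∫ x, k (moveClamped hL x velPos r, velPos) ∂lebesgueIcc L) -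
    ∫ x, k (x, velPos) ∂lebesgueIcc L))) = _
  ring

theorem isInvariantMeasure_rtpMeasure (hω : 0 < ω) (hL : 0 < L) :
    IsInvariantMeasure (rtpKernel hω hL) (rtpMeasure ω L hL) := by
  have hκ := isFellerSemigroup_rtpKernel hω hL
  have := isProbabilityMeasure_rtpMeasure hω hL
  refine isInvariantMeasure_of_integral hκ.markov fun t f => ?_
  refine (isContractionSemigroup_fellerOperator hκ).apply_map_eq
    (continuous_integral_continuousMap (rtpMeasure ω L hL)) (fun k => ?_) t f
  have hk : ∀ z, |k z| ≤ ‖k‖ := k.norm_coe_le_norm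
  have hiB : Integrable (jumpPart hω k) (rtpMeasure ω L hL) :=
    Integrable.of_bound (measurable_jumpPart hω k.continuous.measurable).aestronglyMeasurable _
      (Eventually.of_forall (abs_jumpPart_le hω hk))
  have him : ∀ r : ℝ≥0, Integrable (fun z : Icc (0 : ℝ) L × Velocity =>
      k (moveClamped hL z.1 z.2 r, z.2)) (rtpMeasure ω L hL) := fun r =>
    Integrable.of_bound (k.continuous.measurable.comp (((measurable_moveClamped hL).comp
      (measurable_fst.prodMk (measurable_snd.prodMk measurable_const))).prodMk
        measurable_snd)).aestronglyMeasurable ‖k‖ (Eventually.of_forall fun z => hk _)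
  have hiT : ∀ r : ℝ≥0, Integrable (fun z => rtpMean hω hL k r z) (rtpMeasure ω L hL) := fun r =>
    Integrable.of_bound (continuous_rtpMean hω hL k r).aestronglyMeasurable ‖k‖
      (Eventually.of_forall fun z => abs_rtpMean_le hω hL hk _ _)
  have h1 := (tendsto_integral_rtpMeasure_move hω hL k).add
    (tendsto_const_nhds (x := ∫ z, jumpPart hω k z ∂rtpMeasure ω L hL))
  have h2 : Tendsto (fun r : ℝ≥0 => (r : ℝ)⁻¹ * ∫ z, (rtpMean hω hL k r z -
      k (moveClamped hL z.1 z.2 r, z.2) - r * jumpPart hω k z) ∂rtpMeasure ω L hL)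
      (𝓝[>] 0) (𝓝 0) := by
    rw [Metric.tendsto_nhds]
    intro ε hε
    filter_upwards [eventually_abs_rtpMean_sub_le hω hL k (half_pos hε), self_mem_nhdsWithin]
      with r hr hr0
    have hr0' : (0 : ℝ) < r := NNReal.coe_pos.2 hr0
    have h3 := norm_integral_le_of_norm_le_const (μ := rtpMeasure ω L hL)
      (f := fun z => rtpMean hω hL k r z - k (moveClamped hL z.1 z.2 r, z.2) -
        r * jumpPart hω k z) (Eventually.of_forall hr)
    rw [probReal_univ, mul_one] at h3
    rw [dist_zero_right, norm_mul, norm_inv, Real.norm_of_nonneg hr0'.le]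
    calc _ ≤ (r : ℝ)⁻¹ * (r * (ε / 2)) := by gcongr
      _ = ε / 2 := by field_simp
      _ < ε := half_lt_self hε
  have h3 := h2.add h1
  rw [neg_add_cancel, zero_add] at h3
  refine h3.congr' ?_
  filter_upwards [self_mem_nhdsWithin] with r hr0
  have hr0' : (r : ℝ) ≠ 0 := (NNReal.coe_pos.2 hr0).ne'
  have e : ∫ z, fellerOperator hκ r k z ∂rtpMeasure ω L hL =
      ∫ z, rtpMean hω hL k r z ∂rtpMeasure ω L hL :=
    integral_congr_ae (Eventually.of_forall fun z =>
      integral_rtpKernel hω hL k.continuous.measurable r z)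
  rw [e, integral_sub (f := fun z => rtpMean hω hL k r z -
    k (moveClamped hL z.1 z.2 r, z.2)) ((hiT r).sub (him r)) (hiB.const_mul _),
    integral_sub (hiT r) (him r),
    integral_const_mul]
  field_simp
  ring

end RtpInvariant

/-! ### The lift -/

section L2Generator

variable {E : Type*} [MeasurableSpace E]

/-- Bounded pointwise convergence of the difference quotients suffices for the domain of the
`L²`-generator. -/
theorem isGeneratorPair_l2Operator_of_bounded {κ : ℝ≥0 → Kernel E E} (hκ : ∀ t, IsMarkovKernel (κ t))
    {μ : Measure E} [IsFiniteMeasure μ] (hμ : IsInvariantMeasure κ μ) {u d : E → ℝ}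
    (hu : Measurable u) (hd : Measurable d) {C : ℝ} (hdC : ∀ z, |d z| ≤ C)
    (hlim : ∀ z, Tendsto (fun t : ℝ≥0 => (t : ℝ)⁻¹ * ((∫ y, u y ∂κ t z) - u z)) (𝓝[>] 0) (𝓝 (d z)))
    (hC : ∀ᶠ t : ℝ≥0 in 𝓝[>] 0, ∀ z, |(t : ℝ)⁻¹ * ((∫ y, u y ∂κ t z) - u z)| ≤ C)
    {f g : Lp ℝ 2 μ} (hf : f =ᵐ[μ] u) (hg : g =ᵐ[μ] d) :
    IsGeneratorPair (fun t => l2Operator (κ t) μ (hμ t)) f g := by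
  rw [IsGeneratorPair, tendsto_iff_norm_sub_tendsto_zero]
  set q : ℝ≥0 → E → ℝ := fun t z => (t : ℝ)⁻¹ * ((∫ y, u y ∂κ t z) - u z) with hq
  have hsq : ∀ t : ℝ≥0, ‖(t : ℝ)⁻¹ • (l2Operator (κ t) μ (hμ t) f - f) - g‖ =
      √(∫ z, (q t z - d z) ^ 2 ∂μ) := fun t => by
    rw [eq_comm, Real.sqrt_eq_iff_mul_self_eq (integral_nonneg fun z => sq_nonneg _)
      (norm_nonneg _), ← real_inner_self_eq_norm_mul_norm, L2.inner_def]
    refine integral_congr_ae ?_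
    filter_upwards [Lp.coeFn_sub ((t : ℝ)⁻¹ • (l2Operator (κ t) μ (hμ t) f - f)) g,
      Lp.coeFn_smul (t : ℝ)⁻¹ (l2Operator (κ t) μ (hμ t) f - f),
      Lp.coeFn_sub (l2Operator (κ t) μ (hμ t) f) f, coeFn_l2Operator (κ t) (hμ t) f hf, hf, hg]
      with z h1 h2 h3 h4 h5 h6
    rw [h1, Pi.sub_apply, h2, Pi.smul_apply, h3, Pi.sub_apply, h4, h5, h6, smul_eq_mul]
    simp only [hq, real_inner_self_eq_norm_sq, Real.norm_eq_abs, sq_abs]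
  simp only [hsq]
  have h0 : Tendsto (fun t => ∫ z, (q t z - d z) ^ 2 ∂μ) (𝓝[>] 0) (𝓝 (∫ _, (0 : ℝ) ∂μ)) := by
    refine tendsto_integral_filter_of_dominated_convergence (fun _ => (C + C) ^ 2) ?_ ?_
      (integrable_const _) (Eventually.of_forall fun z => ?_)
    · refine Eventually.of_forall fun t => ?_
      have hm : Measurable (q t) :=
        ((hu.stronglyMeasurable.integral_kernel (κ := κ t)).measurable.sub hu).const_mul _
      exact ((hm.sub hd).pow_const 2).aestronglyMeasurable
    · filter_upwards [hC] with t ht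
      refine Eventually.of_forall fun z => ?_
      rw [Real.norm_eq_abs, abs_of_nonneg (sq_nonneg _), sq_le_sq,
        abs_of_nonneg (a := C + C) (by linarith [(abs_nonneg _).trans (hdC z)])]
      exact (abs_sub _ _).trans (add_le_add (ht z) (hdC z))
    · have := ((hlim z).sub_const (d z)).pow 2
      simpa using this
  rw [integral_zero] at h0
  have := (Real.continuous_sqrt.tendsto 0).comp h0
  rwa [Real.sqrt_zero] at this

end L2Generator

section Lift

variable {ω L : ℝ} {hL : 0 < L}

open Classical in
/-- The velocity times `F'`, except at the jammed states, where it is `0`: the image of `F ∘ π` under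
the generator of the run-and-tumble process. -/
def freeDerivative (hL : 0 < L) (F' : ℝ → ℝ) (z : Icc (0 : ℝ) L × Velocity) : ℝ :=
  if z = (leftEnd hL, velNeg) ∨ z = (rightEnd hL, velPos) then 0 else z.2.1 * F' z.1

theorem measurable_freeDerivative {F' : ℝ → ℝ} (hF' : Continuous F') :
    Measurable (freeDerivative hL F') := by
  have hv : Measurable fun v : Velocity => (v.1 : ℝ) := measurable_of_countable _
  exact Measurable.ite ((measurableSet_singleton _).union (measurableSet_singleton _))
    measurable_const ((hv.comp measurable_snd).mul
      (hF'.measurable.comp (measurable_subtype_coe.comp measurable_fst)))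

theorem abs_velocity_le (v : Velocity) : |(v.1 : ℝ)| ≤ 2 := by
  rcases velocity_cases v with rfl | rfl | rfl <;> norm_num

theorem abs_freeDerivative_le {F' : ℝ → ℝ} {M : ℝ} (hM : ∀ x ∈ Icc 0 L, |F' x| ≤ M)
    (z : Icc (0 : ℝ) L × Velocity) : |freeDerivative hL F' z| ≤ 2 * M := by
  have h0 := (abs_nonneg _).trans (hM z.1 z.1.2)
  unfold freeDerivative
  split_ifs
  · rw [abs_zero]; linarith
  · rw [abs_mul]
    exact mul_le_mul (abs_velocity_le _) (hM _ z.1.2) (abs_nonneg _) two_pos.le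

theorem exists_abs_le_Icc {F' : ℝ → ℝ} (hF' : Continuous F') (L : ℝ) :
    ∃ M, ∀ x ∈ Icc 0 L, |F' x| ≤ M :=
  isCompact_Icc.exists_bound_of_continuousOn hF'.continuousOn

theorem StickyExtension.abs_sub_le {f g : C(Icc (0 : ℝ) L, ℝ)} {F F' F'' : ℝ → ℝ}
    (h : StickyExtension ω hL f g F F' F'') {M : ℝ} (hM : ∀ x ∈ Icc 0 L, |F' x| ≤ M)
    (x : Icc (0 : ℝ) L) (v : Velocity) {r : ℝ} (hr : 0 ≤ r) :
    |f (moveClamped hL x v r) - f x| ≤ M * (2 * r) := by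
  have h1 := (convex_Icc (0 : ℝ) L).norm_image_sub_le_of_norm_hasDerivWithin_le
    (fun y _ => (h.hasDerivAt y).hasDerivWithinAt) hM x.2 (moveClamped hL x v r).2
  rw [h.eq, h.eq] at h1
  have h2 := dist_moveClamped_le hL x v hr
  have h0 := (abs_nonneg _).trans (hM x x.2)
  exact h1.trans (mul_le_mul_of_nonneg_left h2 h0)

/-- The derivative along the motion of the particle. -/
theorem StickyExtension.tendsto_freeDerivative {f g : C(Icc (0 : ℝ) L, ℝ)} {F F' F'' : ℝ → ℝ}
    (h : StickyExtension ω hL f g F F' F'') (z : Icc (0 : ℝ) L × Velocity) :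
    Tendsto (fun r : ℝ≥0 => (r : ℝ)⁻¹ * (f (moveClamped hL z.1 z.2 r) - f z.1)) (𝓝[>] 0)
      (𝓝 (freeDerivative hL F' z)) := by
  have hr0 : Tendsto (fun r : ℝ≥0 => (r : ℝ)) (𝓝[>] 0) (𝓝 0) :=
    tendsto_coe_nnreal_nhdsGT_zero.mono_right nhdsWithin_le_nhds
  obtain ⟨x, v⟩ := z
  by_cases hj : (x, v) = (leftEnd hL, velNeg) ∨ (x, v) = (rightEnd hL, velPos)
  · have hx : ∀ r : ℝ≥0, moveClamped hL x v r = x := fun r => by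
      rcases hj with hj | hj <;> obtain ⟨rfl, rfl⟩ := Prod.mk.inj hj
      · exact projIcc_of_le_left hL.le (by simp)
      · exact projIcc_of_right_le hL.le (by simp)
    simp only [hx, sub_self, mul_zero, freeDerivative, if_pos hj]
    exact tendsto_const_nhds
  rw [freeDerivative, if_neg hj]
  have h0 : HasDerivAt (fun r : ℝ => (x : ℝ) + (v.1 : ℝ) * r) v.1 0 := by
    simpa using ((hasDerivAt_id (0 : ℝ)).const_mul (v.1 : ℝ)).const_add (x : ℝ)
  have h1 := (h.hasDerivAt ((x : ℝ) + (v.1 : ℝ) * 0)).comp 0 h0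
  have h2 := h1.tendsto_slope_zero_right.comp tendsto_coe_nnreal_nhdsGT_zero
  simp only [mul_zero, add_zero] at h2
  rw [mul_comm] at h2
  refine h2.congr' ?_
  -- for small times, the particle does not reach the boundary, unless it rests
  have hmem : ∀ᶠ r : ℝ≥0 in 𝓝[>] 0, (x : ℝ) + (v.1 : ℝ) * r ∈ Icc 0 L := by
    have hx0 := x.2.1
    have hxL := x.2.2
    rcases velocity_cases v with rfl | rfl | rfl
    · have hx : 0 < (x : ℝ) := lt_of_le_of_ne hx0 fun e => hj (Or.inl (by
        rw [Subtype.ext (a1 := x) (a2 := leftEnd hL) e.symm]))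
      filter_upwards [hr0.eventually_lt_const (half_pos hx)] with r hr
      have := r.coe_nonneg
      push_cast
      constructor <;> linarith
    · refine Eventually.of_forall fun r => ?_
      push_cast
      constructor <;> linarith
    · have hx : 0 < L - x := sub_pos.2 (lt_of_le_of_ne hxL fun e => hj (Or.inr (by
        rw [Subtype.ext (a1 := x) (a2 := rightEnd hL) e])))
      filter_upwards [hr0.eventually_lt_const (half_pos hx)] with r hr
      have := r.coe_nonneg
      push_cast
      constructor <;> linarith
  filter_upwards [hmem] with r hr
  simp only [Function.comp, zero_add, smul_eq_mul, mul_zero, add_zero]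
  rw [moveClamped, projIcc_of_mem _ hr, ← h.eq, ← h.eq]

theorem StickyExtension.isGeneratorPair_rtp (hω : 0 < ω) {f g : C(Icc (0 : ℝ) L, ℝ)}
    {F F' F'' : ℝ → ℝ} (h : StickyExtension ω hL f g F F' F'')
    {u d : Lp ℝ 2 (rtpMeasure ω L hL)} (hu : u =ᵐ[rtpMeasure ω L hL] fun z => f z.1)
    (hd : d =ᵐ[rtpMeasure ω L hL] freeDerivative hL F') :
    IsGeneratorPair (fun t => have := isMarkovKernel_rtpKernel hω hL t
      l2Operator (rtpKernel hω hL t) (rtpMeasure ω L hL) (isInvariantMeasure_rtpMeasure hω hL t))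
      u d := by
  have := isFiniteMeasure_rtpMeasure (ω := ω) hL
  obtain ⟨M, hM⟩ := exists_abs_le_Icc h.continuous' L
  let k : C(Icc (0 : ℝ) L × Velocity, ℝ) := ⟨fun z => f z.1, f.continuous.comp continuous_fst⟩
  have hB : ∀ z, jumpPart hω k z = 0 := fun z => by
    have e : jumpAverage hω (fun w => k (z.1, w)) z.2 = k z :=
      jumpAverage_const hω (f z.1) z.2
    rw [jumpPart, e, sub_self, mul_zero]
  have hexp : ∀ ε > 0, ∀ᶠ r : ℝ≥0 in 𝓝[>] 0, ∀ z,
      |(r : ℝ)⁻¹ * (rtpMean hω hL k r z - f z.1) -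
        (r : ℝ)⁻¹ * (f (moveClamped hL z.1 z.2 r) - f z.1)| ≤ ε := fun ε hε => by
    filter_upwards [eventually_abs_rtpMean_sub_le hω hL k hε, self_mem_nhdsWithin] with r hr hr0 z
    have hr0' : (0 : ℝ) < r := NNReal.coe_pos.2 hr0
    have h1 := hr z
    rw [hB, mul_zero, sub_zero] at h1
    rw [← mul_sub, sub_sub_sub_cancel_right, abs_mul, abs_inv, abs_of_pos hr0', inv_mul_le_iff₀ hr0']
    exact h1
  have hi : ∀ (r : ℝ≥0) z, ∫ y, f y.1 ∂rtpKernel hω hL r z = rtpMean hω hL k r z := fun r z =>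
    integral_rtpKernel hω hL k.continuous.measurable r z
  refine isGeneratorPair_l2Operator_of_bounded (isMarkovKernel_rtpKernel hω hL)
    (isInvariantMeasure_rtpMeasure hω hL) (u := fun z => f z.1) (C := 1 + 2 * M)
    (f.continuous.measurable.comp measurable_fst) (measurable_freeDerivative h.continuous')
    (fun z => (abs_freeDerivative_le hM z).trans (by linarith)) (fun z => ?_) ?_ hu hd
  · simp only [hi]
    have h1 : Tendsto (fun r : ℝ≥0 => (r : ℝ)⁻¹ * (rtpMean hω hL k r z - f z.1) -
        (r : ℝ)⁻¹ * (f (moveClamped hL z.1 z.2 r) - f z.1)) (𝓝[>] 0) (𝓝 0) := by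
      rw [Metric.tendsto_nhds]
      intro ε hε
      filter_upwards [hexp _ (half_pos hε)] with r hr
      rw [dist_zero_right, Real.norm_eq_abs]
      exact (hr z).trans_lt (half_lt_self hε)
    simpa using h1.add (h.tendsto_freeDerivative z)
  · filter_upwards [hexp 1 one_pos, self_mem_nhdsWithin] with r hr hr0 z
    have hr0' : (0 : ℝ) < r := NNReal.coe_pos.2 hr0
    rw [hi]
    have h1 : |(r : ℝ)⁻¹ * (f (moveClamped hL z.1 z.2 r) - f z.1)| ≤ 2 * M := by
      rw [abs_mul, abs_inv, abs_of_pos hr0', inv_mul_le_iff₀ hr0']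
      linarith [h.abs_sub_le hM z.1 z.2 r.coe_nonneg]
    have h2 := abs_sub_abs_le_abs_sub ((r : ℝ)⁻¹ * (rtpMean hω hL k r z - f z.1))
      ((r : ℝ)⁻¹ * (f (moveClamped hL z.1 z.2 r) - f z.1))
    linarith [hr z]

/-- A function that vanishes at the atoms is integrated over the interior only. -/
theorem integral_rtpMeasure_of_forall_ne (hω : 0 < ω) {h : Icc (0 : ℝ) L × Velocity → ℝ}
    (hh : Measurable h) {C : ℝ} (hC : ∀ z, |h z| ≤ C) (h1 : h (leftEnd hL, velNeg) = 0)
    (h2 : h (rightEnd hL, velPos) = 0) (h3 : ∀ x, h (x, velZero) = 0) {φ : Velocity → ℝ → ℝ}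
    (hφ : ∀ v (x : Icc (0 : ℝ) L), x ≠ leftEnd hL → x ≠ rightEnd hL → h (x, v) = φ v x) :
    ∫ z, h z ∂rtpMeasure ω L hL = (2 + ω * L)⁻¹ * (ω / 4 *
      ((∫ x in (0 : ℝ)..L, φ velNeg x) + ∫ x in (0 : ℝ)..L, φ velPos x)) := by
  have hv : ∀ v, ∫ x, h (x, v) ∂lebesgueIcc L = ∫ x in (0 : ℝ)..L, φ v x := fun v => by
    rw [integral_lebesgueIcc hL]
    refine intervalIntegral.integral_congr_ae ?_
    filter_upwards [Measure.ae_ne volume 0, Measure.ae_ne volume L] with x hx0 hxL hx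
    rw [uIoc_of_le hL.le] at hx
    rw [IccExtend_of_mem _ _ (Ioc_subset_Icc_self hx)]
    exact hφ v _ (fun e => hx0 (congrArg Subtype.val e)) (fun e => hxL (congrArg Subtype.val e))
  rw [integral_rtpMeasure hω hL hh hC, sum_velocity]
  simp only [hv velNeg, hv velPos, h1, h2, h3, leftWeight, rightWeight, bulkWeight]
  norm_num
  left
  ring

theorem freeDerivative_of_ne (F' : ℝ → ℝ) (v : Velocity) {x : Icc (0 : ℝ) L} (hl : x ≠ leftEnd hL)
    (hr : x ≠ rightEnd hL) : freeDerivative hL F' (x, v) = v.1 * F' x :=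
  if_neg (by rintro (e | e) <;> [exact hl (Prod.mk.inj e).1; exact hr (Prod.mk.inj e).1])

theorem freeDerivative_left (F' : ℝ → ℝ) : freeDerivative hL F' (leftEnd hL, velNeg) = 0 :=
  if_pos (Or.inl rfl)

theorem freeDerivative_right (F' : ℝ → ℝ) : freeDerivative hL F' (rightEnd hL, velPos) = 0 :=
  if_pos (Or.inr rfl)

theorem freeDerivative_velZero (F' : ℝ → ℝ) (x : Icc (0 : ℝ) L) :
    freeDerivative hL F' (x, velZero) = 0 := by
  unfold freeDerivative; split_ifs <;> simp

/-- The first-order part of the generator averages to zero over the velocities. -/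
theorem integral_freeDerivative_mul (hω : 0 < ω) {F' : ℝ → ℝ} (hF' : Continuous F')
    (g : C(Icc (0 : ℝ) L, ℝ)) :
    ∫ z, freeDerivative hL F' z * g z.1 ∂rtpMeasure ω L hL = 0 := by
  obtain ⟨M, hM⟩ := exists_abs_le_Icc hF' L
  have hD := abs_freeDerivative_le (hL := hL) hM
  rw [integral_rtpMeasure_of_forall_ne hω (h := fun z => freeDerivative hL F' z * g z.1)
    (C := 2 * M * ‖g‖) (φ := fun v x => v.1 * F' x * IccExtend hL.le g x)
    ((measurable_freeDerivative hF').mul (g.continuous.measurable.comp measurable_fst))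
    (fun z => by
      rw [abs_mul]
      exact mul_le_mul (hD z) (g.norm_coe_le_norm _) (abs_nonneg _) ((abs_nonneg _).trans (hD z)))
    (by simp [freeDerivative_left]) (by simp [freeDerivative_right])
    (fun x => by simp [freeDerivative_velZero])
    (fun v x hl hr => by rw [freeDerivative_of_ne F' v hl hr, IccExtend_val])]
  simp only [mul_assoc, intervalIntegral.integral_const_mul]
  push_cast
  ring

/-- The variance of the velocity turns the first-order part into the Dirichlet form. -/
theorem integral_freeDerivative_mul_freeDerivative (hω : 0 < ω) {F' G' : ℝ → ℝ}
    (hF' : Continuous F') (hG' : Continuous G') :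
    ∫ z, freeDerivative hL F' z * freeDerivative hL G' z ∂rtpMeasure ω L hL =
      (2 + ω * L)⁻¹ * (2 * ω * ∫ x in (0 : ℝ)..L, F' x * G' x) := by
  obtain ⟨M, hM⟩ := exists_abs_le_Icc hF' L
  obtain ⟨N, hN⟩ := exists_abs_le_Icc hG' L
  have hD := abs_freeDerivative_le (hL := hL) hM
  rw [integral_rtpMeasure_of_forall_ne hω
    (h := fun z => freeDerivative hL F' z * freeDerivative hL G' z)
    (C := 2 * M * (2 * N)) (φ := fun v x => (v.1 * v.1 : ℝ) * (F' x * G' x))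
    ((measurable_freeDerivative hF').mul (measurable_freeDerivative hG'))
    (fun z => by
      rw [abs_mul]
      exact mul_le_mul (hD z) (abs_freeDerivative_le hN z) (abs_nonneg _)
        ((abs_nonneg _).trans (hD z)))
    (by simp [freeDerivative_left]) (by simp [freeDerivative_right])
    (fun x => by simp [freeDerivative_velZero])
    (fun v x hl hr => by
      rw [freeDerivative_of_ne F' v hl hr, freeDerivative_of_ne G' v hl hr]; ring)]
  simp only [intervalIntegral.integral_const_mul]
  push_cast
  ring

theorem inner_eq_integral {E : Type*} [MeasurableSpace E] {μ : Measure E} {f g : Lp ℝ 2 μ}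
    {u v : E → ℝ} (hf : f =ᵐ[μ] u) (hg : g =ᵐ[μ] v) : inner ℝ f g = ∫ z, u z * v z ∂μ := by
  rw [L2.inner_def]
  refine integral_congr_ae ?_
  filter_upwards [hf, hg] with z h1 h2
  rw [h1, h2]
  exact mul_comm _ _

theorem isSecondOrderLift_rtp (hω : 0 < ω) {κ : ℝ≥0 → Kernel (Icc (0 : ℝ) L) (Icc (0 : ℝ) L)}
    (hκ : IsFellerSemigroup κ) (h : fellerGenerator hκ = stickyGenerator ω L hL) :
    IsSecondOrderLift (rtpKernel hω hL) (rtpMeasure ω L hL) κ (stickyMeasure ω L hL) Prod.fst where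
  semigroup' := (isFellerSemigroup_rtpKernel hω hL).toIsMarkovSemigroup
  prob' := isProbabilityMeasure_rtpMeasure hω hL
  invariant' := isInvariantMeasure_rtpMeasure hω hL
  semigroup := hκ.toIsMarkovSemigroup
  invariant := sticky_isInvariantMeasure hω hκ h
  reversible := sticky_isReversible hω hκ h
  surjective x := ⟨(x, velZero), rfl⟩
  measurePreserving := measurePreserving_fst_rtpMeasure hω hL
  exists_core := by
    have := isFiniteMeasure_rtpMeasure (ω := ω) hL
    have hπ := measurePreserving_fst_rtpMeasure hω hL
    have hμ := sticky_isInvariantMeasure hω hκ h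
    have hD : ∀ F' : ℝ → ℝ, Continuous F' →
        MemLp (freeDerivative hL F') 2 (rtpMeasure ω L hL) := fun F' hF' => by
      obtain ⟨M, hM⟩ := exists_abs_le_Icc hF' L
      exact MemLp.of_bound (measurable_freeDerivative hF').aestronglyMeasurable (2 * M)
        (Eventually.of_forall (abs_freeDerivative_le hM))
    have hcomp : ∀ f : C(Icc (0 : ℝ) L, ℝ), Lp.compMeasurePreserving Prod.fst hπ
        (stickyToL2 ω L hL f) =ᵐ[rtpMeasure ω L hL] fun z => f z.1 := fun f =>
      (Lp.coeFn_compMeasurePreserving _ hπ).trans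
        (hπ.quasiMeasurePreserving.ae_eq_comp (ContinuousMap.coeFn_toLp _ f))
    have hgen : ∀ {f g : C(Icc (0 : ℝ) L, ℝ)} {F F' F'' : ℝ → ℝ}
        (hF : StickyExtension ω hL f g F F' F''),
        (Lp.compMeasurePreserving Prod.fst hπ (stickyToL2 ω L hL f),
          (hD F' hF.continuous').toLp _) ∈ (l2Generator
            (isFellerSemigroup_rtpKernel hω hL).toIsMarkovSemigroup
            (isInvariantMeasure_rtpMeasure hω hL)).graph := fun hF =>
      mem_graph_semigroupGenerator.2 (hF.isGeneratorPair_rtp hω (hcomp _) (MemLp.coeFn_toLp _))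
    have hext : ∀ f ∈ (fellerGenerator hκ).domain,
        ∃ g F F' F'', StickyExtension ω hL f g F F' F'' := by
      rw [h]
      exact fun f hf => ⟨_, exists_stickyExtension ⟨f, hf⟩⟩
    refine ⟨_, sticky_hasCore hω hκ h hμ, ?_, ?_⟩
    · rintro _ ⟨f, hf, rfl⟩
      obtain ⟨g, F, F', F'', hF⟩ := hext f hf
      exact LinearPMap.mem_domain_of_mem_graph (hgen hF)
    · rintro _ ⟨f, hf, rfl⟩ _ ⟨u, hu, rfl⟩ D D' v hD₁ hD₂ hv
      obtain ⟨g, F, F', F'', hF⟩ := hext f hf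
      obtain ⟨w, U, U', U'', hU⟩ := hext u hu
      have e1 := IsGeneratorPair.unique (mem_graph_semigroupGenerator.1 hD₁)
        (mem_graph_semigroupGenerator.1 (hgen hF))
      have e2 := IsGeneratorPair.unique (mem_graph_semigroupGenerator.1 hD₂)
        (mem_graph_semigroupGenerator.1 (hgen hU))
      have e3 := IsGeneratorPair.unique (mem_graph_semigroupGenerator.1 hv)
        (isGeneratorPair_l2Operator hκ hμ
          ((isGeneratorPair_of_stickyExtension hκ h).2 ⟨U, U', U'', hU⟩))
      subst e1 e2 e3
      refine ⟨?_, ?_⟩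
      · rw [inner_eq_integral (MemLp.coeFn_toLp _) (hcomp u)]
        exact integral_freeDerivative_mul hω hF.continuous' u
      · rw [inner_eq_integral (MemLp.coeFn_toLp _) (MemLp.coeFn_toLp _),
          integral_freeDerivative_mul_freeDerivative hω hF.continuous' hU.continuous',
          inner_eq_integral (f := stickyToL2 ω L hL f) (ContinuousMap.coeFn_toLp _ f)
            (ContinuousMap.coeFn_toLp _ w),
          hF.integral_mul hω hU]
        ring

end Lift

end SecondOrderLift

end

theorem theorem2p5 (ω L : ℝ) (hω : 0 < ω) (hL : 0 < L) :
    -- sticky Brownian motion exists and is unique in law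
    (∃! κ : ℝ≥0 → Kernel (Icc (0 : ℝ) L) (Icc (0 : ℝ) L), IsStickyBrownianMotion ω L hL κ) ∧
    ∀ (κ : ℝ≥0 → Kernel (Icc (0 : ℝ) L) (Icc (0 : ℝ) L)) (hκ : IsFellerSemigroup κ),
      fellerGenerator hκ = stickyGenerator ω L hL →
      -- unique invariant probability measure
      IsProbabilityMeasure (stickyMeasure ω L hL) ∧
      (∀ ν : Measure (Icc (0 : ℝ) L), IsProbabilityMeasure ν →
        (IsInvariantMeasure κ ν ↔ ν = stickyMeasure ω L hL)) ∧
      -- the `L²`-generator extends the `C⁰`-generator, whose domain is a core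
      (∃ hμ : IsInvariantMeasure κ (stickyMeasure ω L hL),
        (∀ f : (fellerGenerator hκ).domain,
          (stickyToL2 ω L hL f, stickyToL2 ω L hL (fellerGenerator hκ f)) ∈
            (l2Generator hκ.toIsMarkovSemigroup hμ).graph) ∧
        (l2Generator hκ.toIsMarkovSemigroup hμ).IsClosed ∧
        (l2Generator hκ.toIsMarkovSemigroup hμ).HasCore
          ((fellerGenerator hκ).domain.map (stickyToL2 ω L hL))) ∧
      -- the jamming run-and-tumble process is a second-order lift
      IsSecondOrderLift (rtpKernel hω hL) (rtpMeasure ω L hL) κ (stickyMeasure ω L hL)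
        Prod.fst := by
  refine ⟨existsUnique_stickyBrownianMotion hω hL, fun κ hκ h => ?_⟩
  have hμ := sticky_isInvariantMeasure hω hκ h
  refine ⟨isProbabilityMeasure_stickyMeasure hω hL, fun ν hν => ⟨fun hi => ?_, ?_⟩,
    ⟨hμ, sticky_mem_graph_l2Generator hκ hμ, sticky_isClosed_l2Generator hκ hμ,
      sticky_hasCore hω hκ h hμ⟩, isSecondOrderLift_rtp hω hκ h⟩
  · exact sticky_invariant_unique hω hκ h ν hi
  · rintro rfl
    exact hμ
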